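/- Let $\Gamma_0^+(3)\subset \mathrm{SL}(2,\mathbb R)$ be the group consisting of the matrices of determinant $1$ of the form $\begin{pmatrix}a&b\\3c&d\end{pmatrix}$ or $\frac1{\sqrt3}\begin{pmatrix}3a&b\\3c&3d\end{pmatrix}$ with $a,b,c,d\in\mathbb Z$, and let $\chi$ be the (unique) character of $\Gamma_0^+(3)$ with $$\chi\Big(\tfrac1{\sqrt3}\begin{pmatrix}0&-1\\3&0\end{pmatrix}\Big)=\chi\Big(\tfrac1{\sqrt3}\begin{pmatrix}3&-1\\3&0\end{pmatrix}\Big)=-i .$$ For an integer $w$ and a nonnegative integer $k$, let $\widetilde{\mathscr M}_w^{\le1}(\Gamma_0^+(3),\chi^k)$ be the space of quasimodular forms of weight $w$, depth $\le 1$ and character $\chi^k$, i.e. of the holomorphic parts $f_0$ of functions $F(z)=f_0(z)+f_1(z)/(z-\bar z)$ on the upper half-plane $\mathbb H$ with $f_0,f_1$ holomorphic, $F(\gamma z)=\chi(\gamma)^k(cz+d)^wF(z)$ for all $\gamma=\begin{pmatrix}a&b\\c&d\end{pmatrix}\in\Gamma_0^+(3)$, and $F$ having a finite limit at each cusp. An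 element $f$ of this space is called extremal if its vanishing order at $\infty$ (its order in $q=e^{2\pi i z}$) equals $\dim\widetilde{\mathscr M}_w^{\le1}(\Gamma_0^+(3),\chi^k)-1$. Put $$M_2(z)=\frac{3E_2(3z)-E_2(z)}2,\qquad M_4(z)=\frac{9E_4(3z)+E_4(z)}{10},\qquad M_6(z)=\eta(z)^6\eta(3z)^6,$$ where $E_2,E_4$ are the Eisenstein series on $\mathrm{SL}(2,\mathbb Z)$ with constant term $1$ and $\eta$ is the Dedekind eta function. Then $M_4=M_2^2$, and for every nonnegative integer $k$ and every holomorphic branch of $M_6^{k/2}$ on $\mathbb H$: (i) If $f$ is an extremal quasimodular form in $\widetilde{\mathscr M}_{3k}^{\le1}(\Gamma_0^+(3),\chi^k)$, then $y=f/M_6^{k/2}$ is a holomorphic solution on $\mathbb H$ of $$y''(z)=-4\pi^2\Big(\frac k2\Big)^2M_4(z)\,y(z).$$ (ii) If $f$ is an extremal quasimodular form in $\widetilde{\mathscr M}_{3k+2}^{\le1}(\Gamma_0^+(3),\chi^k)$, then $y=f/(M_6^{k/2}M_2)$, which is meromorphic on $\mathbb H$ and holomorphic outside the zeros of $M_2$,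 satisfies, outside the zeros of $M_2$, $$y''(z)=-4\pi^2\Big(\Big(\frac k2\Big)^2M_4(z)-18\,\frac{M_6(z)}{M_2(z)}\Big)y(z).$$ -/

import Mathlib

open UpperHalfPlane hiding I
open Complex Filter Topology
open scoped MatrixGroups ModularForm Manifold

namespace QuasiThree

noncomputable section

/-! ### The group `Γ₀⁺(3)` -/

/-- The elements of `Γ₀(3)`, as real matrices. -/
def IsGammaZero (A : SL(2, ℝ)) : Prop :=
  ∃ a b c d : ℤ, (A : Matrix (Fin 2) (Fin 2) ℝ) = !![(a : ℝ), b; 3 * c, d]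

/-- The Atkin-Lehner coset `W₃`, i.e. the matrices `3^{-1/2} (3a, b; 3c, 3d)` of determinant `1`. -/
def IsAtkinLehner (A : SL(2, ℝ)) : Prop :=
  ∃ a b c d : ℤ, (A : Matrix (Fin 2) (Fin 2) ℝ) =
    (1 / √3 : ℝ) • !![(3 * a : ℝ), b; 3 * c, 3 * d]

lemma sq3 : (√3 : ℝ) * √3 = 3 := Real.mul_self_sqrt (by norm_num)

lemma s3_ne : (√3 : ℝ) ≠ 0 := by positivity

lemma isGammaZero_iff (A : SL(2, ℝ)) : IsGammaZero A ↔ ∃ a b c d : ℤ,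
    A 0 0 = a ∧ A 0 1 = b ∧ A 1 0 = 3 * c ∧ A 1 1 = d := by
  simp only [IsGammaZero, ← Matrix.ext_iff, Fin.forall_fin_two]
  simp [and_assoc]

lemma isAtkinLehner_iff (A : SL(2, ℝ)) : IsAtkinLehner A ↔ ∃ a b c d : ℤ,
    A 0 0 = √3 * a ∧ A 0 1 = b / √3 ∧ A 1 0 = √3 * c ∧ A 1 1 = √3 * d := by
  have h : ∀ x : ℝ, (√3)⁻¹ * (3 * x) = √3 * x := fun x => by
    rw [← mul_assoc]; congr 1
    rw [inv_mul_eq_iff_eq_mul₀ s3_ne, sq3]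
  simp only [IsAtkinLehner, ← Matrix.ext_iff, Fin.forall_fin_two]
  simp [and_assoc, h, div_eq_inv_mul]

lemma det_eq (A : SL(2, ℝ)) : A 0 0 * A 1 1 - A 0 1 * A 1 0 = 1 := by
  have := A.det_coe
  rwa [Matrix.det_fin_two] at this

lemma mul_entries (A B : SL(2, ℝ)) :
    (A * B) 0 0 = A 0 0 * B 0 0 + A 0 1 * B 1 0 ∧ (A * B) 0 1 = A 0 0 * B 0 1 + A 0 1 * B 1 1 ∧
    (A * B) 1 0 = A 1 0 * B 0 0 + A 1 1 * B 1 0 ∧ (A * B) 1 1 = A 1 0 * B 0 1 + A 1 1 * B 1 1 := by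
  simp [Matrix.SpecialLinearGroup.coe_mul, Matrix.mul_apply, Fin.sum_univ_two]

lemma inv_entries (A : SL(2, ℝ)) : A⁻¹ 0 0 = A 1 1 ∧ A⁻¹ 0 1 = -A 0 1 ∧ A⁻¹ 1 0 = -A 1 0 ∧
    A⁻¹ 1 1 = A 0 0 := by
  simp [Matrix.SpecialLinearGroup.SL2_inv_expl]

lemma ext_entries {A B : SL(2, ℝ)} (h1 : A 0 0 = B 0 0) (h2 : A 0 1 = B 0 1)
    (h3 : A 1 0 = B 1 0) (h4 : A 1 1 = B 1 1) : A = B := by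
  apply Subtype.ext
  ext i j
  fin_cases i <;> fin_cases j
  · exact h1
  · exact h2
  · exact h3
  · exact h4

lemma mul_GG {A B : SL(2, ℝ)} {a b c d a' b' c' d' : ℤ}
    (hA : A 0 0 = a ∧ A 0 1 = b ∧ A 1 0 = 3 * c ∧ A 1 1 = d)
    (hB : B 0 0 = a' ∧ B 0 1 = b' ∧ B 1 0 = 3 * c' ∧ B 1 1 = d') :
    (A * B) 0 0 = (a * a' + 3 * b * c' : ℤ) ∧ (A * B) 0 1 = (a * b' + b * d' : ℤ) ∧
    (A * B) 1 0 = 3 * (c * a' + d * c' : ℤ) ∧ (A * B) 1 1 = (3 * c * b' + d * d' : ℤ) := by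
  obtain ⟨h1, h2, h3, h4⟩ := mul_entries A B
  obtain ⟨a1, a2, a3, a4⟩ := hA
  obtain ⟨b1, b2, b3, b4⟩ := hB
  rw [h1, h2, h3, h4, a1, a2, a3, a4, b1, b2, b3, b4]
  push_cast
  refine ⟨?_, ?_, ?_, ?_⟩ <;> ring

lemma mul_GW {A B : SL(2, ℝ)} {a b c d a' b' c' d' : ℤ}
    (hA : A 0 0 = a ∧ A 0 1 = b ∧ A 1 0 = 3 * c ∧ A 1 1 = d)
    (hB : B 0 0 = √3 * a' ∧ B 0 1 = b' / √3 ∧ B 1 0 = √3 * c' ∧ B 1 1 = √3 * d') :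
    (A * B) 0 0 = √3 * (a * a' + b * c' : ℤ) ∧ (A * B) 0 1 = (a * b' + 3 * b * d' : ℤ) / √3 ∧
    (A * B) 1 0 = √3 * (3 * c * a' + d * c' : ℤ) ∧ (A * B) 1 1 = √3 * (c * b' + d * d' : ℤ) := by
  obtain ⟨h1, h2, h3, h4⟩ := mul_entries A B
  obtain ⟨a1, a2, a3, a4⟩ := hA
  obtain ⟨b1, b2, b3, b4⟩ := hB
  rw [h1, h2, h3, h4, a1, a2, a3, a4, b1, b2, b3, b4]
  have := s3_ne
  have h := sq3
  push_cast
  refine ⟨by ring, ?_, by ring, ?_⟩ <;> field_simp <;> grind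

lemma mul_WG {A B : SL(2, ℝ)} {a b c d a' b' c' d' : ℤ}
    (hA : A 0 0 = √3 * a ∧ A 0 1 = b / √3 ∧ A 1 0 = √3 * c ∧ A 1 1 = √3 * d)
    (hB : B 0 0 = a' ∧ B 0 1 = b' ∧ B 1 0 = 3 * c' ∧ B 1 1 = d') :
    (A * B) 0 0 = √3 * (a * a' + b * c' : ℤ) ∧ (A * B) 0 1 = (3 * a * b' + b * d' : ℤ) / √3 ∧
    (A * B) 1 0 = √3 * (c * a' + 3 * d * c' : ℤ) ∧ (A * B) 1 1 = √3 * (c * b' + d * d' : ℤ) := by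
  obtain ⟨h1, h2, h3, h4⟩ := mul_entries A B
  obtain ⟨a1, a2, a3, a4⟩ := hA
  obtain ⟨b1, b2, b3, b4⟩ := hB
  rw [h1, h2, h3, h4, a1, a2, a3, a4, b1, b2, b3, b4]
  have := s3_ne
  have h := sq3
  push_cast
  refine ⟨?_, ?_, by ring, by ring⟩ <;> field_simp <;> grind

lemma mul_WW {A B : SL(2, ℝ)} {a b c d a' b' c' d' : ℤ}
    (hA : A 0 0 = √3 * a ∧ A 0 1 = b / √3 ∧ A 1 0 = √3 * c ∧ A 1 1 = √3 * d)
    (hB : B 0 0 = √3 * a' ∧ B 0 1 = b' / √3 ∧ B 1 0 = √3 * c' ∧ B 1 1 = √3 * d') :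
    (A * B) 0 0 = (3 * a * a' + b * c' : ℤ) ∧ (A * B) 0 1 = (a * b' + b * d' : ℤ) ∧
    (A * B) 1 0 = 3 * (c * a' + d * c' : ℤ) ∧ (A * B) 1 1 = (c * b' + 3 * d * d' : ℤ) := by
  obtain ⟨h1, h2, h3, h4⟩ := mul_entries A B
  obtain ⟨a1, a2, a3, a4⟩ := hA
  obtain ⟨b1, b2, b3, b4⟩ := hB
  rw [h1, h2, h3, h4, a1, a2, a3, a4, b1, b2, b3, b4]
  have := s3_ne
  have h := sq3
  push_cast
  refine ⟨?_, ?_, ?_, ?_⟩ <;> field_simp <;> grind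

/-- The group `Γ₀⁺(3) = Γ₀(3) ∪ W₃ ⊆ SL(2, ℝ)`. -/
def GammaPlus : Subgroup SL(2, ℝ) where
  carrier := {A | IsGammaZero A ∨ IsAtkinLehner A}
  one_mem' := Or.inl ((isGammaZero_iff 1).2 ⟨1, 0, 0, 1, by simp⟩)
  mul_mem' := by
    intro A B hA hB
    rcases hA with hA | hA <;> rcases hB with hB | hB <;>
      simp only [isGammaZero_iff, isAtkinLehner_iff] at hA hB <;>
      obtain ⟨a, b, c, d, hA⟩ := hA <;> obtain ⟨a', b', c', d', hB⟩ := hB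
    · exact Or.inl ((isGammaZero_iff _).2 ⟨_, _, _, _, mul_GG hA hB⟩)
    · exact Or.inr ((isAtkinLehner_iff _).2 ⟨_, _, _, _, mul_GW hA hB⟩)
    · exact Or.inr ((isAtkinLehner_iff _).2 ⟨_, _, _, _, mul_WG hA hB⟩)
    · exact Or.inl ((isGammaZero_iff _).2 ⟨_, _, _, _, mul_WW hA hB⟩)
  inv_mem' := by
    intro A hA
    obtain ⟨h1, h2, h3, h4⟩ := inv_entries A
    rcases hA with hA | hA
    · obtain ⟨a, b, c, d, a1, a2, a3, a4⟩ := (isGammaZero_iff A).1 hA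
      refine Or.inl ((isGammaZero_iff _).2 ⟨d, -b, -c, a, ?_⟩)
      rw [h1, h2, h3, h4, a1, a2, a3, a4]
      simp
    · obtain ⟨a, b, c, d, a1, a2, a3, a4⟩ := (isAtkinLehner_iff A).1 hA
      refine Or.inr ((isAtkinLehner_iff _).2 ⟨d, -b, -c, a, ?_⟩)
      rw [h1, h2, h3, h4, a1, a2, a3, a4]
      refine ⟨rfl, ?_, ?_, rfl⟩ <;> push_cast <;> ring

/-- `S = 3^{-1/2} (0, -1; 3, 0)`. -/
def matS : GammaPlus :=
  ⟨⟨(1 / √3 : ℝ) • !![0, -1; 3, 0], by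
      rw [Matrix.det_smul, Matrix.det_fin_two_of, Fintype.card_fin, div_pow,
        Real.sq_sqrt (by norm_num)]; norm_num⟩,
    Or.inr ⟨0, -1, 1, 0, by simp⟩⟩

/-- `R = 3^{-1/2} (3, -1; 3, 0)`. -/
def matR : GammaPlus :=
  ⟨⟨(1 / √3 : ℝ) • !![3, -1; 3, 0], by
      rw [Matrix.det_smul, Matrix.det_fin_two_of, Fintype.card_fin, div_pow,
        Real.sq_sqrt (by norm_num)]; norm_num⟩,
    Or.inr ⟨1, -1, 1, 0, by simp⟩⟩

/-! ### The character `χ` -/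

/-- The Legendre symbol `(n / 3)`. -/
def leg (n : ℤ) : ℂ := ((quadraticChar (ZMod 3) (n : ZMod 3) : ℤ) : ℂ)

open Classical in
/-- `χ(γ) = (d / 3)` for `γ = (a, b; c, d)` in `Γ₀(3)`, and `χ(γ) = i (b / 3)` for
`γ = 3^{-1/2} (3a, b; 3c, 3d)` in `W₃`. -/
def chiFun (A : SL(2, ℝ)) : ℂ :=
  if IsGammaZero A then leg ⌊A 1 1⌋ else I * leg ⌊√3 * A 0 1⌋

lemma chiFun_G {A : SL(2, ℝ)} {a b c d : ℤ}
    (hA : A 0 0 = a ∧ A 0 1 = b ∧ A 1 0 = 3 * c ∧ A 1 1 = d) : chiFun A = leg d := by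
  have : IsGammaZero A := (isGammaZero_iff A).2 ⟨a, b, c, d, hA⟩
  simp [chiFun, this, hA.2.2.2]

lemma det_W {A : SL(2, ℝ)} {a b c d : ℤ}
    (hA : A 0 0 = √3 * a ∧ A 0 1 = b / √3 ∧ A 1 0 = √3 * c ∧ A 1 1 = √3 * d) :
    3 * a * d - b * c = 1 := by
  have h := det_eq A
  obtain ⟨a1, a2, a3, a4⟩ := hA
  rw [a1, a2, a3, a4] at h
  have h3 := s3_ne
  have hs := sq3
  have : (3 * a * d - b * c : ℝ) = 1 := by
    rw [← h]; field_simp; grind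
  exact_mod_cast this

lemma det_G {A : SL(2, ℝ)} {a b c d : ℤ}
    (hA : A 0 0 = a ∧ A 0 1 = b ∧ A 1 0 = 3 * c ∧ A 1 1 = d) : a * d - 3 * b * c = 1 := by
  have h := det_eq A
  obtain ⟨a1, a2, a3, a4⟩ := hA
  rw [a1, a2, a3, a4] at h
  have : (a * d - 3 * b * c : ℝ) = 1 := by rw [← h]; ring
  exact_mod_cast this

lemma chiFun_W {A : SL(2, ℝ)} {a b c d : ℤ}
    (hA : A 0 0 = √3 * a ∧ A 0 1 = b / √3 ∧ A 1 0 = √3 * c ∧ A 1 1 = √3 * d) :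
    chiFun A = I * leg b := by
  have hn : ¬ IsGammaZero A := by
    intro h
    obtain ⟨a', b', c', d', h1, h2, h3, h4⟩ := (isGammaZero_iff A).1 h
    have hb : (b : ℝ) = √3 * b' := by
      rw [← h2, hA.2.1]; field_simp [s3_ne]
    have hb2 : b * b = 3 * (b' * b') := by
      have : (b * b : ℝ) = 3 * (b' * b') := by rw [hb]; linear_combination ((b' : ℝ) * b') * sq3
      exact_mod_cast this
    have h3b : (3 : ℤ) ∣ b := by
      have : (3 : ℤ) ∣ b * b := ⟨_, hb2⟩
      exact (Int.prime_three.dvd_mul.1 this).elim id id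
    have hd := det_W hA
    obtain ⟨e, rfl⟩ := h3b
    have : (3 : ℤ) ∣ 1 := ⟨a * d - e * c, by rw [← hd]; ring⟩
    norm_num at this
  have : √3 * A 0 1 = b := by rw [hA.2.1]; field_simp [s3_ne]
  simp [chiFun, hn, this]

lemma leg_mul (m n : ℤ) : leg (m * n) = leg m * leg n := by
  simp only [leg, Int.cast_mul, map_mul]

lemma leg_congr {m n : ℤ} (h : (m : ZMod 3) = n) : leg m = leg n := by simp [leg, h]

lemma leg_inv {m n : ℤ} (h : (m : ZMod 3) * n = 1) : leg m = leg n := by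
  have key : ∀ x y : ZMod 3, x * y = 1 → x = y := by decide
  exact leg_congr (key _ _ h)

lemma leg_neg_one : leg (-1) = -1 := by
  have : quadraticChar (ZMod 3) (-1) = -1 := by decide
  simp [leg, this]

lemma three_zero : (3 : ZMod 3) = 0 := by decide

lemma chiFun_mul {A B : SL(2, ℝ)} (hA : A ∈ GammaPlus) (hB : B ∈ GammaPlus) :
    chiFun (A * B) = chiFun A * chiFun B := by
  have h3 := three_zero
  rcases hA with hA | hA <;> rcases hB with hB | hB <;>
    simp only [isGammaZero_iff, isAtkinLehner_iff] at hA hB <;>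
    obtain ⟨a, b, c, d, hA⟩ := hA <;> obtain ⟨a', b', c', d', hB⟩ := hB
  · rw [chiFun_G (mul_GG hA hB), chiFun_G hA, chiFun_G hB, ← leg_mul]
    exact leg_congr (by push_cast; simp [h3])
  · rw [chiFun_W (mul_GW hA hB), chiFun_G hA, chiFun_W hB]
    have hd := congrArg (Int.cast : ℤ → ZMod 3) (det_G hA)
    have : leg a = leg d := leg_inv (by push_cast at hd; simpa [h3] using hd)
    rw [← this, mul_left_comm, ← leg_mul]
    congr 1
    exact leg_congr (by push_cast; simp [h3])
  · rw [chiFun_W (mul_WG hA hB), chiFun_W hA, chiFun_G hB, mul_assoc I, ← leg_mul]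
    congr 1
    exact leg_congr (by push_cast; simp [h3])
  · rw [chiFun_G (mul_WW hA hB), chiFun_W hA, chiFun_W hB]
    have hd := congrArg (Int.cast : ℤ → ZMod 3) (det_W hA)
    have h1 : leg c = leg (-1 * b) := leg_inv (by
      push_cast at hd ⊢
      simp only [h3, zero_mul, zero_sub] at hd
      linear_combination hd)
    rw [leg_congr (n := c * b') (by push_cast; simp [h3]), leg_mul, h1, leg_mul, leg_neg_one]
    linear_combination (-(leg b * leg b')) * I_mul_I

/-- The character `χ` of `Γ₀⁺(3)`; it is the unique one with `χ(S) = χ(R) = -i`, see `chi_matS`,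
`chi_matR` and `chi_unique`. -/
def chi : GammaPlus →* ℂ where
  toFun A := chiFun A
  map_one' := by
    have : chiFun 1 = leg 1 := chiFun_G (a := 1) (b := 0) (c := 0) (d := 1) (by simp)
    simpa [leg] using this
  map_mul' A B := chiFun_mul A.2 B.2

lemma matS_entries : (matS : SL(2, ℝ)) 0 0 = √3 * (0 : ℤ) ∧ (matS : SL(2, ℝ)) 0 1 = (-1 : ℤ) / √3 ∧
    (matS : SL(2, ℝ)) 1 0 = √3 * (1 : ℤ) ∧ (matS : SL(2, ℝ)) 1 1 = √3 * (0 : ℤ) := by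
  have h : (√3)⁻¹ * 3 = √3 := by rw [inv_mul_eq_iff_eq_mul₀ s3_ne, sq3]
  simp [matS, h, neg_div]

lemma matR_entries : (matR : SL(2, ℝ)) 0 0 = √3 * (1 : ℤ) ∧ (matR : SL(2, ℝ)) 0 1 = (-1 : ℤ) / √3 ∧
    (matR : SL(2, ℝ)) 1 0 = √3 * (1 : ℤ) ∧ (matR : SL(2, ℝ)) 1 1 = √3 * (0 : ℤ) := by
  have h : (√3)⁻¹ * 3 = √3 := by rw [inv_mul_eq_iff_eq_mul₀ s3_ne, sq3]
  simp [matR, h, neg_div]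

theorem chi_matS : chi matS = -I := by
  change chiFun matS = -I
  rw [chiFun_W matS_entries, leg_neg_one]; ring

theorem chi_matR : chi matR = -I := by
  change chiFun matR = -I
  rw [chiFun_W matR_entries, leg_neg_one]; ring

/-- `T = R S⁻¹ = (1, 1; 0, 1)` and its powers. -/
lemma T_zpow_entries (n : ℤ) : (((matR * matS⁻¹) ^ n : GammaPlus) : SL(2, ℝ)) 0 0 = 1 ∧
    (((matR * matS⁻¹) ^ n : GammaPlus) : SL(2, ℝ)) 0 1 = n ∧
    (((matR * matS⁻¹) ^ n : GammaPlus) : SL(2, ℝ)) 1 0 = 0 ∧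
    (((matR * matS⁻¹) ^ n : GammaPlus) : SL(2, ℝ)) 1 1 = 1 := by
  have hs := sq3
  have h0 := s3_ne
  obtain ⟨r1, r2, r3, r4⟩ := matR_entries
  obtain ⟨s1, s2, s3, s4⟩ := matS_entries
  have base : ∀ m : ℕ, (((matR * matS⁻¹) ^ m : GammaPlus) : SL(2, ℝ)) 0 0 = 1 ∧
      (((matR * matS⁻¹) ^ m : GammaPlus) : SL(2, ℝ)) 0 1 = m ∧
      (((matR * matS⁻¹) ^ m : GammaPlus) : SL(2, ℝ)) 1 0 = 0 ∧
      (((matR * matS⁻¹) ^ m : GammaPlus) : SL(2, ℝ)) 1 1 = 1 := by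
    intro m
    induction m with
    | zero => simp
    | succ m ih =>
      obtain ⟨i1, i2, i3, i4⟩ := ih
      obtain ⟨t1, t2, t3, t4⟩ := mul_entries (matR : SL(2, ℝ)) (matS : SL(2, ℝ))⁻¹
      obtain ⟨v1, v2, v3, v4⟩ := inv_entries (matS : SL(2, ℝ))
      rw [pow_succ, Subgroup.coe_mul, Subgroup.coe_mul, Subgroup.coe_inv]
      obtain ⟨e1, e2, e3, e4⟩ := mul_entries (((matR * matS⁻¹) ^ m : GammaPlus) : SL(2, ℝ))
        ((matR : SL(2, ℝ)) * (matS : SL(2, ℝ))⁻¹)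
      rw [e1, e2, e3, e4, i1, i2, i3, i4, t1, t2, t3, t4, v1, v2, v3, v4, r1, r2, r3, r4, s1, s2,
        s3, s4]
      push_cast
      refine ⟨?_, ?_, ?_, ?_⟩ <;> field_simp <;> grind
  obtain ⟨m, rfl | rfl⟩ := n.eq_nat_or_neg
  · simpa using base m
  · obtain ⟨i1, i2, i3, i4⟩ := base m
    rw [zpow_neg, zpow_natCast, Subgroup.coe_inv]
    obtain ⟨v1, v2, v3, v4⟩ := inv_entries (((matR * matS⁻¹) ^ m : GammaPlus) : SL(2, ℝ))
    rw [v1, v2, v3, v4, i1, i2, i3, i4]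
    simp

/-- `S` and `R` generate `Γ₀⁺(3)`. -/
theorem closure_matS_matR : Subgroup.closure {matS, matR} = ⊤ := by
  set H := Subgroup.closure {matS, matR} with hH
  have hS : matS ∈ H := Subgroup.subset_closure (by simp)
  have hR : matR ∈ H := Subgroup.subset_closure (by simp)
  have hT : ∀ n : ℤ, (matR * matS⁻¹) ^ n ∈ H := fun n => H.zpow_mem (H.mul_mem hR (H.inv_mem hS)) n
  have sqint : ∀ A : GammaPlus, ∃ m : ℕ, ((A : SL(2, ℝ)) 1 0) ^ 2 = m := by
    rintro ⟨A, hA | hA⟩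
    · obtain ⟨a, b, c, d, -, -, h, -⟩ := (isGammaZero_iff A).1 hA
      refine ⟨9 * c.natAbs ^ 2, ?_⟩
      have : (c.natAbs : ℝ) ^ 2 = (c : ℝ) ^ 2 := by
        rw [Nat.cast_natAbs, Int.cast_abs, sq_abs]
      change A 1 0 ^ 2 = _
      rw [h]; rw [Nat.cast_mul, Nat.cast_pow]; rw [this]; push_cast; ring
    · obtain ⟨a, b, c, d, -, -, h, -⟩ := (isAtkinLehner_iff A).1 hA
      refine ⟨3 * c.natAbs ^ 2, ?_⟩
      have : (c.natAbs : ℝ) ^ 2 = (c : ℝ) ^ 2 := by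
        rw [Nat.cast_natAbs, Int.cast_abs, sq_abs]
      change A 1 0 ^ 2 = _
      rw [h]; rw [Nat.cast_mul, Nat.cast_pow]; rw [this, mul_pow, sq √3, sq3]; rfl
  have main : ∀ m : ℕ, ∀ A : GammaPlus, ((A : SL(2, ℝ)) 1 0) ^ 2 = m → A ∈ H := by
    intro m
    induction m using Nat.strong_induction_on with
    | _ m ih =>
    intro A hm
    by_cases h0 : (A : SL(2, ℝ)) 1 0 = 0
    · rcases A.2 with hA | hA
      · obtain ⟨a, b, c, d, hh⟩ := (isGammaZero_iff _).1 hA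
        have hd := det_G hh
        have hc : c = 0 := by
          have := hh.2.2.1
          rw [h0] at this
          have : (c : ℝ) = 0 := by linarith
          exact_mod_cast this
        subst hc
        have had : a * d = 1 := by linarith
        obtain ⟨x1, x2, x3, x4⟩ := hh
        rcases Int.mul_eq_one_iff_eq_one_or_neg_one.1 had with ⟨rfl, rfl⟩ | ⟨rfl, rfl⟩
        · have : A = (matR * matS⁻¹) ^ b := by
            obtain ⟨t1, t2, t3, t4⟩ := T_zpow_entries b
            apply Subtype.ext
            exact ext_entries (by rw [x1, t1]; simp) (by rw [x2, t2]) (by rw [x3, t3]; simp)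
              (by rw [x4, t4]; simp)
          rw [this]; exact hT b
        · have : A = matS * matS * (matR * matS⁻¹) ^ (-b) := by
            obtain ⟨t1, t2, t3, t4⟩ := T_zpow_entries (-b)
            obtain ⟨s1, s2, s3, s4⟩ := mul_WW matS_entries matS_entries
            obtain ⟨e1, e2, e3, e4⟩ := mul_entries ((matS : SL(2, ℝ)) * (matS : SL(2, ℝ)))
              (((matR * matS⁻¹) ^ (-b) : GammaPlus) : SL(2, ℝ))
            rw [t1, t2, t3, t4, s1, s2, s3, s4] at *
            apply Subtype.ext
            rw [Subgroup.coe_mul, Subgroup.coe_mul]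
            exact ext_entries (x1.trans (by rw [e1]; simp)) (x2.trans (by rw [e2]; simp))
              (x3.trans (by rw [e3]; simp)) (x4.trans (by rw [e4]; simp))
          rw [this]; exact H.mul_mem (H.mul_mem hS hS) (hT _)
      · obtain ⟨a, b, c, d, hh⟩ := (isAtkinLehner_iff _).1 hA
        have hd := det_W hh
        have hc : c = 0 := by
          have h := hh.2.2.1
          rw [h0] at h
          have : (c : ℝ) = 0 := by
            rcases mul_eq_zero.1 h.symm with h | h
            · exact absurd h s3_ne
            · exact h
          exact_mod_cast this
        subst hc
        have : (3 : ℤ) ∣ 1 := ⟨a * d, by linarith⟩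
        norm_num at this
    · set x : ℝ := (A : SL(2, ℝ)) 1 1 / (A : SL(2, ℝ)) 1 0 with hx
      set n : ℤ := -round x with hn
      set B : GammaPlus := A * (matR * matS⁻¹) ^ n * matS with hB
      have hB10 : (B : SL(2, ℝ)) 1 0 = √3 * ((A : SL(2, ℝ)) 1 0 * (x - round x)) := by
        obtain ⟨t1, t2, t3, t4⟩ := T_zpow_entries n
        obtain ⟨s1, s2, s3, s4⟩ := matS_entries
        obtain ⟨-, -, e3, e4⟩ := mul_entries (A : SL(2, ℝ))
          (((matR * matS⁻¹) ^ n : GammaPlus) : SL(2, ℝ))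
        obtain ⟨-, -, f3, -⟩ := mul_entries ((A : SL(2, ℝ)) *
          (((matR * matS⁻¹) ^ n : GammaPlus) : SL(2, ℝ))) (matS : SL(2, ℝ))
        rw [hB, Subgroup.coe_mul, Subgroup.coe_mul, f3, e3, e4, t1, t2, t3, t4, s1, s3, hn, hx]
        push_cast
        field_simp
        ring
      obtain ⟨m', hm'⟩ := sqint B
      have hr := abs_sub_round x
      have hr2 : (x - round x) ^ 2 ≤ 1 / 4 := by
        have := sq_le_sq' (neg_le_of_abs_le hr) (le_of_abs_le hr)
        linarith
      have hlt : m' < m := by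
        have h1 : (0 : ℝ) < m := by rw [← hm]; positivity
        have : (m' : ℝ) < m := by
          rw [← hm', hB10, mul_pow, mul_pow, hm, Real.sq_sqrt (by norm_num)]
          nlinarith
        exact_mod_cast this
      have hBH := ih m' hlt B hm'
      have : A = B * matS⁻¹ * ((matR * matS⁻¹) ^ n)⁻¹ := by rw [hB]; group
      rw [this]
      exact H.mul_mem (H.mul_mem hBH (H.inv_mem hS)) (H.inv_mem (hT n))
  rw [eq_top_iff]
  intro A _
  obtain ⟨m, hm⟩ := sqint A
  exact main m A hm

theorem chi_unique (ψ : GammaPlus →* ℂ) (hS : ψ matS = -I) (hR : ψ matR = -I) : ψ = chi := by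
  apply MonoidHom.eq_of_eqOn_dense closure_matS_matR
  rintro x (rfl | rfl)
  · rw [hS, chi_matS]
  · rw [hR, chi_matR]

/-! ### Quasimodular forms with character -/

/-- The nearly holomorphic function `∑_{j ≤ r} c_j(z) / (z - z̄)^j`. -/
def nearlyHol {r : ℕ} (c : Fin (r + 1) → ℍ → ℂ) (z : ℍ) : ℂ :=
  ∑ j, c j z / ((z : ℂ) - (starRingEnd ℂ) (z : ℂ)) ^ (j : ℕ)

/-- `F` transforms under `Γ` with weight `k` and character `χ`, i.e.
`F(γz) = χ(γ) (cz + d)^k F(z)`, and has a finite limit at every cusp of `Γ`. -/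
structure IsModularWith (Γ : Subgroup SL(2, ℝ)) (χ : Γ →* ℂ) (k : ℤ) (F : ℍ → ℂ) : Prop where
  slash_eq : ∀ γ : Γ, F ∣[k] ((γ : SL(2, ℝ)) : GL (Fin 2) ℝ) = χ γ • F
  limit_at_cusp : ∀ g : SL(2, ℝ),
    IsCusp ((g : GL (Fin 2) ℝ) • OnePoint.infty)
      (Γ.map (Matrix.SpecialLinearGroup.toGL : SL(2, ℝ) →* GL (Fin 2) ℝ)) →
    ∃ L : ℂ, Tendsto (F ∣[k] (g : GL (Fin 2) ℝ)) atImInfty (𝓝 L)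

lemma slash_smul (a : ℂ) (k : ℤ) (g : SL(2, ℝ)) (F : ℍ → ℂ) :
    (a • F) ∣[k] (g : GL (Fin 2) ℝ) = a • (F ∣[k] (g : GL (Fin 2) ℝ)) := by
  rw [ModularForm.smul_slash]
  simp [UpperHalfPlane.σ]

/-- The space of quasimodular forms of weight `k`, depth `≤ r` and character `χ` on `Γ`: the
holomorphic parts `c 0` of the nearly holomorphic modular forms `∑_{j ≤ r} c_j(z) / (z - z̄)^j`. -/
def quasimodular (Γ : Subgroup SL(2, ℝ)) (χ : Γ →* ℂ) (k : ℤ) (r : ℕ) :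
    Submodule ℂ (ℍ → ℂ) where
  carrier := {f | ∃ c : Fin (r + 1) → ℍ → ℂ, (∀ j, MDifferentiable 𝓘(ℂ) 𝓘(ℂ) (c j)) ∧
    IsModularWith Γ χ k (nearlyHol c) ∧ c 0 = f}
  zero_mem' := by
    have h0 : nearlyHol (fun _ : Fin (r + 1) => (0 : ℍ → ℂ)) = 0 := by
      ext z; simp [nearlyHol]
    refine ⟨fun _ => 0, fun _ => mdifferentiable_const, ?_, rfl⟩
    rw [h0]
    refine ⟨fun γ => by simp, fun g _ => ⟨0, ?_⟩⟩
    rw [SlashAction.zero_slash]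
    exact tendsto_const_nhds
  add_mem' := by
    rintro _ _ ⟨c, hc, ⟨hm, hl⟩, rfl⟩ ⟨c', hc', ⟨hm', hl'⟩, rfl⟩
    have hadd : nearlyHol (fun j => c j + c' j) = nearlyHol c + nearlyHol c' := by
      ext z; simp [nearlyHol, add_div, Finset.sum_add_distrib]
    refine ⟨fun j => c j + c' j, fun j => (hc j).add (hc' j), ?_, rfl⟩
    rw [hadd]
    refine ⟨fun γ => by rw [SlashAction.add_slash, hm, hm', smul_add], fun g hg => ?_⟩
    obtain ⟨L, hL⟩ := hl g hg
    obtain ⟨L', hL'⟩ := hl' g hg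
    refine ⟨L + L', ?_⟩
    rw [SlashAction.add_slash]
    exact hL.add hL'
  smul_mem' := by
    rintro a _ ⟨c, hc, ⟨hm, hl⟩, rfl⟩
    have hsm : nearlyHol (fun j => a • c j) = a • nearlyHol c := by
      ext z; simp [nearlyHol, Finset.mul_sum, mul_div_assoc]
    refine ⟨fun j => a • c j, fun j => (hc j).const_smul a, ?_, rfl⟩
    rw [hsm]
    refine ⟨fun γ => by rw [slash_smul, hm, smul_comm], fun g hg => ?_⟩
    obtain ⟨L, hL⟩ := hl g hg
    refine ⟨a • L, ?_⟩
    rw [slash_smul]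
    exact hL.const_smul a

/-- `f` is extremal in the space of quasimodular forms on `Γ₀⁺(3)` of weight `k`, depth `≤ r` and
character `χ`: its vanishing order at `∞`, i.e. the order of its expansion in powers of
`q = exp(2πiz)`, is the dimension of the space minus one. -/
def IsExtremal (χ : GammaPlus →* ℂ) (k : ℤ) (r : ℕ) (f : ℍ → ℂ) : Prop :=
  f ∈ quasimodular GammaPlus χ k r ∧
    (qExpansion 1 f).order + 1 = (Module.finrank ℂ (quasimodular GammaPlus χ k r) : ℕ∞)

/-! ### The forms `M₂`, `M₄`, `M₆` -/

/-- The point `3z`. -/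
def triple (z : ℍ) : ℍ := ⟨3 * (z : ℂ), by simpa using z.im_pos⟩

def M2 (z : ℍ) : ℂ := (3 * EisensteinSeries.E2 (triple z) - EisensteinSeries.E2 z) / 2

def M4 (z : ℍ) : ℂ := (9 * ModularForm.E₄ (triple z) + ModularForm.E₄ z) / 10

def M6 (z : ℍ) : ℂ := ModularForm.eta z ^ 6 * ModularForm.eta (3 * z) ^ 6

/-- `h` is a holomorphic branch of `M₆^{k/2}` on the upper half-plane. -/
def IsBranchM6 (k : ℕ) (h : ℍ → ℂ) : Prop :=
  MDifferentiable 𝓘(ℂ) 𝓘(ℂ) h ∧ ∀ z, h z ^ 2 = M6 z ^ k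

/-- Such a branch exists. -/
theorem isBranchM6_eta (k : ℕ) : IsBranchM6 k
    fun z => (ModularForm.eta z ^ 3 * ModularForm.eta (3 * z) ^ 3) ^ k := by
  refine ⟨?_, fun z => by simp only [M6]; ring⟩
  rw [UpperHalfPlane.mdifferentiable_iff]
  have : DifferentiableOn ℂ (fun z : ℂ => (ModularForm.eta z ^ 3 * ModularForm.eta (3 * z) ^ 3) ^ k)
      {z | 0 < z.im} := by
    intro z hz
    have h1 : DifferentiableAt ℂ ModularForm.eta z :=
      ModularForm.differentiableAt_eta_of_mem_upperHalfPlaneSet hz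
    have h2 : DifferentiableAt ℂ ModularForm.eta (3 * z) :=
      ModularForm.differentiableAt_eta_of_mem_upperHalfPlaneSet
        (by simpa [UpperHalfPlane.upperHalfPlaneSet] using hz)
    have h3 : DifferentiableAt ℂ (fun z => ModularForm.eta (3 * z)) z :=
      h2.comp z (differentiableAt_id.const_mul 3)
    exact (((h1.pow 3).mul (h3.pow 3)).pow k).differentiableWithinAt
  refine this.congr fun z hz => ?_
  simp [ofComplex_apply_of_im_pos hz]

/-! ### The differential equation -/

/-- `y` is a solution of `y'' = -4π² Q y` on the upper half-plane: `y` is meromorphic there, and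
outside the set `P` it is holomorphic and satisfies the equation. -/
structure IsSolution (Q y : ℍ → ℂ) (P : Set ℍ) : Prop where
  meromorphic : MeromorphicOn (y ∘ ofComplex) upperHalfPlaneSet
  analytic : ∀ z : ℍ, z ∉ P → AnalyticAt ℂ (y ∘ ofComplex) z
  equation : ∀ z : ℍ, z ∉ P →
    deriv (deriv (y ∘ ofComplex)) z = -4 * (Real.pi : ℂ) ^ 2 * Q z * y z

end

end QuasiThree

namespace QuasiThree

noncomputable section

-- The group is generated by the Fricke involution z ↦ -1/(3z) and the translation z ↦ z + 1, so
-- transformation laws are checked on these two maps only. The modular input is one principle,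
-- `eq_const_of_invariant`: a holomorphic function on the upper half plane that is invariant under
-- both maps and has a limit at i∞ is constant. As M₆ = q + … has no zeros there, division by its
-- powers determines forms of small weight (`IsForm.eq_mul_g6_pow`,
-- `IsForm.eq_zero_of_tendsto_zero`).
--
-- Let f0 be the extremal form, f1 its companion, e = η(z)³η(3z)³, v = f0/e^k and u = (z f0 +
-- f1)/e^k. The span of v and u is stable under the group up to an automorphy factor, of weight -1
-- if f0 has weight 3k and of weight 1 if it has weight 3k + 2. Hence W = u v' - u' v is a form of
-- weight 0 or 4, and W v'' = W' v' + W♯ v with W♯ = u'' v' - u' v''. Explicit forms show that the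
-- dimension is at least k + 1 (`add_one_le_finrank`, `add_one_le_finrank'`), so f0 vanishes to some
-- order n ≥ k, and W = (f1 f0' - f0² - f1' f0)/M₆^k is O(q^(n-k)). Moreover W is not identically 0,
-- because z ↦ z + 1 adds 1 to u/v. So W is L or L M₂² with L ≠ 0, which forces n = k; the exact
-- dimension is never computed separately.
--
-- In weight 3k, W♯ is a form of weight 4, hence a multiple of M₂² = M₄, and the limit (πik)² of
-- v''/v at i∞ gives the factor (`ShiftPair.ode_one`).
--
-- In weight 3k + 2, a correction turns W♯/L into a form of weight 8, a combination of M₂⁴ and M₂M₆.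
-- The first coefficient is again read off at i∞. The second is 0 by a local argument at the
-- elliptic point of order 6, where M₂ vanishes (`ShiftPair.apply_ellPt_ne_zero`,
-- `ShiftPair.ode_two`). Division by M₂ removes the first-order term, and -18 M₆/M₂ arises from the
-- identity `m1_bracket` for the square root of M₂.

local notation "ℍₒ" => upperHalfPlaneSet
local notation "s3" => ((√3 : ℝ) : ℂ)

/-! ### Expansions at the cusp `∞` -/

/-- The filter of neighbourhoods of `i∞` in `ℂ`. -/
abbrev imTop : Filter ℂ := comap Complex.im atTop

/-- The local parameter `q = exp(2πiz)` at `∞`. -/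
def cuspParam (z : ℂ) : ℂ := cexp (2 * Real.pi * I * z)

lemma cuspParam_eq (z : ℂ) : cuspParam z = Function.Periodic.qParam 1 z := by
  simp [cuspParam, Function.Periodic.qParam]

lemma cuspParam_ne_zero (z : ℂ) : cuspParam z ≠ 0 := exp_ne_zero _

lemma tendsto_cuspParam : Tendsto cuspParam imTop (𝓝[≠] 0) := by
  rw [funext cuspParam_eq]
  exact Function.Periodic.qParam_tendsto one_pos

lemma tendsto_cuspParam' : Tendsto cuspParam imTop (𝓝 0) :=
  tendsto_cuspParam.mono_right nhdsWithin_le_nhds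

lemma hasDerivAt_cuspParam (z : ℂ) :
    HasDerivAt cuspParam (2 * Real.pi * I * cuspParam z) z := by
  have := ((hasDerivAt_id z).const_mul (2 * Real.pi * I)).cexp
  convert! this using 1
  simp [cuspParam, mul_comm]

lemma eventually_imTop_iff {p : ℂ → Prop} : (∀ᶠ z in imTop, p z) ↔ ∃ A : ℝ, ∀ z, A < z.im → p z := by
  rw [eventually_comap, eventually_atTop]
  constructor
  · rintro ⟨A, h⟩
    exact ⟨A, fun z hz => h _ hz.le z rfl⟩
  · rintro ⟨A, h⟩
    exact ⟨A + 1, fun b hb z hz => h z (by rw [hz]; linarith)⟩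

lemma eventually_im_gt (A : ℝ) : ∀ᶠ z in imTop, A < z.im := eventually_imTop_iff.2 ⟨A, fun _ h => h⟩

instance imTop_neBot : imTop.NeBot := by
  rw [imTop, comap_neBot_iff]
  intro t ht
  obtain ⟨A, hA⟩ := mem_atTop_sets.1 ht
  exact ⟨⟨0, A⟩, hA _ le_rfl⟩

lemma eventually_nhds_of_imTop {p : ℂ → Prop} (h : ∀ᶠ z in imTop, p z) :
    ∀ᶠ z in imTop, ∀ᶠ w in 𝓝 z, p w := by
  obtain ⟨A, hA⟩ := eventually_imTop_iff.1 h
  refine eventually_imTop_iff.2 ⟨A, fun z hz => ?_⟩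
  filter_upwards [(isOpen_lt continuous_const Complex.continuous_im).mem_nhds hz] with w hw
  exact hA w hw

/-- `f` agrees near `i∞` with `φ(q)` for a function `φ` that is analytic at `0`. -/
structure HasQ (f φ : ℂ → ℂ) : Prop where
  analytic : AnalyticAt ℂ φ 0
  eventually_eq : ∀ᶠ z in imTop, f z = φ (cuspParam z)

namespace HasQ

variable {f g φ ψ : ℂ → ℂ}

lemma tendsto (h : HasQ f φ) : Tendsto f imTop (𝓝 (φ 0)) :=
  (h.analytic.continuousAt.tendsto.comp tendsto_cuspParam').congr'
    (h.eventually_eq.mono fun _ hz => hz.symm)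

lemma congr (h : HasQ f φ) (hg : ∀ᶠ z in imTop, g z = f z) : HasQ g φ :=
  ⟨h.analytic, by filter_upwards [hg, h.eventually_eq] with z h1 h2; rw [h1, h2]⟩

lemma const (c : ℂ) : HasQ (fun _ => c) (fun _ => c) := ⟨analyticAt_const, by simp⟩

lemma add (hf : HasQ f φ) (hg : HasQ g ψ) : HasQ (fun z => f z + g z) (fun q => φ q + ψ q) :=
  ⟨hf.analytic.fun_add hg.analytic, by
    filter_upwards [hf.eventually_eq, hg.eventually_eq] with z h1 h2; rw [h1, h2]⟩

lemma sub (hf : HasQ f φ) (hg : HasQ g ψ) : HasQ (fun z => f z - g z) (fun q => φ q - ψ q) :=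
  ⟨hf.analytic.fun_sub hg.analytic, by
    filter_upwards [hf.eventually_eq, hg.eventually_eq] with z h1 h2; rw [h1, h2]⟩

lemma mul (hf : HasQ f φ) (hg : HasQ g ψ) : HasQ (fun z => f z * g z) (fun q => φ q * ψ q) :=
  ⟨hf.analytic.fun_mul hg.analytic, by
    filter_upwards [hf.eventually_eq, hg.eventually_eq] with z h1 h2; rw [h1, h2]⟩

lemma const_mul (hf : HasQ f φ) (c : ℂ) : HasQ (fun z => c * f z) (fun q => c * φ q) :=
  (const c).mul hf

lemma pow (hf : HasQ f φ) (n : ℕ) : HasQ (fun z => f z ^ n) (fun q => φ q ^ n) :=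
  ⟨hf.analytic.fun_pow n, by filter_upwards [hf.eventually_eq] with z h1; rw [h1]⟩

lemma div (hf : HasQ f φ) (hg : HasQ g ψ) (h0 : ψ 0 ≠ 0) :
    HasQ (fun z => f z / g z) (fun q => φ q / ψ q) :=
  ⟨hf.analytic.fun_div hg.analytic h0, by
    filter_upwards [hf.eventually_eq, hg.eventually_eq] with z h1 h2; rw [h1, h2]⟩

/-- Chain rule: d/dz is 2πi q d/dq, so the constant term is lost. -/
lemma deriv (hf : HasQ f φ) :
    HasQ (deriv f) (fun q => 2 * Real.pi * I * (q * _root_.deriv φ q)) := by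
  refine ⟨analyticAt_const.fun_mul (analyticAt_id.fun_mul hf.analytic.deriv), ?_⟩
  filter_upwards [eventually_nhds_of_imTop hf.eventually_eq,
    tendsto_cuspParam'.eventually hf.analytic.eventually_analyticAt] with z h1 h2
  rw [Filter.EventuallyEq.deriv_eq h1]
  have := h2.differentiableAt.hasDerivAt.comp z (hasDerivAt_cuspParam z)
  rw [show (fun w => φ (cuspParam w)) = φ ∘ cuspParam from rfl, this.deriv]
  ring

/-- Every small q ≠ 0 is the value of `cuspParam` at a point near i∞, so the two expansions agree on
a punctured disc, and by analyticity at 0 too. -/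
lemma unique (hf : HasQ f φ) (hg : HasQ f ψ) : φ =ᶠ[𝓝 0] ψ := by
  have h : ∀ᶠ q in 𝓝[≠] (0 : ℂ), φ q = ψ q := by
    have := (Function.Periodic.invQParam_tendsto one_pos).eventually
      (hf.eventually_eq.and hg.eventually_eq)
    filter_upwards [this, self_mem_nhdsWithin] with q ⟨h1, h2⟩ hq
    rwa [h1, cuspParam_eq, Function.Periodic.qParam_right_inv one_ne_zero hq] at h2
  exact (hf.analytic.frequently_eq_iff_eventually_eq hg.analytic).1 h.frequently

/-- Split off the value of the constant term. -/
lemma exists_eq_param_mul (hf : HasQ f φ) (h0 : φ 0 = 0) :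
    ∃ ψ, HasQ (fun z => f z / cuspParam z) ψ ∧ ψ 0 = _root_.deriv φ 0 := by
  refine ⟨dslope φ 0, ⟨?_, ?_⟩, by simp⟩
  · obtain ⟨p, hp⟩ := hf.analytic
    exact ⟨_, hp.has_fpower_series_dslope_fslope⟩
  · filter_upwards [hf.eventually_eq] with z hz
    rw [hz, dslope_of_ne _ (cuspParam_ne_zero z), slope_def_field, h0]
    simp

end HasQ

/-- A holomorphic function of period `1` that is `o(1/q)` at `i∞` has an expansion there. -/
theorem exists_hasQ {F : ℍ → ℂ} (hF : MDifferentiable 𝓘(ℂ) 𝓘(ℂ) F)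
    (hper : Function.Periodic (F ∘ ofComplex) 1)
    (ho : Tendsto (fun z => (F ∘ ofComplex) z * cuspParam z) imTop (𝓝 0)) :
    HasQ (F ∘ ofComplex) (cuspFunction 1 F) := by
  have hper' : Function.Periodic (F ∘ ofComplex) ((1 : ℝ) : ℂ) := by simpa using hper
  have hd : ∀ᶠ z in imTop, DifferentiableAt ℂ (F ∘ ofComplex) z := by
    filter_upwards [eventually_im_gt 0] with z hz
    exact ((UpperHalfPlane.mdifferentiable_iff.1 hF) z hz).differentiableAt
      (isOpen_upperHalfPlaneSet.mem_nhds hz)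
  have hd' := Function.Periodic.eventually_differentiableAt_cuspFunction_nhds_ne_zero one_pos
    hper' hd
  have heq : ∀ q : ℂ, q ≠ 0 → Function.Periodic.cuspFunction 1 (F ∘ ofComplex) q =
      (F ∘ ofComplex) (Function.Periodic.invQParam 1 q) := fun q hq =>
    Function.Periodic.cuspFunction_eq_of_nonzero _ _ hq
  -- Growth o(1/q) is all that the removable singularity theorem needs for a finite limit at q = 0.
  have hlim : Tendsto (Function.Periodic.cuspFunction 1 (F ∘ ofComplex)) (𝓝[≠] 0)
      (𝓝 (limUnder (𝓝[≠] 0) (Function.Periodic.cuspFunction 1 (F ∘ ofComplex)))) := by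
    refine tendsto_limUnder_of_differentiable_on_punctured_nhds_of_isLittleO hd' ?_
    have h1 : (Function.Periodic.cuspFunction 1 (F ∘ ofComplex)) =o[𝓝[≠] 0]
        fun z : ℂ => (z - 0)⁻¹ := by
      refine (Asymptotics.isLittleO_iff_tendsto' ?_).2 ?_
      · filter_upwards [self_mem_nhdsWithin] with q hq h
        exact absurd h (by simpa using hq)
      · have := ho.comp (Function.Periodic.invQParam_tendsto one_pos)
        refine this.congr' ?_
        filter_upwards [self_mem_nhdsWithin] with q hq
        rw [Function.comp_apply, heq q hq, cuspParam_eq, Function.Periodic.qParam_right_inv one_ne_zero hq]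
        simp
    refine h1.sub ?_
    refine (Asymptotics.isLittleO_iff_tendsto' ?_).2 ?_
    · filter_upwards [self_mem_nhdsWithin] with q hq h
      exact absurd h (by simpa using hq)
    · have : Tendsto (fun q : ℂ => Function.Periodic.cuspFunction 1 (F ∘ ofComplex) 0 * q) (𝓝[≠] 0)
          (𝓝 (Function.Periodic.cuspFunction 1 (F ∘ ofComplex) 0 * 0)) :=
        (continuous_const.mul continuous_id).continuousAt.tendsto.mono_left nhdsWithin_le_nhds
      simpa using this
  -- The value of `cuspFunction` at 0 is this limit, whence continuity there.
  rw [← Function.Periodic.cuspFunction_zero_eq_limUnder_nhds_ne] at hlim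
  refine ⟨analyticAt_of_differentiable_on_punctured_nhds_of_continuousAt hd' ?_, ?_⟩
  · exact continuousAt_iff_punctured_nhds.2 hlim
  · filter_upwards with z
    rw [cuspParam_eq]
    exact (Function.Periodic.eq_cuspFunction one_ne_zero hper' z).symm

lemma ofComplex_coe_eq {z : ℂ} (hz : 0 < z.im) : ((ofComplex z : ℍ) : ℂ) = z := by
  rw [ofComplex_apply_of_im_pos hz]

lemma mdifferentiable_coe_comp {f : ℂ → ℂ} (hf : DifferentiableOn ℂ f ℍₒ) :
    MDifferentiable 𝓘(ℂ) 𝓘(ℂ) (fun z : ℍ => f z) := by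
  rw [UpperHalfPlane.mdifferentiable_iff]
  exact hf.congr fun z hz => by simp [ofComplex_coe_eq hz]

lemma periodic_coe_comp {f : ℂ → ℂ} (hT : ∀ z, 0 < z.im → f (z + 1) = f z) :
    Function.Periodic ((fun z : ℍ => f z) ∘ ofComplex) 1 := by
  intro z
  by_cases hz : 0 < z.im
  · have hz1 : 0 < (z + 1).im := by simpa using hz
    simp [ofComplex_coe_eq hz, ofComplex_coe_eq hz1, hT z hz]
  · have hz1 : (z + 1).im ≤ 0 := by simpa using hz
    simp only [Function.comp_apply]
    rw [ofComplex_apply_eq_of_im_nonpos hz1 (not_lt.1 hz)]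

theorem exists_hasQ' {f : ℂ → ℂ} (hf : DifferentiableOn ℂ f ℍₒ)
    (hT : ∀ z, 0 < z.im → f (z + 1) = f z)
    (ho : Tendsto (fun z => f z * cuspParam z) imTop (𝓝 0)) :
    ∃ φ, HasQ f φ := by
  refine ⟨_, (exists_hasQ (mdifferentiable_coe_comp hf) (periodic_coe_comp hT) ?_).congr ?_⟩
  · refine ho.congr' ?_
    filter_upwards [eventually_im_gt 0] with z hz
    simp [ofComplex_coe_eq hz]
  · filter_upwards [eventually_im_gt 0] with z hz
    simp [ofComplex_coe_eq hz]

theorem exists_hasQ_of_bounded {f : ℂ → ℂ} (hf : DifferentiableOn ℂ f ℍₒ)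
    (hT : ∀ z, 0 < z.im → f (z + 1) = f z) {L : ℂ} (hL : Tendsto f imTop (𝓝 L)) :
    ∃ φ, HasQ f φ ∧ φ 0 = L := by
  obtain ⟨φ, hφ⟩ := exists_hasQ' hf hT (by simpa using hL.mul tendsto_cuspParam')
  exact ⟨φ, hφ, tendsto_nhds_unique hφ.tendsto hL⟩

/-! ### The Fricke involution and invariant functions -/

/-- The action `z ↦ -1/(3z)` of `matS`. -/
def fricke (z : ℂ) : ℂ := -1 / (3 * z)

lemma ne_zero_of_im {z : ℂ} (hz : 0 < z.im) : z ≠ 0 := by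
  rintro rfl; simp at hz

lemma fricke_im {z : ℂ} (hz : 0 < z.im) : 0 < (fricke z).im := by
  have h := UpperHalfPlane.im_inv_neg_coe_pos ⟨3 * z, by simpa using hz⟩
  simpa [fricke, neg_div, neg_inv] using h

lemma hasDerivAt_fricke {z : ℂ} (hz : z ≠ 0) : HasDerivAt fricke (1 / (3 * z ^ 2)) z := by
  have := ((hasDerivAt_id z).const_mul 3).inv (by simpa using hz) |>.const_mul (-1)
  convert! this using 1
  simp; field_simp

lemma SL_smul_coe (A : SL(2, ℝ)) (z : ℍ) :
    (((A : GL (Fin 2) ℝ) • z : ℍ) : ℂ) = ((A 0 0 : ℂ) * z + A 0 1) / ((A 1 0 : ℂ) * z + A 1 1) := by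
  rw [UpperHalfPlane.coe_smul_of_det_pos (by simp)]
  simp [num, denom]

lemma SL_denom (A : SL(2, ℝ)) (z : ℍ) :
    denom (A : GL (Fin 2) ℝ) z = (A 1 0 : ℂ) * z + A 1 1 := by
  simp [denom]

lemma SL_slash (A : SL(2, ℝ)) (k : ℤ) (F : ℍ → ℂ) (z : ℍ) :
    (F ∣[k] (A : GL (Fin 2) ℝ)) z =
      F ((A : GL (Fin 2) ℝ) • z) * ((A 1 0 : ℂ) * z + A 1 1) ^ (-k) := by
  rw [ModularForm.slash_apply, SL_denom]
  simp [UpperHalfPlane.σ]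

lemma s3C_ne : ((√3 : ℝ) : ℂ) ≠ 0 := by exact_mod_cast s3_ne

lemma s3C_sq : ((√3 : ℝ) : ℂ) * ((√3 : ℝ) : ℂ) = 3 := by exact_mod_cast sq3

lemma matS_smul_coe (z : ℍ) :
    ((((matS : SL(2, ℝ)) : GL (Fin 2) ℝ) • z : ℍ) : ℂ) = fricke z := by
  obtain ⟨h1, h2, h3, h4⟩ := matS_entries
  rw [SL_smul_coe, h1, h2, h3, h4, fricke]
  have := s3C_ne
  have hz := UpperHalfPlane.ne_zero z
  have := s3C_sq
  push_cast
  rw [div_eq_div_iff (by simp [*]) (by simp [*])]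
  field_simp
  grind

lemma matR_smul_coe (z : ℍ) :
    ((((matR : SL(2, ℝ)) : GL (Fin 2) ℝ) • z : ℍ) : ℂ) = fricke z + 1 := by
  obtain ⟨h1, h2, h3, h4⟩ := matR_entries
  rw [SL_smul_coe, h1, h2, h3, h4, fricke]
  have := s3C_ne
  have hz := UpperHalfPlane.ne_zero z
  have := s3C_sq
  push_cast
  rw [div_add_one (by simp [*]), div_eq_div_iff (by simp [*]) (by simp [*])]
  field_simp
  grind

section Invariant

variable {f : ℂ → ℂ}

/-- `matS` and `matR` generate the group, and `matR` acts as the involution followed by z ↦ z + 1.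
-/
lemma invariant_GammaPlus (hT : ∀ z, 0 < z.im → f (z + 1) = f z)
    (hS : ∀ z, 0 < z.im → f (fricke z) = f z) (A : GammaPlus) (z : ℍ) :
    f ((((A : SL(2, ℝ)) : GL (Fin 2) ℝ) • z : ℍ) : ℂ) = f z := by
  have hA : A ∈ Subgroup.closure {matS, matR} := by rw [closure_matS_matR]; trivial
  induction hA using Subgroup.closure_induction generalizing z with
  | mem x hx =>
    rcases hx with rfl | rfl
    · rw [matS_smul_coe, hS z z.im_pos]
    · rw [matR_smul_coe, hT _ (fricke_im z.im_pos), hS z z.im_pos]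
  | one => simp
  | mul x y _ _ h1 h2 =>
    rw [Subgroup.coe_mul, map_mul, mul_smul, h1, h2]
  | inv x _ h =>
    have := h ((((x⁻¹ : GammaPlus) : SL(2, ℝ)) : GL (Fin 2) ℝ) • z)
    rw [← mul_smul, ← map_mul, ← Subgroup.coe_mul] at this
    simpa using this.symm

/-- An integer prime to 3 is its own inverse modulo 3, so j = dc works. -/
lemma exists_int_dvd_sub_mul {c : ℤ} (hc : ¬ (3 : ℤ) ∣ c) (d : ℤ) : ∃ j e : ℤ, d - j * c = 3 * e := by
  have h : (3 : ℤ) ∣ 1 - c * c := by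
    have := Int.emod_emod_of_dvd c (dvd_refl 3)
    rcases (by omega : c % 3 = 1 ∨ c % 3 = 2) with h | h
    · exact Int.dvd_of_emod_eq_zero (by simp [Int.sub_emod, Int.mul_emod, h])
    · exact Int.dvd_of_emod_eq_zero (by simp [Int.sub_emod, Int.mul_emod, h])
  obtain ⟨e, he⟩ := h
  exact ⟨d * c, d * e, by linear_combination d * he⟩

open scoped Modular in
/-- Every point is equivalent under `Γ₀⁺(3)` to one of imaginary part at least `1/4`. -/
lemma exists_equivalent_im_ge (hT : ∀ z, 0 < z.im → f (z + 1) = f z)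
    (hS : ∀ z, 0 < z.im → f (fricke z) = f z) (z : ℍ) :
    ∃ w : ℍ, 1 / 4 ≤ w.im ∧ f z = f w := by
  obtain ⟨g, hg⟩ := ModularGroup.exists_smul_mem_fd z
  set w := g • z with hw
  have him : 3 / 4 ≤ w.im := by
    have h1 := ModularGroup.three_le_four_mul_im_sq_of_mem_fd hg
    have h2 := w.im_pos
    nlinarith
  have hz : z = g⁻¹ • w := by rw [hw, inv_smul_smul]
  set γ := g⁻¹
  have hdet : γ 0 0 * γ 1 1 - γ 0 1 * γ 1 0 = 1 := by
    have := γ.det_coe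
    rwa [Matrix.det_fin_two] at this
  have hzc : (z : ℂ) = ((γ 0 0 : ℂ) * w + γ 0 1) / ((γ 1 0 : ℂ) * w + γ 1 1) := by
    rw [hz, UpperHalfPlane.coe_specialLinearGroup_apply]
    simp
  -- If 3 divides the lower left entry c, then γ lies in Γ₀(3). Otherwise γ is up to a scalar A (1,
  -- j; 0, 3) with A in W₃, where j is chosen with 3 ∣ d - jc. This replaces w by (w + j)/3, and the
  -- bound 3/4 on the imaginary part by 1/4.
  by_cases hc : (3 : ℤ) ∣ γ 1 0
  · obtain ⟨c, hc⟩ := hc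
    let A : SL(2, ℝ) := ⟨!![(γ 0 0 : ℝ), γ 0 1; 3 * c, γ 1 1], by
      rw [Matrix.det_fin_two_of]
      rw [hc] at hdet
      have : ((γ 0 0 * γ 1 1 - γ 0 1 * (3 * c) : ℤ) : ℝ) = 1 := by rw [hdet]; simp
      push_cast at this
      exact this⟩
    have hA : A ∈ GammaPlus := Or.inl ⟨γ 0 0, γ 0 1, c, γ 1 1, rfl⟩
    refine ⟨w, by linarith, ?_⟩
    rw [← invariant_GammaPlus hT hS ⟨A, hA⟩ w, SL_smul_coe, hzc, hc]
    simp [A]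
  · obtain ⟨j, e, hj⟩ := exists_int_dvd_sub_mul hc (γ 1 1)
    let A : SL(2, ℝ) := ⟨(1 / √3 : ℝ) • !![(3 * γ 0 0 : ℝ), (γ 0 1 - j * γ 0 0 : ℤ); 3 * γ 1 0, 3 * e], by
      rw [Matrix.det_smul, Matrix.det_fin_two_of, Fintype.card_fin, div_pow,
        Real.sq_sqrt (by norm_num)]
      have h1 : ((γ 0 0 * γ 1 1 - γ 0 1 * γ 1 0 : ℤ) : ℝ) = 1 := by rw [hdet]; simp
      have h2 : ((γ 1 1 - j * γ 1 0 : ℤ) : ℝ) = (3 * e : ℤ) := by rw [hj]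
      push_cast at h1 h2 ⊢
      linear_combination h1 - (γ 0 0 : ℝ) * h2⟩
    have hA : A ∈ GammaPlus := Or.inr ⟨γ 0 0, γ 0 1 - j * γ 0 0, γ 1 0, e, rfl⟩
    have hw' : 0 < (((w : ℂ) + j) / 3).im := by
      simpa using w.im_pos
    refine ⟨⟨_, hw'⟩, ?_, ?_⟩
    · change 1 / 4 ≤ (((w : ℂ) + j) / 3).im
      have : (((w : ℂ) + j) / 3).im = w.im / 3 := by simp
      rw [this]; linarith
    · rw [← invariant_GammaPlus hT hS ⟨A, hA⟩ ⟨_, hw'⟩, SL_smul_coe, hzc]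
      have h2 : ((γ 1 1 - j * γ 1 0 : ℤ) : ℂ) = (3 * e : ℤ) := by rw [hj]
      push_cast at h2
      have h3 : (γ 1 1 : ℂ) = 3 * e + j * γ 1 0 := by linear_combination h2
      congr 1
      simp only [A, Matrix.smul_apply, Matrix.of_apply, Matrix.cons_val', Matrix.cons_val_zero,
        Matrix.cons_val_one, smul_eq_mul]
      push_cast
      rw [h3]
      have h4 : (1 / ((√3 : ℝ) : ℂ) * (3 * (γ 0 0 : ℂ))) * (((w : ℂ) + j) / 3) +
          1 / ((√3 : ℝ) : ℂ) * ((γ 0 1 : ℂ) - j * γ 0 0) =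
          1 / ((√3 : ℝ) : ℂ) * ((γ 0 0 : ℂ) * w + γ 0 1) := by ring
      have h5 : (1 / ((√3 : ℝ) : ℂ) * (3 * (γ 1 0 : ℂ))) * (((w : ℂ) + j) / 3) +
          1 / ((√3 : ℝ) : ℂ) * (3 * (e : ℂ)) =
          1 / ((√3 : ℝ) : ℂ) * ((γ 1 0 : ℂ) * w + (3 * e + j * γ 1 0)) := by ring
      rw [h4, h5, mul_div_mul_left _ _ (by simp)]

/-- A holomorphic function on the upper half plane that is invariant under `Γ₀⁺(3)` and has a
limit at `i∞` is constant. -/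
theorem eq_const_of_invariant (hf : DifferentiableOn ℂ f ℍₒ)
    (hT : ∀ z, 0 < z.im → f (z + 1) = f z) (hS : ∀ z, 0 < z.im → f (fricke z) = f z)
    {L : ℂ} (hL : Tendsto f imTop (𝓝 L)) : ∀ z, 0 < z.im → f z = L := by
  set F : ℍ → ℂ := fun z => f z with hF
  have hFd : MDifferentiable 𝓘(ℂ) 𝓘(ℂ) F := mdifferentiable_coe_comp hf
  have hper : Function.Periodic (F ∘ ofComplex) ((1 : ℝ) : ℂ) := by
    simpa using periodic_coe_comp hT
  have hbdd : IsBoundedAtImInfty F := by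
    have : Tendsto F atImInfty (𝓝 L) := hL.comp tendsto_coe_atImInfty
    exact this.isBigO_one ℝ
  set Φ := cuspFunction 1 F with hΦ
  have hd : DifferentiableOn ℂ Φ (Metric.ball 0 1) :=
    differentiableOn_cuspFunction_ball one_pos hper hFd hbdd
  have hval : ∀ w : ℍ, Φ (Function.Periodic.qParam 1 w) = f w := fun w =>
    eq_cuspFunction w one_ne_zero hper
  -- This is |q| on the line Im z = 1/4.
  set r : ℝ := Real.exp (-2 * Real.pi * (1 / 4) / 1) with hr
  have hr1 : r < 1 := by
    rw [hr, Real.exp_lt_one_iff]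
    have := Real.pi_pos
    linarith
  obtain ⟨q₀, hq₀, hmax⟩ := (isCompact_closedBall (0 : ℂ) r).exists_isMaxOn
    (f := fun q => ‖Φ q‖) ⟨0, by simp [hr, Real.exp_nonneg]⟩
    (hd.continuousOn.mono (Metric.closedBall_subset_ball hr1)).norm
  have hq₀' : q₀ ∈ Metric.ball (0 : ℂ) 1 := Metric.closedBall_subset_ball hr1 hq₀
  -- Every orbit meets Im z ≥ 1/4, so every value of Φ on the punctured unit disc is taken on |q| ≤
  -- r. The maximum over this compact disc is thus a maximum over the open unit disc, and the
  -- maximum principle applies.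
  have hmax' : IsMaxOn (norm ∘ Φ) (Metric.ball 0 1) q₀ := by
    intro q hq
    by_cases h0 : q = 0
    · exact hmax (by simp [h0, hr, Real.exp_nonneg])
    · have him : 0 < (Function.Periodic.invQParam 1 q).im := by
        rw [Function.Periodic.im_invQParam]
        have h1 : Real.log ‖q‖ < 0 := Real.log_neg (by simpa using h0) (by simpa using hq)
        have := Real.pi_pos
        have h2 : -1 / (2 * Real.pi) < 0 := by
          apply div_neg_of_neg_of_pos <;> linarith
        exact mul_pos_of_neg_of_neg h2 h1
      obtain ⟨w, hw, hfw⟩ := exists_equivalent_im_ge hT hS ⟨_, him⟩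
      have h1 : Φ q = Φ (Function.Periodic.qParam 1 w) := by
        rw [hval, ← hfw]
        have := hval ⟨_, him⟩
        rw [← this]
        congr 1
        exact (Function.Periodic.qParam_right_inv one_ne_zero h0).symm
      change ‖Φ q‖ ≤ ‖Φ q₀‖
      rw [h1]
      refine hmax ?_
      rw [mem_closedBall_zero_iff, Function.Periodic.norm_qParam, hr, Real.exp_le_exp]
      have := Real.pi_pos
      have h2 : (1 : ℝ) / 4 ≤ (w : ℂ).im := hw
      nlinarith
  have hconst := Complex.eqOn_of_isPreconnected_of_isMaxOn_norm
    (convex_ball (0 : ℂ) 1).isPreconnected Metric.isOpen_ball hd hq₀' hmax'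
  have hfc : ∀ z, 0 < z.im → f z = Φ q₀ := by
    intro z hz
    have h1 := hval ⟨z, hz⟩
    change Φ (Function.Periodic.qParam 1 z) = f z at h1
    rw [← h1]
    refine hconst ?_
    rw [mem_ball_zero_iff]
    exact Function.Periodic.norm_qParam_lt_one one_pos hz
  have hlim : Tendsto f imTop (𝓝 (Φ q₀)) := by
    refine tendsto_const_nhds.congr' ?_
    filter_upwards [eventually_im_gt 0] with z hz
    exact (hfc z hz).symm
  intro z hz
  rw [hfc z hz, tendsto_nhds_unique hlim hL]

end Invariant

/-! ### Eta products -/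

/-- The Euler product `∏ (1 - q^(n+1))`. -/
def eulerProd (q : ℂ) : ℂ := ∏' n : ℕ, (1 - q ^ (n + 1))

lemma eulerProd_zero : eulerProd 0 = 1 := by simp [eulerProd]

lemma analyticAt_eulerProd : AnalyticAt ℂ eulerProd 0 :=
  ModularForm.differentiableOn_tprod_one_sub_pow.analyticAt (Metric.ball_mem_nhds 0 one_pos)

lemma eta_eq (z : ℂ) :
    ModularForm.eta z = Function.Periodic.qParam 24 z * eulerProd (cuspParam z) := by
  simp only [ModularForm.eta, eulerProd, cuspParam_eq]

lemma eta_add_one (z : ℂ) :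
    ModularForm.eta (z + 1) = cexp (2 * Real.pi * I / 24) * ModularForm.eta z := by
  rw [eta_eq, eta_eq]
  have h1 : cuspParam (z + 1) = cuspParam z := by
    rw [cuspParam, cuspParam, mul_add, mul_one, exp_add, exp_two_pi_mul_I, mul_one]
  have h2 : Function.Periodic.qParam 24 (z + 1) =
      cexp (2 * Real.pi * I / 24) * Function.Periodic.qParam 24 z := by
    rw [Function.Periodic.qParam, Function.Periodic.qParam, ← exp_add]
    congr 1
    push_cast
    ring
  rw [h1, h2, mul_assoc]

lemma exp_pow_eq (n : ℕ) (w : ℂ) : cexp w ^ n = cexp (n * w) := (exp_nat_mul w n).symm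

lemma eta_pow_three_add_one (z : ℂ) :
    ModularForm.eta (z + 1) ^ 3 = cexp (2 * Real.pi * I / 8) * ModularForm.eta z ^ 3 := by
  rw [eta_add_one, mul_pow, exp_pow_eq]
  congr 2
  push_cast
  ring

lemma eta_three_mul_add_one (z : ℂ) : ModularForm.eta (3 * (z + 1)) =
    cexp (2 * Real.pi * I / 8) * ModularForm.eta (3 * z) := by
  rw [show 3 * (z + 1) = 3 * z + 1 + 1 + 1 by ring, eta_add_one, eta_add_one, eta_add_one,
    ← mul_assoc, ← mul_assoc, ← exp_add, ← exp_add]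
  congr 2
  ring

lemma eta_neg_one_div {z : ℂ} (hz : 0 < z.im) :
    ModularForm.eta (-1 / z) = (Complex.sqrt I)⁻¹ * (Complex.sqrt z * ModularForm.eta z) :=
  ModularForm.eta_comp_eq_csqrt_I_inv hz

lemma csqrt_sq (z : ℂ) : Complex.sqrt z ^ 2 = z := by
  rcases eq_or_ne z 0 with rfl | hz
  · simp
  · rw [sqrt_eq_exp hz, exp_pow_eq]
    conv_rhs => rw [← exp_log hz]
    congr 1
    push_cast
    ring

lemma csqrt_three : Complex.sqrt 3 = s3 := by
  rw [sqrt_eq_exp (by norm_num), Real.sqrt_eq_rpow, Real.rpow_def_of_pos (by norm_num),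
    Complex.ofReal_exp]
  have h4 := Complex.ofReal_log (x := 3) (by norm_num)
  push_cast at h4 ⊢
  rw [h4]
  congr 1
  ring

lemma csqrt_three_mul {z : ℂ} (hz : z ≠ 0) : Complex.sqrt (3 * z) = s3 * Complex.sqrt z := by
  have h3 : (3 : ℂ) ≠ 0 := by norm_num
  rw [← csqrt_three, sqrt_eq_exp (mul_ne_zero h3 hz), sqrt_eq_exp hz, sqrt_eq_exp h3, ← exp_add]
  have := Complex.log_ofReal_mul (r := 3) (by norm_num) hz
  have h4 := Complex.ofReal_log (x := 3) (by norm_num)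
  push_cast at this h4
  rw [this, h4]
  congr 1
  ring

lemma eta_fricke {z : ℂ} (hz : 0 < z.im) : ModularForm.eta (fricke z) =
    (Complex.sqrt I)⁻¹ * (s3 * Complex.sqrt z * ModularForm.eta (3 * z)) := by
  rw [fricke, eta_neg_one_div (by simpa using hz), csqrt_three_mul (ne_zero_of_im hz)]

lemma eta_three_fricke {z : ℂ} (hz : 0 < z.im) : ModularForm.eta (3 * fricke z) =
    (Complex.sqrt I)⁻¹ * (Complex.sqrt z * ModularForm.eta z) := by
  rw [← eta_neg_one_div hz]
  congr 1
  have := ne_zero_of_im hz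
  simp only [fricke]
  field_simp

lemma csqrt_I_inv_pow : (Complex.sqrt I)⁻¹ ^ 6 = I := by
  rw [inv_pow, show 6 = 2 * 3 by rfl, pow_mul, csqrt_sq, I_pow_three]
  simp

lemma csqrt_pow_six (z : ℂ) : Complex.sqrt z ^ 6 = z ^ 3 := by
  rw [show 6 = 2 * 3 by rfl, pow_mul, csqrt_sq]

/-- The square root `η(z)³ η(3z)³` of `M₆`. -/
def etaRoot (z : ℂ) : ℂ := ModularForm.eta z ^ 3 * ModularForm.eta (3 * z) ^ 3

lemma three_mul_mem {z : ℂ} (hz : 0 < z.im) : 0 < (3 * z).im := by simpa using hz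

lemma eta_three_ne_zero {z : ℂ} (hz : 0 < z.im) : ModularForm.eta (3 * z) ≠ 0 :=
  ModularForm.eta_ne_zero (z := 3 * z) (three_mul_mem hz)

lemma etaRoot_ne_zero {z : ℂ} (hz : 0 < z.im) : etaRoot z ≠ 0 :=
  mul_ne_zero (pow_ne_zero _ (ModularForm.eta_ne_zero hz))
    (pow_ne_zero _ (eta_three_ne_zero hz))

lemma differentiableOn_eta : DifferentiableOn ℂ ModularForm.eta ℍₒ := fun _ hz =>
  (ModularForm.differentiableAt_eta_of_mem_upperHalfPlaneSet hz).differentiableWithinAt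

lemma differentiableOn_eta_three : DifferentiableOn ℂ (fun z => ModularForm.eta (3 * z)) ℍₒ :=
  differentiableOn_eta.comp (differentiableOn_id.const_mul 3) fun z hz => three_mul_mem (z := z) hz

lemma differentiableOn_etaRoot : DifferentiableOn ℂ etaRoot ℍₒ :=
  (differentiableOn_eta.fun_pow 3).fun_mul (differentiableOn_eta_three.fun_pow 3)

lemma etaRoot_add_one (z : ℂ) : etaRoot (z + 1) = -etaRoot z := by
  rw [etaRoot, etaRoot, eta_pow_three_add_one, eta_three_mul_add_one, mul_pow, exp_pow_eq]
  have : cexp (2 * Real.pi * I / 8) * cexp ((3 : ℕ) * (2 * Real.pi * I / 8)) = -1 := by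
    rw [← exp_add, ← exp_pi_mul_I]
    congr 1
    push_cast
    ring
  linear_combination (ModularForm.eta z ^ 3 * ModularForm.eta (3 * z) ^ 3) * this

/-- Only sixth powers of the square roots occur, so the choice of branch drops out. -/
lemma etaRoot_fricke {z : ℂ} (hz : 0 < z.im) :
    etaRoot (fricke z) = I * (s3 * z) ^ 3 * etaRoot z := by
  rw [etaRoot, etaRoot, eta_fricke hz, eta_three_fricke hz]
  linear_combination (s3 ^ 3 * ModularForm.eta z ^ 3 * ModularForm.eta (3 * z) ^ 3) *
    (Complex.sqrt z ^ 6 * csqrt_I_inv_pow + I * csqrt_pow_six z)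

/-- The weight `3` form `η(z)⁹ / η(3z)³ + 27 η(3z)⁹ / η(z)³`. -/
def etaCube (z : ℂ) : ℂ := ModularForm.eta z ^ 9 / ModularForm.eta (3 * z) ^ 3 +
  27 * (ModularForm.eta (3 * z) ^ 9 / ModularForm.eta z ^ 3)

lemma differentiableOn_etaCube : DifferentiableOn ℂ etaCube ℍₒ := by
  refine ((differentiableOn_eta.fun_pow 9).fun_div (differentiableOn_eta_three.fun_pow 3)
    fun z hz => pow_ne_zero _ (eta_three_ne_zero hz)).fun_add
    (((differentiableOn_eta_three.fun_pow 9).fun_div (differentiableOn_eta.fun_pow 3)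
    fun z hz => pow_ne_zero _ (ModularForm.eta_ne_zero hz)).const_mul 27)

lemma etaCube_add_one (z : ℂ) : etaCube (z + 1) = etaCube z := by
  have h9 : ModularForm.eta (z + 1) ^ 9 = cexp (2 * Real.pi * I / 8) ^ 3 * ModularForm.eta z ^ 9 := by
    rw [show 9 = 3 * 3 by rfl, pow_mul, eta_pow_three_add_one, mul_pow, ← pow_mul]
  have h8 : cexp (2 * Real.pi * I / 8) ^ 9 = cexp (2 * Real.pi * I / 8) := by
    rw [exp_pow_eq, show ((9 : ℕ) : ℂ) * (2 * Real.pi * I / 8) =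
      2 * Real.pi * I / 8 + 2 * Real.pi * I by push_cast; ring, exp_periodic]
  have h0 : cexp (2 * Real.pi * I / 8) ≠ 0 := exp_ne_zero _
  rw [etaCube, etaCube, h9, eta_pow_three_add_one, eta_three_mul_add_one, mul_pow, mul_pow, h8,
    mul_div_mul_left _ _ (pow_ne_zero _ h0), mul_div_mul_left _ _ h0]

/-- The involution exchanges the two eta quotients, and the coefficient 27 = √3⁶ makes their sum an
eigenvector. -/
lemma etaCube_fricke {z : ℂ} (hz : 0 < z.im) :
    etaCube (fricke z) = I * (s3 * z) ^ 3 * etaCube z := by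
  rw [etaCube, etaCube, eta_fricke hz, eta_three_fricke hz]
  have hi : Complex.sqrt I ≠ 0 := by
    intro h
    have := csqrt_sq I
    rw [h] at this
    exact I_ne_zero (by simpa using this.symm)
  have hz0 : Complex.sqrt z ≠ 0 := by
    intro h
    have := csqrt_sq z
    rw [h] at this
    exact ne_zero_of_im hz (by simpa using this.symm)
  have h1 := ModularForm.eta_ne_zero hz
  have h2 := eta_three_ne_zero hz
  have h3 := s3C_ne
  set i := (Complex.sqrt I)⁻¹ with hidef
  have hi' : i ≠ 0 := inv_ne_zero hi
  have e1 : (i * (s3 * Complex.sqrt z * ModularForm.eta (3 * z))) ^ 9 /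
      (i * (Complex.sqrt z * ModularForm.eta z)) ^ 3 =
      i ^ 6 * s3 ^ 9 * Complex.sqrt z ^ 6 * (ModularForm.eta (3 * z) ^ 9 / ModularForm.eta z ^ 3) := by
    field_simp
  have e2 : (i * (Complex.sqrt z * ModularForm.eta z)) ^ 9 /
      (i * (s3 * Complex.sqrt z * ModularForm.eta (3 * z))) ^ 3 =
      i ^ 6 * Complex.sqrt z ^ 6 / s3 ^ 3 * (ModularForm.eta z ^ 9 / ModularForm.eta (3 * z) ^ 3) := by
    field_simp
  have h6 : s3 ^ 6 = 27 := by
    calc s3 ^ 6 = (s3 * s3) ^ 3 := by ring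
      _ = 27 := by rw [s3C_sq]; norm_num
  have e3 : (27 : ℂ) / s3 ^ 3 = s3 ^ 3 := by
    rw [div_eq_iff (pow_ne_zero _ h3), ← h6]; ring
  rw [e1, e2, csqrt_I_inv_pow, csqrt_pow_six, show s3 ^ 9 = 27 * s3 ^ 3 by rw [← h6]; ring]
  linear_combination (I * z ^ 3 * (ModularForm.eta z ^ 9 / ModularForm.eta (3 * z) ^ 3)) * e3

/-! ### Forms for `Γ₀⁺(3)` -/

/-- Holomorphic functions on the upper half plane with a limit at `i∞` that transform under
the generators of `Γ₀⁺(3)` with weight `w` and with the factor `ε` at the Fricke involution. -/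
structure IsForm (w : ℤ) (ε : ℂ) (f : ℂ → ℂ) : Prop where
  diff : DifferentiableOn ℂ f ℍₒ
  per : ∀ z, 0 < z.im → f (z + 1) = f z
  fricke : ∀ z, 0 < z.im → f (fricke z) = ε * (s3 * z) ^ w * f z
  lim : ∃ L, Tendsto f imTop (𝓝 L)

lemma s3_mul_ne_zero {z : ℂ} (hz : 0 < z.im) : s3 * z ≠ 0 :=
  mul_ne_zero s3C_ne (ne_zero_of_im hz)

namespace IsForm

variable {w w' : ℤ} {ε ε' : ℂ} {f g : ℂ → ℂ}

lemma const (c : ℂ) : IsForm 0 1 (fun _ => c) :=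
  ⟨differentiableOn_const c, fun _ _ => rfl, fun _ _ => by simp, c, tendsto_const_nhds⟩

lemma zero (w : ℤ) (ε : ℂ) : IsForm w ε (fun _ => 0) :=
  ⟨differentiableOn_const 0, fun _ _ => rfl, fun _ _ => by simp, 0, tendsto_const_nhds⟩

lemma congr (hf : IsForm w ε f) (hw : w = w') (hε : ε = ε') (h : ∀ z, 0 < z.im → g z = f z) :
    IsForm w' ε' g := by
  subst hw hε
  refine ⟨hf.diff.congr fun z hz => h z hz, fun z hz => ?_, fun z hz => ?_, ?_⟩
  · rw [h z hz, h (z + 1) (by simpa using hz), hf.per z hz]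
  · rw [h z hz, h _ (fricke_im hz), hf.fricke z hz]
  · obtain ⟨L, hL⟩ := hf.lim
    refine ⟨L, hL.congr' ?_⟩
    filter_upwards [eventually_im_gt 0] with z hz
    exact (h z hz).symm

lemma mul (hf : IsForm w ε f) (hg : IsForm w' ε' g) :
    IsForm (w + w') (ε * ε') (fun z => f z * g z) := by
  refine ⟨hf.diff.fun_mul hg.diff, fun z hz => by rw [hf.per z hz, hg.per z hz],
    fun z hz => ?_, ?_⟩
  · rw [hf.fricke z hz, hg.fricke z hz, zpow_add₀ (s3_mul_ne_zero hz)]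
    ring
  · obtain ⟨L, hL⟩ := hf.lim
    obtain ⟨L', hL'⟩ := hg.lim
    exact ⟨_, hL.mul hL'⟩

lemma const_mul (hf : IsForm w ε f) (c : ℂ) : IsForm w ε (fun z => c * f z) :=
  ((const c).mul hf).congr (by simp) (by simp) fun _ _ => rfl

lemma add (hf : IsForm w ε f) (hg : IsForm w ε g) : IsForm w ε (fun z => f z + g z) := by
  refine ⟨hf.diff.fun_add hg.diff, fun z hz => by rw [hf.per z hz, hg.per z hz],
    fun z hz => ?_, ?_⟩
  · rw [hf.fricke z hz, hg.fricke z hz]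
    ring
  · obtain ⟨L, hL⟩ := hf.lim
    obtain ⟨L', hL'⟩ := hg.lim
    exact ⟨_, hL.add hL'⟩

lemma sub (hf : IsForm w ε f) (hg : IsForm w ε g) : IsForm w ε (fun z => f z - g z) :=
  (hf.add (hg.const_mul (-1))).congr rfl rfl fun _ _ => by ring

lemma pow (hf : IsForm w ε f) (n : ℕ) : IsForm (n * w) (ε ^ n) (fun z => f z ^ n) := by
  induction n with
  | zero => exact (const 1).congr (by simp) (by simp) fun _ _ => by simp
  | succ n ih =>
    exact (ih.mul hf).congr (by push_cast; ring) (by ring) fun _ _ => by ring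

lemma sum {ι : Type*} (s : Finset ι) {F : ι → ℂ → ℂ} (h : ∀ i ∈ s, IsForm w ε (F i)) :
    IsForm w ε (fun z => ∑ i ∈ s, F i z) := by
  classical
  induction s using Finset.induction_on with
  | empty => simpa using zero w ε
  | insert a s ha ih =>
    simp only [Finset.sum_insert ha]
    exact (h a (by simp)).add (ih fun i hi => h i (by simp [hi]))

lemma hasQ (hf : IsForm w ε f) {L : ℂ} (hL : Tendsto f imTop (𝓝 L)) : ∃ φ, HasQ f φ ∧ φ 0 = L :=
  exists_hasQ_of_bounded hf.diff hf.per hL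

lemma tendsto_div_param (hf : IsForm w ε f) (h0 : Tendsto f imTop (𝓝 0)) :
    ∃ L, Tendsto (fun z => f z / cuspParam z) imTop (𝓝 L) := by
  obtain ⟨φ, hφ, hφ0⟩ := hf.hasQ h0
  obtain ⟨ψ, hψ, -⟩ := hφ.exists_eq_param_mul hφ0
  exact ⟨_, hψ.tendsto⟩

end IsForm

/-- The form `M₆`, as a function on `ℂ`. -/
def g6 (z : ℂ) : ℂ := etaRoot z ^ 2

lemma M6_eq (z : ℍ) : M6 z = g6 z := by
  simp only [M6, g6, etaRoot]; ring

lemma g6_ne_zero {z : ℂ} (hz : 0 < z.im) : g6 z ≠ 0 := pow_ne_zero _ (etaRoot_ne_zero hz)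

lemma g6_eq (z : ℂ) : g6 z = cuspParam z * (eulerProd (cuspParam z) ^ 6 *
    eulerProd (cuspParam z ^ 3) ^ 6) := by
  have h1 : cuspParam (3 * z) = cuspParam z ^ 3 := by
    rw [cuspParam, cuspParam, exp_pow_eq]
    congr 1
    push_cast
    ring
  have h2 : Function.Periodic.qParam 24 z ^ 6 * Function.Periodic.qParam 24 (3 * z) ^ 6 =
      cuspParam z := by
    rw [Function.Periodic.qParam, Function.Periodic.qParam, exp_pow_eq, exp_pow_eq, ← exp_add,
      cuspParam]
    congr 1
    push_cast
    ring
  rw [g6, etaRoot, eta_eq, eta_eq, h1, ← h2]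
  ring

lemma hasQ_g6_div : ∃ θ, HasQ (fun z => g6 z / cuspParam z) θ ∧ θ 0 = 1 := by
  refine ⟨fun q => eulerProd q ^ 6 * eulerProd (q ^ 3) ^ 6, ⟨?_, ?_⟩, by simp [eulerProd_zero]⟩
  · refine (analyticAt_eulerProd.fun_pow 6).fun_mul (AnalyticAt.fun_pow ?_ 6)
    refine AnalyticAt.fun_comp (g := eulerProd) ?_ (analyticAt_id.fun_pow 3)
    simpa using analyticAt_eulerProd
  · filter_upwards with z
    rw [g6_eq, mul_div_cancel_left₀ _ (cuspParam_ne_zero z)]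

lemma tendsto_g6_div : Tendsto (fun z => g6 z / cuspParam z) imTop (𝓝 1) := by
  obtain ⟨θ, hθ, h⟩ := hasQ_g6_div
  exact h ▸ hθ.tendsto

lemma tendsto_g6 : Tendsto g6 imTop (𝓝 0) := by
  have := tendsto_g6_div.mul tendsto_cuspParam'
  simpa [div_mul_cancel₀ _ (cuspParam_ne_zero _)] using this

lemma isForm_g6 : IsForm 6 (-1) g6 := by
  refine ⟨differentiableOn_etaRoot.fun_pow 2, fun z _ => ?_, fun z hz => ?_, 0, tendsto_g6⟩
  · rw [g6, g6, etaRoot_add_one]; ring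
  · rw [g6, g6, etaRoot_fricke hz]
    rw [show (s3 * z) ^ (6 : ℤ) = ((s3 * z) ^ 3) ^ 2 by rw [← pow_mul]; norm_cast]
    linear_combination ((s3 * z) ^ 3) ^ 2 * etaRoot z ^ 2 * I_sq

/-- A form that is divisible by `M₆ ^ m` in the right weight is a multiple of it. -/
theorem IsForm.eq_mul_g6_pow {m : ℕ} {w : ℤ} {ε : ℂ} {f : ℂ → ℂ} (hf : IsForm w ε f)
    (hw : w = 6 * m) (hε : ε = (-1) ^ m) {L : ℂ}
    (hL : Tendsto (fun z => f z / cuspParam z ^ m) imTop (𝓝 L)) :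
    ∀ z, 0 < z.im → f z = L * g6 z ^ m := by
  -- Since `g6` has no zeros in the upper half plane, the quotient is holomorphic, and the weights
  -- and factors cancel.
  have key : ∀ z, 0 < z.im → f z / g6 z ^ m = L := by
    have hg := isForm_g6.pow m
    refine eq_const_of_invariant (hf.diff.fun_div hg.diff fun z hz => pow_ne_zero _ (g6_ne_zero hz))
      (fun z hz => ?_) (fun z hz => ?_) ?_
    · rw [hf.per z hz, isForm_g6.per z hz]
    · have h1 := hg.fricke z hz
      rw [hf.fricke z hz, h1, hw, hε, mul_comm (m : ℤ) 6, mul_div_mul_left]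
      exact mul_ne_zero (pow_ne_zero _ (by norm_num)) (zpow_ne_zero _ (s3_mul_ne_zero hz))
    · have := hL.div (tendsto_g6_div.pow m) (by simp)
      simp only [one_pow, div_one] at this
      refine this.congr fun z => ?_
      have := cuspParam_ne_zero z
      rw [Pi.div_apply, div_pow, div_div_div_cancel_right₀ (pow_ne_zero _ this)]
  intro z hz
  rw [← key z hz, div_mul_cancel₀ _ (pow_ne_zero _ (g6_ne_zero hz))]

/-- A cusp form of small weight vanishes. -/
theorem IsForm.eq_zero_of_tendsto_zero {w : ℤ} {ε : ℂ} {f : ℂ → ℂ} (hf : IsForm w ε f)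
    (h0 : Tendsto f imTop (𝓝 0)) (n m : ℕ) (hw : n * w = 6 * m) (hε : ε ^ n = (-1) ^ m)
    (hmn : m < n) : ∀ z, 0 < z.im → f z = 0 := by
  obtain ⟨L, hL⟩ := hf.tendsto_div_param h0
  -- As f = O(q), its n-th power vanishes to order at least n > m at i∞, more than `g6 ^ m`, which
  -- has the same weight.
  have hlim : Tendsto (fun z => f z ^ n / cuspParam z ^ m) imTop (𝓝 0) := by
    have := (hL.pow m).mul (h0.pow (n - m))
    rw [zero_pow (by omega), mul_zero] at this
    refine this.congr fun z => ?_
    rw [div_pow, div_mul_eq_mul_div, ← pow_add, Nat.add_sub_cancel' hmn.le]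
  intro z hz
  have := (hf.pow n).eq_mul_g6_pow hw hε hlim z hz
  rw [zero_mul] at this
  exact pow_eq_zero_iff (by omega) |>.1 this

/-! ### Calculus on the upper half plane -/

lemma isOpen_H : IsOpen ℍₒ := isOpen_upperHalfPlaneSet

lemma isPreconnected_H : IsPreconnected ℍₒ := (convex_halfSpace_im_gt 0).isPreconnected

lemma differentiableAt_of_H {f : ℂ → ℂ} (hf : DifferentiableOn ℂ f ℍₒ) {z : ℂ} (hz : 0 < z.im) :
    DifferentiableAt ℂ f z :=
  hf.differentiableAt (isOpen_H.mem_nhds hz)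

lemma eventually_mem_H {z : ℂ} (hz : 0 < z.im) : ∀ᶠ w in 𝓝 z, 0 < w.im := isOpen_H.mem_nhds hz

lemma eventually_ne_zero_of_H {f : ℂ → ℂ} (hf : DifferentiableOn ℂ f ℍₒ) {z₁ : ℂ}
    (hz₁ : 0 < z₁.im) (h1 : f z₁ ≠ 0) {z : ℂ} (hz : 0 < z.im) : ∀ᶠ w in 𝓝[≠] z, f w ≠ 0 := by
  by_contra h
  have := (hf.analyticOnNhd isOpen_H).eqOn_zero_of_preconnected_of_frequently_eq_zero
    isPreconnected_H hz (by rw [Filter.Frequently]; exact h)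
  exact h1 (this hz₁)

lemma exists_im_pos_of_imTop {p : ℂ → Prop} (h : ∀ᶠ z in imTop, p z) : ∃ z, 0 < z.im ∧ p z :=
  ((eventually_im_gt 0).and h).exists

lemma deriv_add_one {f : ℂ → ℂ} {s : ℂ} (h : ∀ z, 0 < z.im → f (z + 1) = s * f z)
    {z : ℂ} (hz : 0 < z.im) : deriv f (z + 1) = s * deriv f z := by
  rw [← deriv_comp_add_const, ← deriv_const_mul_field]
  refine Filter.EventuallyEq.deriv_eq ?_
  filter_upwards [eventually_mem_H hz] with w hw using h w hw

lemma deriv_add_one' {f : ℂ → ℂ} (h : ∀ z, 0 < z.im → f (z + 1) = f z)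
    {z : ℂ} (hz : 0 < z.im) : deriv f (z + 1) = deriv f z := by
  simpa using deriv_add_one (s := 1) (by simpa using h) hz

lemma deriv_fricke {f g : ℂ → ℂ} (hf : DifferentiableOn ℂ f ℍₒ)
    (h : ∀ z, 0 < z.im → f (fricke z) = g z) {z : ℂ} (hz : 0 < z.im) {g' : ℂ}
    (hg : HasDerivAt g g' z) : deriv f (fricke z) = 3 * z ^ 2 * g' := by
  have h0 := ne_zero_of_im hz
  have h1 := (differentiableAt_of_H hf (fricke_im hz)).hasDerivAt.comp z (hasDerivAt_fricke h0)
  have h2 : HasDerivAt (f ∘ fricke) g' z := by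
    refine hg.congr_of_eventuallyEq ?_
    filter_upwards [eventually_mem_H hz] with w hw using h w hw
  have := h1.unique h2
  rw [← this]
  field_simp

namespace HasQ

variable {f φ : ℂ → ℂ}

lemma tendsto_deriv (hf : HasQ f φ) : Tendsto (_root_.deriv f) imTop (𝓝 0) := by
  simpa using hf.deriv.tendsto

lemma deriv_deriv_zero (hf : HasQ f φ) :
    _root_.deriv (fun q => 2 * Real.pi * I * (q * _root_.deriv φ q)) 0 =
      2 * Real.pi * I * _root_.deriv φ 0 := by
  have := ((hasDerivAt_id (0 : ℂ)).mul hf.analytic.deriv.differentiableAt.hasDerivAt).const_mul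
    (2 * Real.pi * I)
  simpa using! this.deriv

lemma tendsto_deriv_div (hf : HasQ f φ) : Tendsto (fun z => _root_.deriv f z / cuspParam z) imTop
    (𝓝 (2 * Real.pi * I * _root_.deriv φ 0)) := by
  obtain ⟨ψ, hψ, h⟩ := hf.deriv.exists_eq_param_mul (by simp)
  rw [hf.deriv_deriv_zero] at h
  exact h ▸ hψ.tendsto

lemma tendsto_deriv_deriv_div (hf : HasQ f φ) :
    Tendsto (fun z => _root_.deriv (_root_.deriv f) z / cuspParam z) imTop
    (𝓝 ((2 * Real.pi * I) ^ 2 * _root_.deriv φ 0)) := by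
  have := hf.deriv.tendsto_deriv_div
  rw [hf.deriv_deriv_zero] at this
  convert this using 2
  ring

end HasQ

/-! ### The forms `M₂` and `M₄` -/

/-- `M₂`, as a function on `ℂ`. -/
def m2 (z : ℂ) : ℂ := (3 * EisensteinSeries.E2 (ofComplex (3 * z)) -
  EisensteinSeries.E2 (ofComplex z)) / 2

/-- `M₄`, as a function on `ℂ`. -/
def m4 (z : ℂ) : ℂ := (9 * ModularForm.E₄ (ofComplex (3 * z)) +
  ModularForm.E₄ (ofComplex z)) / 10

lemma ofComplex_three_mul (z : ℍ) : ofComplex (3 * (z : ℂ)) = triple z := by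
  rw [ofComplex_apply_of_im_pos (three_mul_mem z.im_pos)]; rfl

lemma M2_eq (z : ℍ) : M2 z = m2 z := by
  rw [M2, m2, ofComplex_three_mul, ofComplex_apply]

lemma M4_eq (z : ℍ) : M4 z = m4 z := by
  rw [M4, m4, ofComplex_three_mul, ofComplex_apply]

lemma differentiableOn_comp_ofComplex {F : ℍ → ℂ} (hF : MDifferentiable 𝓘(ℂ) 𝓘(ℂ) F) :
    DifferentiableOn ℂ (fun z => F (ofComplex z)) ℍₒ := UpperHalfPlane.mdifferentiable_iff.1 hF

lemma differentiableOn_comp_ofComplex_three {F : ℍ → ℂ} (hF : MDifferentiable 𝓘(ℂ) 𝓘(ℂ) F) :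
    DifferentiableOn ℂ (fun z => F (ofComplex (3 * z))) ℍₒ :=
  (differentiableOn_comp_ofComplex hF).comp (differentiableOn_id.const_mul 3)
    fun z hz => three_mul_mem (z := z) hz

lemma cuspParam_three_mul (z : ℂ) : cuspParam (3 * z) = cuspParam z ^ 3 := by
  rw [cuspParam, cuspParam, exp_pow_eq]
  congr 1
  push_cast
  ring

lemma HasQ.comp_three_mul {f φ : ℂ → ℂ} (h : HasQ f φ) :
    HasQ (fun z => f (3 * z)) (fun q => φ (q ^ 3)) := by
  refine ⟨?_, ?_⟩
  · refine AnalyticAt.fun_comp (g := φ) ?_ (analyticAt_id.fun_pow 3)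
    simpa using h.analytic
  · obtain ⟨A, hA⟩ := eventually_imTop_iff.1 h.eventually_eq
    filter_upwards [eventually_im_gt A, eventually_im_gt 0] with z h1 h2
    rw [hA (3 * z) (by simp; linarith), cuspParam_three_mul]

lemma HasQ.deriv_comp_three_mul {f φ : ℂ → ℂ} (h : HasQ f φ) :
    _root_.deriv (fun q => φ (q ^ 3)) 0 = 0 := by
  have h1 : HasDerivAt (fun q : ℂ => q ^ 3) 0 0 := by simpa using hasDerivAt_pow 3 (0 : ℂ)
  have h2 : HasDerivAt φ (_root_.deriv φ 0) ((0 : ℂ) ^ 3) := by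
    simpa using h.analytic.differentiableAt.hasDerivAt
  simpa using! (h2.comp (0 : ℂ) h1).deriv

lemma E2_periodic : Function.Periodic (EisensteinSeries.E2 ∘ ofComplex) 1 := by
  have key : ∀ z : ℍ, EisensteinSeries.E2 ((1 : ℝ) +ᵥ z) = EisensteinSeries.E2 z := by
    intro z
    refine (EisensteinSeries.hasSum_qExpansion_E2 (z := (1 : ℝ) +ᵥ z)).unique ?_
    convert! EisensteinSeries.hasSum_qExpansion_E2 (z := z) using 4
    rw [UpperHalfPlane.coe_vadd, ofReal_one, mul_add, mul_one, exp_add, exp_two_pi_mul_I, one_mul]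
  have h : ∀ z : ℂ, 0 < z.im →
      (EisensteinSeries.E2 ∘ ofComplex) (z + 1) = (EisensteinSeries.E2 ∘ ofComplex) z := by
    intro z hz
    have hz1 : 0 < (z + 1).im := by simpa using hz
    simp only [Function.comp_apply]
    rw [ofComplex_apply_of_im_pos hz, ofComplex_apply_of_im_pos hz1, ← key ⟨z, hz⟩]
    congr 1
    ext
    simp [add_comm]
  have := periodic_coe_comp h
  refine fun z => ?_
  have h2 := this z
  simpa using h2

lemma hasQ_E2 : ∃ φ, HasQ (fun z => EisensteinSeries.E2 (ofComplex z)) φ ∧ φ 0 = 1 ∧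
    deriv φ 0 = -24 := by
  have hper : Function.Periodic (EisensteinSeries.E2 ∘ ofComplex) ((1 : ℝ) : ℂ) := by
    simpa using E2_periodic
  have han := analyticAt_cuspFunction_zero one_pos hper E2_mdifferentiable
    EisensteinSeries.isBoundedAtImInfty_E2
  have hps := hasFPowerSeriesOnBall_cuspFunction one_pos han
    (c := fun m : ℕ ↦ (if m = 0 then 1 else -24 * ArithmeticFunction.sigma 1 m : ℂ)) fun τ ↦ by
      simpa only [Function.Periodic.qParam, ofReal_one, div_one] using
        EisensteinSeries.hasSum_qExpansion_E2 (z := τ)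
  refine ⟨_, ⟨han, ?_⟩, ?_, ?_⟩
  · filter_upwards with z
    rw [cuspParam_eq]
    exact (Function.Periodic.eq_cuspFunction one_ne_zero hper z).symm
  · rw [← hps.hasFPowerSeriesAt.coeff_zero (fun _ => 0)]
    simp [FormalMultilinearSeries.ofScalars]
  · rw [hps.hasFPowerSeriesAt.deriv]
    simp [FormalMultilinearSeries.ofScalars]

/-- E₂(3z) is a series in q³ and does not contribute to the coefficient of q, which is therefore
24/2. -/
lemma hasQ_m2 : ∃ φ, HasQ m2 φ ∧ φ 0 = 1 ∧ deriv φ 0 = 12 := by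
  obtain ⟨φ, h, h0, h1⟩ := hasQ_E2
  have h3 := h.comp_three_mul
  refine ⟨_, ((h3.const_mul 3).sub h).div (HasQ.const 2) (by norm_num), ?_, ?_⟩
  · simp [h0]; norm_num
  · have d3 := h3.analytic.differentiableAt.hasDerivAt
    rw [h.deriv_comp_three_mul] at d3
    have := ((d3.const_mul 3).sub h.analytic.differentiableAt.hasDerivAt).div_const 2
    rw [h1] at this
    refine this.deriv.trans ?_
    norm_num

lemma ofComplex_neg_inv {z : ℂ} (hz : 0 < z.im) :
    ofComplex (-1 / z) = ModularGroup.S • (⟨z, hz⟩ : ℍ) := by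
  have h : -1 / z = (-z)⁻¹ := by rw [neg_div, one_div, inv_neg]
  rw [UpperHalfPlane.modular_S_smul, h, ofComplex_apply_of_im_pos
    (UpperHalfPlane.im_inv_neg_coe_pos ⟨z, hz⟩)]

lemma E2_neg_inv {z : ℂ} (hz : 0 < z.im) : EisensteinSeries.E2 (ofComplex (-1 / z)) =
    z ^ 2 * EisensteinSeries.E2 (ofComplex z) - 1 / (2 * riemannZeta 2) * (2 * Real.pi * I) * z := by
  have h := congrFun (EisensteinSeries.E2_slash_action ModularGroup.S) ⟨z, hz⟩
  have h0 := ne_zero_of_im hz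
  rw [ModularForm.SL_slash_apply, ModularGroup.denom_S, ← ofComplex_neg_inv hz] at h
  simp only [Pi.sub_apply, Pi.smul_apply, EisensteinSeries.D2_S, smul_eq_mul] at h
  rw [ofComplex_apply_of_im_pos hz]
  rw [zpow_neg, mul_inv_eq_iff_eq_mul₀ (zpow_ne_zero _ h0)] at h
  rw [h, zpow_ofNat]
  field_simp

lemma three_mul_fricke {z : ℂ} : 3 * fricke z = -1 / z := by
  simp only [fricke]
  rw [← mul_div_assoc, mul_div_mul_left _ _ (by norm_num)]

/-- Under the involution 3E₂(3z) and E₂(z) acquire the same non-modular term, which cancels in the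
difference. -/
lemma isForm_m2 : IsForm 2 (-1) m2 := by
  obtain ⟨φ, h, h0, h1⟩ := hasQ_m2
  refine ⟨?_, fun z hz => ?_, fun z hz => ?_, _, h.tendsto⟩
  · exact (((differentiableOn_comp_ofComplex_three E2_mdifferentiable).const_mul 3).fun_sub
      (differentiableOn_comp_ofComplex E2_mdifferentiable)).div_const 2
  · have e1 : ∀ w, EisensteinSeries.E2 (ofComplex (w + 1)) = EisensteinSeries.E2 (ofComplex w) :=
      E2_periodic
    rw [m2, m2, show 3 * (z + 1) = 3 * z + 1 + 1 + 1 by ring, e1, e1, e1, e1]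
  · rw [m2, m2, three_mul_fricke, E2_neg_inv hz, fricke, E2_neg_inv (three_mul_mem hz)]
    rw [show (s3 * z) ^ (2 : ℤ) = (s3 * s3) * z ^ 2 by rw [zpow_ofNat]; ring, s3C_sq]
    ring

lemma tendsto_m2 : Tendsto m2 imTop (𝓝 1) := by
  obtain ⟨φ, h, h0, h1⟩ := hasQ_m2
  exact h0 ▸ h.tendsto

lemma E4_periodic : Function.Periodic (ModularForm.E₄ ∘ ofComplex) 1 := by
  simpa using SlashInvariantFormClass.periodic_comp_ofComplex (h := 1) ModularForm.E₄ (by simp)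

lemma hasQ_E4 : ∃ φ, HasQ (fun z => ModularForm.E₄ (ofComplex z)) φ ∧ φ 0 = 1 := by
  refine ⟨_, ⟨ModularFormClass.analyticAt_cuspFunction_zero ModularForm.E₄ one_pos (by simp),
    ?_⟩, ?_⟩
  · filter_upwards with z
    rw [cuspParam_eq]
    exact (Function.Periodic.eq_cuspFunction one_ne_zero 
      (SlashInvariantFormClass.periodic_comp_ofComplex (h := 1) ModularForm.E₄ (by simp)) z).symm
  · have := EisensteinSeries.E_qExpansion_coeff_zero (k := 4) (by norm_num) (by decide)
    rw [qExpansion_coeff] at this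
    simpa using this

lemma E4_neg_inv {z : ℂ} (hz : 0 < z.im) : ModularForm.E₄ (ofComplex (-1 / z)) =
    z ^ 4 * ModularForm.E₄ (ofComplex z) := by
  have h := SlashInvariantForm.slash_action_eqn'' ModularForm.E₄
    (MonoidHom.mem_range.2 ⟨ModularGroup.S, rfl⟩) ⟨z, hz⟩
  rw [ofComplex_neg_inv hz, ofComplex_apply_of_im_pos hz]
  have h1 : denom (Matrix.SpecialLinearGroup.mapGL ℝ ModularGroup.S) z = z :=
    ModularGroup.denom_S ⟨z, hz⟩
  refine h.trans ?_
  change denom (Matrix.SpecialLinearGroup.mapGL ℝ ModularGroup.S) z ^ (4 : ℤ) * _ = _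
  rw [h1, zpow_ofNat]

lemma isForm_m4 : IsForm 4 1 m4 := by
  obtain ⟨φ, h, h0⟩ := hasQ_E4
  refine ⟨?_, fun z hz => ?_, fun z hz => ?_, _,
    (((h.comp_three_mul.const_mul 9).add h).div (HasQ.const 10) (by norm_num)).tendsto⟩
  · exact (((differentiableOn_comp_ofComplex_three ModularForm.E₄.holo').const_mul 9).fun_add
      (differentiableOn_comp_ofComplex ModularForm.E₄.holo')).div_const 10
  · have e1 : ∀ w, ModularForm.E₄ (ofComplex (w + 1)) = ModularForm.E₄ (ofComplex w) :=
      E4_periodic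
    rw [m4, m4, show 3 * (z + 1) = 3 * z + 1 + 1 + 1 by ring, e1, e1, e1, e1]
  · rw [m4, m4, three_mul_fricke, E4_neg_inv hz, fricke, E4_neg_inv (three_mul_mem hz)]
    rw [show (s3 * z) ^ (4 : ℤ) = (s3 * s3) ^ 2 * z ^ 4 by rw [zpow_ofNat]; ring, s3C_sq]
    ring

lemma tendsto_m4 : Tendsto m4 imTop (𝓝 1) := by
  obtain ⟨φ, h, h0⟩ := hasQ_E4
  convert! (((h.comp_three_mul.const_mul 9).add h).div (HasQ.const 10) (by norm_num)).tendsto using 2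
  simp [h0]; norm_num

/-- Forms of weight `4` and trivial character are multiples of `M₂²`. -/
lemma IsForm.eq_mul_m2_sq {f : ℂ → ℂ} (hf : IsForm 4 1 f) {L : ℂ} (hL : Tendsto f imTop (𝓝 L))
    {z : ℂ} (hz : 0 < z.im) : f z = L * m2 z ^ 2 := by
  have h := hf.sub (((isForm_m2.pow 2).const_mul L).congr (w' := 4) (ε' := 1) rfl (by norm_num)
    fun _ _ => rfl)
  have h0 := hL.sub ((tendsto_m2.pow 2).const_mul L)
  have := h.eq_zero_of_tendsto_zero (by simpa using h0) 3 2 (by norm_num) (by norm_num) (by norm_num)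
    z hz
  exact sub_eq_zero.1 this

theorem m4_eq {z : ℂ} (hz : 0 < z.im) : m4 z = m2 z ^ 2 := by
  simpa using isForm_m4.eq_mul_m2_sq tendsto_m4 hz

/-! ### The elliptic point of order `6` -/

/-- The point `1/2 + i/(2√3)`, which is fixed by `matR`. -/
def ellPt : ℂ := 1 / 2 + I / (2 * s3)

lemma s3_mul_ellPt : s3 * ellPt = (s3 + I) / 2 := by
  have := s3C_ne
  rw [ellPt]
  field_simp

lemma s3_mul_ellPt_sq : (s3 * ellPt) ^ 2 = (1 + I * s3) / 2 := by
  rw [s3_mul_ellPt]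
  linear_combination (1 / 4) * s3C_sq + (1 / 4) * I_sq

lemma s3_mul_ellPt_cube : (s3 * ellPt) ^ 3 = I := by
  rw [pow_succ, s3_mul_ellPt_sq, s3_mul_ellPt]
  linear_combination (I / 4) * s3C_sq + (s3 / 4) * I_sq

lemma ellPt_im : 0 < ellPt.im := by
  have h : ellPt = ((1 / 2 : ℝ) : ℂ) + ((1 / (2 * √3) : ℝ) : ℂ) * I := by
    rw [ellPt]; push_cast; ring
  rw [h]
  simp

lemma three_mul_ellPt_sq : 3 * ellPt ^ 2 = 3 * ellPt - 1 := by
  have h1 := s3_mul_ellPt_sq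
  have h2 : s3 * (s3 * ellPt) = s3 * ((s3 + I) / 2) := by rw [s3_mul_ellPt]
  have h3 := s3C_sq
  linear_combination h1 - h2 + (ellPt - ellPt ^ 2 - 1 / 2) * h3

lemma fricke_ellPt : fricke ellPt + 1 = ellPt := by
  have h := three_mul_ellPt_sq
  have h0 := ne_zero_of_im ellPt_im
  rw [fricke]
  field_simp
  linear_combination -h

/-- `ellPt` is fixed by the involution followed by z ↦ z + 1, so a form vanishes there unless its
automorphy factor at this point is 1. -/
lemma IsForm.apply_ellPt {w : ℤ} {ε : ℂ} {f : ℂ → ℂ} (hf : IsForm w ε f) :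
    f ellPt = ε * (s3 * ellPt) ^ w * f ellPt := by
  rw [← hf.fricke _ ellPt_im, ← hf.per _ (fricke_im ellPt_im), fricke_ellPt]

lemma s3_mul_ellPt_sq_ne : -1 * (s3 * ellPt) ^ 2 ≠ 1 := by
  intro h
  have h3 : ((s3 * ellPt) ^ 2) ^ 3 = -1 := by
    rw [← pow_mul, mul_comm 2 3, pow_mul, s3_mul_ellPt_cube, I_sq]
  have h4 : (s3 * ellPt) ^ 2 = -1 := by linear_combination -h
  rw [s3_mul_ellPt_sq] at h4
  have h5 : I * s3 = -3 := by linear_combination 2 * h4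
  have h6 : (I * s3) * (I * s3) = 9 := by rw [h5]; norm_num
  have : (-3 : ℂ) = 9 := by rw [← h6]; linear_combination (-s3 * s3) * I_mul_I + s3C_sq
  norm_num at this

lemma m2_ellPt : m2 ellPt = 0 := by
  have h := isForm_m2.apply_ellPt
  rw [zpow_ofNat] at h
  by_contra h0
  exact s3_mul_ellPt_sq_ne (mul_right_cancel₀ h0 (by rw [one_mul]; exact h.symm))

/-! ### The square root of `M₂` -/

lemma eta_quot_eq (z : ℂ) : ModularForm.eta z ^ 9 / ModularForm.eta (3 * z) ^ 3 =
    eulerProd (cuspParam z) ^ 9 / eulerProd (cuspParam z ^ 3) ^ 3 := by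
  have h : Function.Periodic.qParam 24 z ^ 9 = Function.Periodic.qParam 24 (3 * z) ^ 3 := by
    rw [Function.Periodic.qParam, Function.Periodic.qParam, exp_pow_eq, exp_pow_eq]
    congr 1
    push_cast
    ring
  rw [eta_eq, eta_eq, cuspParam_three_mul, mul_pow, mul_pow, h, mul_div_mul_left]
  exact pow_ne_zero _ (exp_ne_zero _)

lemma eta_quot_eq' (z : ℂ) : ModularForm.eta (3 * z) ^ 9 / ModularForm.eta z ^ 3 =
    cuspParam z * (eulerProd (cuspParam z ^ 3) ^ 9 / eulerProd (cuspParam z) ^ 3) := by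
  have h : Function.Periodic.qParam 24 (3 * z) ^ 9 =
      cuspParam z * Function.Periodic.qParam 24 z ^ 3 := by
    rw [Function.Periodic.qParam, Function.Periodic.qParam, exp_pow_eq, exp_pow_eq, cuspParam,
      ← exp_add]
    congr 1
    push_cast
    ring
  rw [eta_eq, eta_eq, cuspParam_three_mul, mul_pow, mul_pow, h, mul_assoc, mul_div_assoc,
    mul_div_mul_left]
  exact pow_ne_zero _ (exp_ne_zero _)

lemma tendsto_eulerProd {f : ℂ → ℂ} (hf : Tendsto f imTop (𝓝 0)) :
    Tendsto (fun z => eulerProd (f z)) imTop (𝓝 1) := by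
  rw [← eulerProd_zero]
  exact analyticAt_eulerProd.continuousAt.tendsto.comp hf

lemma tendsto_etaCube : Tendsto etaCube imTop (𝓝 1) := by
  have h1 := tendsto_eulerProd tendsto_cuspParam'
  have h3 := tendsto_eulerProd (f := fun z => cuspParam z ^ 3) (by simpa using tendsto_cuspParam'.pow 3)
  have h := ((h1.pow 9).div (h3.pow 3) (by simp)).add
    (((tendsto_cuspParam'.mul ((h3.pow 9).div (h1.pow 3) (by simp)))).const_mul 27)
  simp only [one_pow, div_one, zero_mul, mul_zero, add_zero] at h
  refine h.congr fun z => ?_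
  rw [etaCube, eta_quot_eq, eta_quot_eq']
  rfl

lemma isForm_etaCube : IsForm 3 I etaCube :=
  ⟨differentiableOn_etaCube, fun z _ => etaCube_add_one z, fun _ hz => etaCube_fricke hz, 1,
    tendsto_etaCube⟩

lemma etaCube_ellPt : etaCube ellPt = 0 := by
  have h := isForm_etaCube.apply_ellPt
  rw [zpow_ofNat, s3_mul_ellPt_cube, I_mul_I] at h
  linear_combination h / 2

/-- Both sides have weight 6 and constant term 1, so they differ by a multiple of M₆. Both vanish at
`ellPt`, where M₆ does not. -/
lemma etaCube_sq {z : ℂ} (hz : 0 < z.im) : etaCube z ^ 2 = m2 z ^ 3 := by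
  have hf : IsForm 6 (-1) (fun z => etaCube z ^ 2 - m2 z ^ 3) :=
    ((isForm_etaCube.pow 2).congr (by norm_num) (by simp) fun _ _ => rfl).sub
      ((isForm_m2.pow 3).congr (by norm_num) (by norm_num) fun _ _ => rfl)
  have h0 : Tendsto (fun z => etaCube z ^ 2 - m2 z ^ 3) imTop (𝓝 0) := by
    simpa using (tendsto_etaCube.pow 2).sub (tendsto_m2.pow 3)
  obtain ⟨L, hL⟩ := hf.tendsto_div_param h0
  have h := hf.eq_mul_g6_pow (m := 1) (by norm_num) (by norm_num) (by simpa using hL)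
  have h1 := h _ ellPt_im
  simp only [etaCube_ellPt, m2_ellPt] at h1
  have hL0 : L = 0 := by
    have h2 : L = 0 ∨ g6 ellPt = 0 := by simpa using h1.symm
    exact h2.resolve_right (g6_ne_zero ellPt_im)
  have := h z hz
  rw [hL0, zero_mul] at this
  exact sub_eq_zero.1 this

/-- The weight `1` form whose square is `M₂`. -/
def m1 (z : ℂ) : ℂ := etaCube z / m2 z

/-- At a zero of `m2` the quotient is 0 by the convention on division, which is the right value. -/
lemma m1_sq {z : ℂ} (hz : 0 < z.im) : m1 z ^ 2 = m2 z := by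
  rw [m1, div_pow, etaCube_sq hz]
  rcases eq_or_ne (m2 z) 0 with h | h
  · simp [h]
  · field_simp

lemma m1_eq_zero_iff {z : ℂ} (hz : 0 < z.im) : m1 z = 0 ↔ m2 z = 0 := by
  rw [← m1_sq hz]; simp

lemma exists_m2_ne_zero : ∃ z : ℂ, 0 < z.im ∧ m2 z ≠ 0 :=
  exists_im_pos_of_imTop (tendsto_m2.eventually_ne one_ne_zero)

/-- The zeros of `m2` are isolated and |`m1`|² = |`m2`| tends to 0 at them, so the singularities are
removable with the value 0 already in place. -/
lemma differentiableOn_m1 : DifferentiableOn ℂ m1 ℍₒ := by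
  intro z hz
  refine DifferentiableAt.differentiableWithinAt ?_
  have hz : 0 < z.im := hz
  have hd : ∀ w : ℂ, 0 < w.im → m2 w ≠ 0 → DifferentiableAt ℂ m1 w := fun w hw h =>
    (differentiableAt_of_H differentiableOn_etaCube hw).fun_div
      (differentiableAt_of_H isForm_m2.diff hw) h
  by_cases h : m2 z = 0
  · refine (analyticAt_of_differentiable_on_punctured_nhds_of_continuousAt ?_ ?_).differentiableAt
    · obtain ⟨z₁, hz₁, h1⟩ := exists_m2_ne_zero
      filter_upwards [eventually_ne_zero_of_H isForm_m2.diff hz₁ h1 hz,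
        (eventually_mem_H hz).filter_mono nhdsWithin_le_nhds] with w h2 h3
      exact hd w h3 h2
    · rw [ContinuousAt, (m1_eq_zero_iff hz).2 h, tendsto_zero_iff_norm_tendsto_zero]
      have hc : Tendsto (fun w => √‖m2 w‖) (𝓝 z) (𝓝 0) := by
        have := (differentiableAt_of_H isForm_m2.diff hz).continuousAt.norm.sqrt
        simpa [ContinuousAt, h] using this
      refine hc.congr' ?_
      filter_upwards [eventually_mem_H hz] with w hw
      rw [← m1_sq hw, norm_pow, Real.sqrt_sq (norm_nonneg _)]
  · exact hd z hz h

lemma tendsto_m1 : Tendsto m1 imTop (𝓝 1) := by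
  have := tendsto_etaCube.div tendsto_m2 one_ne_zero
  rw [div_one] at this
  exact this

lemma isForm_m1 : IsForm 1 (-I) m1 := by
  refine ⟨differentiableOn_m1, fun z hz => ?_, fun z hz => ?_, 1, tendsto_m1⟩
  · rw [m1, m1, isForm_etaCube.per z hz, isForm_m2.per z hz]
  · rw [m1, m1, isForm_etaCube.fricke z hz, isForm_m2.fricke z hz, mul_div_mul_comm]
    congr 1
    have := s3_mul_ne_zero hz
    rw [zpow_ofNat, zpow_ofNat, zpow_one]
    field_simp

lemma m1_ellPt : m1 ellPt = 0 := (m1_eq_zero_iff ellPt_im).2 m2_ellPt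

/-- The coefficients of q in m1² = M₂ give 2 · 6 = 12. -/
lemma hasQ_m1 : ∃ φ, HasQ m1 φ ∧ φ 0 = 1 ∧ deriv φ 0 = 6 := by
  obtain ⟨φ, hφ, h0⟩ := isForm_m1.hasQ tendsto_m1
  obtain ⟨ψ, hψ, h1, h2⟩ := hasQ_m2
  refine ⟨φ, hφ, h0, ?_⟩
  have h3 : HasQ m2 (fun q => φ q ^ 2) := (hφ.pow 2).congr (by
    filter_upwards [eventually_im_gt 0] with z hz using (m1_sq hz).symm)
  have h4 := (h3.unique hψ).deriv_eq
  rw [(hφ.analytic.differentiableAt.hasDerivAt.fun_pow 2).deriv, h2, h0] at h4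
  norm_num at h4
  linear_combination h4 / 2

lemma hasDerivAt_of_H {f : ℂ → ℂ} (hf : DifferentiableOn ℂ f ℍₒ) {z : ℂ} (hz : 0 < z.im) :
    HasDerivAt f (deriv f z) z := (differentiableAt_of_H hf hz).hasDerivAt

lemma differentiableOn_deriv {f : ℂ → ℂ} (hf : DifferentiableOn ℂ f ℍₒ) :
    DifferentiableOn ℂ (deriv f) ℍₒ := hf.deriv isOpen_H

lemma m1_fricke {z : ℂ} (hz : 0 < z.im) : m1 (fricke z) = -I * s3 * (z * m1 z) := by
  rw [isForm_m1.fricke z hz, zpow_one]; ring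

lemma deriv_m1_fricke {z : ℂ} (hz : 0 < z.im) :
    deriv m1 (fricke z) = -I * s3 * (3 * z ^ 2 * m1 z + 3 * z ^ 3 * deriv m1 z) := by
  have hd := (((hasDerivAt_id z).fun_mul (hasDerivAt_of_H differentiableOn_m1 hz)).const_mul (-I * s3))
  rw [deriv_fricke differentiableOn_m1 (fun w hw => m1_fricke hw) hz hd]
  simp only [id]
  ring

lemma deriv_deriv_m1_fricke {z : ℂ} (hz : 0 < z.im) : deriv (deriv m1) (fricke z) =
    -I * s3 * (18 * z ^ 3 * m1 z + 36 * z ^ 4 * deriv m1 z + 9 * z ^ 5 * deriv (deriv m1) z) := by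
  have h2 := ((hasDerivAt_pow 2 z).const_mul 3).fun_mul (hasDerivAt_of_H differentiableOn_m1 hz)
  have h3 := ((hasDerivAt_pow 3 z).const_mul 3).fun_mul
    (hasDerivAt_of_H (differentiableOn_deriv differentiableOn_m1) hz)
  rw [deriv_fricke (differentiableOn_deriv differentiableOn_m1) (fun w hw => deriv_m1_fricke hw) hz
    ((h2.fun_add h3).const_mul (-I * s3))]
  norm_num
  ring

/-- The second Rankin-Cohen bracket of `M₂^{1/2}` with itself is a multiple of `M₆`. -/
theorem m1_bracket {z : ℂ} (hz : 0 < z.im) :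
    m1 z * deriv (deriv m1) z - 2 * deriv m1 z ^ 2 = -24 * Real.pi ^ 2 * g6 z := by
  obtain ⟨φ, hφ, h0, h1⟩ := hasQ_m1
  have hd1 := differentiableOn_m1
  have hd2 := differentiableOn_deriv hd1
  have hd3 := differentiableOn_deriv hd2
  -- Since m1 = 1 + 6q + … and m1' = O(q), the coefficient of q comes from m1 m1'' alone and is
  -- (2πi)² · 6.
  have hlim : Tendsto (fun z => (m1 z * deriv (deriv m1) z - 2 * deriv m1 z ^ 2) / cuspParam z ^ 1)
      imTop (𝓝 (-24 * (Real.pi : ℂ) ^ 2)) := by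
    have := (hφ.tendsto.mul hφ.tendsto_deriv_deriv_div).sub
      ((hφ.tendsto_deriv.mul hφ.tendsto_deriv_div).const_mul 2)
    rw [h0, h1, zero_mul, mul_zero, one_mul, sub_zero,
      show (2 * Real.pi * I) ^ 2 * 6 = -24 * (Real.pi : ℂ) ^ 2 by
        linear_combination (24 * (Real.pi : ℂ) ^ 2) * I_sq] at this
    refine this.congr fun z => ?_
    ring
  have hper1 : ∀ z : ℂ, 0 < z.im → deriv m1 (z + 1) = deriv m1 z :=
    fun z hz => deriv_add_one' isForm_m1.per hz
  have hf : IsForm 6 (-1) (fun z => m1 z * deriv (deriv m1) z - 2 * deriv m1 z ^ 2) := by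
    refine ⟨(hd1.fun_mul hd3).fun_sub ((hd2.fun_pow 2).const_mul 2), fun z hz => ?_, fun z hz => ?_,
      ?_⟩
    · rw [isForm_m1.per z hz, hper1 z hz, deriv_add_one' hper1 hz]
    · rw [m1_fricke hz, deriv_m1_fricke hz, deriv_deriv_m1_fricke hz, zpow_ofNat]
      have h6 : s3 ^ 6 = 27 := by
        calc s3 ^ 6 = (s3 * s3) ^ 3 := by ring
          _ = 27 := by rw [s3C_sq]; norm_num
      rw [mul_pow s3 z, h6]
      have h2 : (-I * s3) ^ 2 = -3 := by linear_combination (s3 * s3) * I_sq - s3C_sq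
      linear_combination (9 * z ^ 6 * (m1 z * deriv (deriv m1) z - 2 * deriv m1 z ^ 2)) * h2
    · have := hφ.tendsto.mul hφ.deriv.tendsto_deriv |>.sub ((hφ.tendsto_deriv.pow 2).const_mul 2)
      exact ⟨_, this⟩
  simpa using hf.eq_mul_g6_pow (m := 1) (by norm_num) (by norm_num) hlim z hz

/-! ### The logarithmic derivative of `M₆^{1/2}` and the form of weight `3` -/

/-- The logarithmic derivative of `M₆^{1/2}`, a quasimodular form of weight `2`. -/
def etaLog (z : ℂ) : ℂ := deriv etaRoot z / etaRoot z

lemma differentiableOn_etaLog : DifferentiableOn ℂ etaLog ℍₒ :=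
  (differentiableOn_deriv differentiableOn_etaRoot).fun_div differentiableOn_etaRoot
    fun _ hz => etaRoot_ne_zero hz

lemma etaLog_add_one {z : ℂ} (hz : 0 < z.im) : etaLog (z + 1) = etaLog z := by
  rw [etaLog, etaLog, deriv_add_one (s := -1) (fun z _ => by rw [etaRoot_add_one]; ring) hz,
    etaRoot_add_one, neg_one_mul, neg_div_neg_eq]

/-- Logarithmic differentiation of the weight 3 law of `etaRoot`; the factor z³ contributes 3z² ·
3/z. -/
lemma etaLog_fricke {z : ℂ} (hz : 0 < z.im) : etaLog (fricke z) = 3 * z ^ 2 * etaLog z + 9 * z := by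
  have hd := (((hasDerivAt_pow 3 z).fun_mul
    (hasDerivAt_of_H differentiableOn_etaRoot hz)).const_mul (I * s3 ^ 3))
  have h1 := deriv_fricke differentiableOn_etaRoot (g := fun w => I * s3 ^ 3 * (w ^ 3 * etaRoot w))
    (fun w hw => by rw [etaRoot_fricke hw]; ring) hz hd
  have h0 := ne_zero_of_im hz
  have he := etaRoot_ne_zero hz
  have hs := s3C_ne
  have hI := I_ne_zero
  rw [etaLog, etaLog, h1, etaRoot_fricke hz]
  field_simp
  norm_num
  ring

/-- `etaRoot` changes sign under z ↦ z + 1, so the expansion is derived from that of its square `g6`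
= q + …; the constant term is half of 2πi. -/
lemma hasQ_etaLog : ∃ φ, HasQ etaLog φ ∧ φ 0 = Real.pi * I := by
  obtain ⟨θ, hθ, h0⟩ := hasQ_g6_div
  refine ⟨_, (((hθ.const_mul (Real.pi * I)).add (hθ.deriv.const_mul (1 / 2))).div hθ
    (by simp [h0])).congr ?_, by simp [h0]⟩
  filter_upwards [eventually_im_gt 0] with z hz
  have hq := cuspParam_ne_zero z
  have he := etaRoot_ne_zero hz
  have hdg : HasDerivAt g6 (2 * etaRoot z * deriv etaRoot z) z := by
    simpa [g6] using! (hasDerivAt_of_H differentiableOn_etaRoot hz).fun_pow 2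
  rw [(hdg.fun_div (hasDerivAt_cuspParam z) hq).deriv, etaLog, g6]
  field_simp
  ring

lemma tendsto_etaLog : Tendsto etaLog imTop (𝓝 (Real.pi * I)) := by
  obtain ⟨φ, hφ, h⟩ := hasQ_etaLog
  exact h ▸ hφ.tendsto

/-- The Serre derivative of `M₂^{1/2}`, a form of weight `3`. -/
def m3 (z : ℂ) : ℂ := deriv m1 z - etaLog z * m1 z / 3

lemma tendsto_m3 : Tendsto m3 imTop (𝓝 (-(Real.pi * I) / 3)) := by
  obtain ⟨φ, hφ, h0, h1⟩ := hasQ_m1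
  have := hφ.tendsto_deriv.sub ((tendsto_etaLog.mul tendsto_m1).div_const 3)
  rw [mul_one, zero_sub, ← neg_div] at this
  exact this

/-- The factor 1/3 is the ratio of the weights of `m1` and `etaRoot`; it makes the non-modular terms
of m1' and etaLog · m1 cancel. -/
lemma isForm_m3 : IsForm 3 (-I) m3 := by
  refine ⟨(differentiableOn_deriv differentiableOn_m1).fun_sub
    ((differentiableOn_etaLog.fun_mul differentiableOn_m1).div_const 3), fun z hz => ?_,
    fun z hz => ?_, _, tendsto_m3⟩
  · rw [m3, m3, deriv_add_one' isForm_m1.per hz, etaLog_add_one hz, isForm_m1.per z hz]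
  · rw [m3, m3, deriv_m1_fricke hz, etaLog_fricke hz, m1_fricke hz, zpow_ofNat]
    have h3 : s3 ^ 3 = 3 * s3 := by rw [pow_succ, sq, s3C_sq]
    rw [mul_pow s3 z, h3]
    ring

/-! ### The cusps of `Γ₀⁺(3)` -/

/-- Elements of W₃ square into Γ₀(3). A parabolic element thus has an integral parabolic square
fixing the same cusp, which reduces the cusps to those of SL(2, ℤ). -/
lemma mul_self_integral (A : GammaPlus) : ∃ γ : SL(2, ℤ),
    (Matrix.SpecialLinearGroup.toGL (A : SL(2, ℝ))) ^ 2 = Matrix.SpecialLinearGroup.mapGL ℝ γ := by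
  have key : ∃ a b c d : ℤ, ((A : SL(2, ℝ)) * (A : SL(2, ℝ))) 0 0 = a ∧
      ((A : SL(2, ℝ)) * (A : SL(2, ℝ))) 0 1 = b ∧ ((A : SL(2, ℝ)) * (A : SL(2, ℝ))) 1 0 = c ∧
      ((A : SL(2, ℝ)) * (A : SL(2, ℝ))) 1 1 = d := by
    rcases A.2 with hA | hA
    · obtain ⟨a, b, c, d, hA⟩ := (isGammaZero_iff _).1 hA
      obtain ⟨h1, h2, h3, h4⟩ := mul_GG hA hA
      exact ⟨_, _, 3 * (c * a + d * c), _, h1, h2, by rw [h3]; push_cast; rfl, h4⟩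
    · obtain ⟨a, b, c, d, hA⟩ := (isAtkinLehner_iff _).1 hA
      obtain ⟨h1, h2, h3, h4⟩ := mul_WW hA hA
      exact ⟨_, _, 3 * (c * a + d * c), _, h1, h2, by rw [h3]; push_cast; rfl, h4⟩
  obtain ⟨a, b, c, d, h1, h2, h3, h4⟩ := key
  have hdet := det_eq ((A : SL(2, ℝ)) * (A : SL(2, ℝ)))
  rw [h1, h2, h3, h4] at hdet
  refine ⟨⟨!![a, b; c, d], by rw [Matrix.det_fin_two_of]; exact_mod_cast hdet⟩, ?_⟩
  rw [sq, ← map_mul]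
  ext i j
  fin_cases i <;> fin_cases j
  · exact h1
  · exact h2
  · exact h3
  · exact h4

lemma toGL_smul_infty (A : SL(2, ℝ)) : (A : GL (Fin 2) ℝ) • (OnePoint.infty : OnePoint ℝ) =
    if A 1 0 = 0 then OnePoint.infty else ((A 0 0 / A 1 0 : ℝ) : OnePoint ℝ) :=
  OnePoint.smul_infty_eq_ite _

lemma mapGL_smul_infty (γ : SL(2, ℤ)) :
    Matrix.SpecialLinearGroup.mapGL ℝ γ • (OnePoint.infty : OnePoint ℝ) =
    if (γ 1 0 : ℝ) = 0 then OnePoint.infty else ((γ 0 0 / γ 1 0 : ℝ) : OnePoint ℝ) :=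
  OnePoint.smul_infty_eq_ite _

lemma isCusp_SL2Z_of_isCusp {c : OnePoint ℝ}
    (hc : IsCusp c (GammaPlus.map
      (Matrix.SpecialLinearGroup.toGL : SL(2, ℝ) →* GL (Fin 2) ℝ))) : IsCusp c 𝒮ℒ := by
  obtain ⟨p, ⟨A, hA, rfl⟩, hp, hpc⟩ := hc
  obtain ⟨γ, hγ⟩ := mul_self_integral ⟨A, hA⟩
  refine ⟨_, ⟨γ, rfl⟩, ?_, ?_⟩
  · rw [← hγ]; exact hp.pow two_ne_zero
  · rw [← hγ, sq, mul_smul, hpc, hpc]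

/-- All cusps of `Γ₀⁺(3)` are equivalent to `∞`. -/
lemma exists_smul_infty_eq {c : OnePoint ℝ}
    (hc : IsCusp c (GammaPlus.map
      (Matrix.SpecialLinearGroup.toGL : SL(2, ℝ) →* GL (Fin 2) ℝ))) :
    ∃ A : GammaPlus, c = ((A : SL(2, ℝ)) : GL (Fin 2) ℝ) • OnePoint.infty := by
  obtain ⟨γ, rfl⟩ := isCusp_SL2Z_iff'.1 (isCusp_SL2Z_of_isCusp hc)
  have hdet : γ 0 0 * γ 1 1 - γ 0 1 * γ 1 0 = 1 := by
    have := γ.det_coe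
    rwa [Matrix.det_fin_two] at this
  by_cases hc : (3 : ℤ) ∣ γ 1 0
  · obtain ⟨c, hc⟩ := hc
    let A : SL(2, ℝ) := ⟨!![(γ 0 0 : ℝ), γ 0 1; 3 * c, γ 1 1], by
      rw [Matrix.det_fin_two_of]
      rw [hc] at hdet
      have : ((γ 0 0 * γ 1 1 - γ 0 1 * (3 * c) : ℤ) : ℝ) = 1 := by rw [hdet]; simp
      push_cast at this
      exact this⟩
    refine ⟨⟨A, Or.inl ⟨γ 0 0, γ 0 1, c, γ 1 1, rfl⟩⟩, ?_⟩
    rw [toGL_smul_infty, mapGL_smul_infty, hc]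
    simp [A]
  -- The image of ∞ depends only on the ratio of the first column, so an element of W₃ whose first
  -- column is √3 times that of γ suffices; j and e complete it to determinant 1.
  · obtain ⟨j, e, hj⟩ := exists_int_dvd_sub_mul hc (γ 1 1)
    let A : SL(2, ℝ) := ⟨(1 / √3 : ℝ) • !![(3 * γ 0 0 : ℝ), (γ 0 1 - j * γ 0 0 : ℤ); 3 * γ 1 0, 3 * e], by
      rw [Matrix.det_smul, Matrix.det_fin_two_of, Fintype.card_fin, div_pow,
        Real.sq_sqrt (by norm_num)]
      have h1 : ((γ 0 0 * γ 1 1 - γ 0 1 * γ 1 0 : ℤ) : ℝ) = 1 := by rw [hdet]; simp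
      have h2 : ((γ 1 1 - j * γ 1 0 : ℤ) : ℝ) = (3 * e : ℤ) := by rw [hj]
      push_cast at h1 h2 ⊢
      linear_combination h1 - (γ 0 0 : ℝ) * h2⟩
    refine ⟨⟨A, Or.inr ⟨γ 0 0, γ 0 1 - j * γ 0 0, γ 1 0, e, rfl⟩⟩, ?_⟩
    have h0 : γ 1 0 ≠ 0 := fun h => hc (by rw [h]; exact dvd_zero 3)
    have h3 := s3_ne
    have h4 : (1 / √3 * (3 * (γ 0 0 : ℝ))) / (1 / √3 * (3 * (γ 1 0 : ℝ))) = γ 0 0 / γ 1 0 := by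
      rw [mul_div_mul_left _ _ (by positivity), mul_div_mul_left _ _ three_ne_zero]
    have h5 : A 1 0 ≠ 0 := by simp [A, h0]
    rw [toGL_smul_infty, mapGL_smul_infty, if_neg (by exact_mod_cast h0), if_neg h5, ← h4]
    rfl

/-! ### Quasimodular forms of depth one as pairs of functions -/

/-- The nearly holomorphic function attached to a pair of functions. -/
def nearly (f0 f1 : ℂ → ℂ) (z : ℂ) : ℂ := f0 z + f1 z / (z - (starRingEnd ℂ) z)

/-- Holomorphic functions `f0`, `f1` for which `f0 + f1 / (z - z̄)` transforms with weight `w` under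
`z ↦ z + 1` and `z ↦ -1 / (3z)`, the latter with multiplier `ε`. -/
structure QuasiLaws (w : ℤ) (ε : ℂ) (f0 f1 : ℂ → ℂ) : Prop where
  diff0 : DifferentiableOn ℂ f0 ℍₒ
  diff1 : DifferentiableOn ℂ f1 ℍₒ
  per0 : ∀ z, 0 < z.im → f0 (z + 1) = f0 z
  per1 : ∀ z, 0 < z.im → f1 (z + 1) = f1 z
  fricke0 : ∀ z, 0 < z.im → f0 (fricke z) = ε * (s3 * z) ^ w * (f0 z + f1 z / z)
  fricke1 : ∀ z, 0 < z.im → f1 (fricke z) = ε * (s3 * z) ^ (w - 2) * f1 z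

/-- Pairs as in `QuasiLaws` with limits at `∞`. -/
structure QuasiPair (w : ℤ) (ε : ℂ) (f0 f1 : ℂ → ℂ) : Prop extends QuasiLaws w ε f0 f1 where
  lim0 : ∃ L, Tendsto f0 imTop (𝓝 L)
  lim1 : ∃ L, Tendsto f1 imTop (𝓝 L)

lemma sub_conj_ne_zero {z : ℂ} (hz : 0 < z.im) : z - (starRingEnd ℂ) z ≠ 0 := by
  rw [sub_conj]
  simp [hz.ne']

lemma fricke_sub_conj {z : ℂ} (hz : 0 < z.im) :
    fricke z - (starRingEnd ℂ) (fricke z) =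
      (z - (starRingEnd ℂ) z) / (3 * z * (starRingEnd ℂ) z) := by
  have h0 := ne_zero_of_im hz
  have h1 : (starRingEnd ℂ) z ≠ 0 := by simpa using h0
  simp only [fricke, map_div₀, map_neg, map_one, map_mul, Complex.conj_ofNat]
  field_simp
  ring

namespace QuasiLaws

variable {w : ℤ} {ε : ℂ} {f0 f1 : ℂ → ℂ}

lemma nearly_add_one (h : QuasiLaws w ε f0 f1) {z : ℂ} (hz : 0 < z.im) :
    nearly f0 f1 (z + 1) = nearly f0 f1 z := by
  rw [nearly, nearly, h.per0 z hz, h.per1 z hz, map_add, map_one, add_sub_add_right_eq_sub]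

lemma nearly_fricke (h : QuasiLaws w ε f0 f1) {z : ℂ} (hz : 0 < z.im) :
    nearly f0 f1 (fricke z) = ε * (s3 * z) ^ w * nearly f0 f1 z := by
  have h0 := ne_zero_of_im hz
  have h1 : (starRingEnd ℂ) z ≠ 0 := by simpa using h0
  have h2 := sub_conj_ne_zero hz
  rw [nearly, nearly, h.fricke0 z hz, h.fricke1 z hz, fricke_sub_conj hz,
    zpow_sub₀ (s3_mul_ne_zero hz), zpow_ofNat, mul_pow, sq s3, s3C_sq]
  field_simp
  ring

end QuasiLaws

/-- The law passes to products and inverses, so the generators suffice. `matS` and `matR` have the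
same bottom row and the same value of χ, and their actions differ by z ↦ z + 1. -/
lemma slash_eq_of_laws {F : ℂ → ℂ} {w : ℤ} {k : ℕ}
    (hT : ∀ z, 0 < z.im → F (z + 1) = F z)
    (hS : ∀ z, 0 < z.im → F (fricke z) = (-I) ^ k * (s3 * z) ^ w * F z) (γ : GammaPlus) :
    (fun z : ℍ => F z) ∣[w] ((γ : SL(2, ℝ)) : GL (Fin 2) ℝ) =
      (chi ^ k) γ • (fun z : ℍ => F z) := by
  have hγ : γ ∈ Subgroup.closure {matS, matR} := by rw [closure_matS_matR]; trivial
  have key : ∀ A : GammaPlus, chi A = -I → (A : SL(2, ℝ)) 1 0 = √3 * (1 : ℤ) →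
      (A : SL(2, ℝ)) 1 1 = √3 * (0 : ℤ) →
      (∀ z : ℍ, F ((((A : SL(2, ℝ)) : GL (Fin 2) ℝ) • z : ℍ) : ℂ) = F (fricke z)) →
      (fun z : ℍ => F z) ∣[w] ((A : SL(2, ℝ)) : GL (Fin 2) ℝ) =
        (chi ^ k) A • (fun z : ℍ => F z) := by
    intro A hchi h1 h2 h
    ext z
    have h0 := s3_mul_ne_zero z.im_pos
    rw [SL_slash, h z, hS z z.im_pos, h1, h2, Pi.smul_apply, MonoidHom.pow_apply, hchi, smul_eq_mul]
    push_cast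
    rw [mul_zero, add_zero, mul_one, zpow_neg]
    have := zpow_ne_zero w h0
    change s3 * (z : ℂ) ≠ 0 at h0
    have h9 : (s3 * (z : ℂ)) ^ w ≠ 0 := this
    field_simp
  induction hγ using Subgroup.closure_induction with
  | mem x hx =>
    rcases hx with rfl | rfl
    · exact key _ chi_matS matS_entries.2.2.1 matS_entries.2.2.2 fun z => by rw [matS_smul_coe]
    · exact key _ chi_matR matR_entries.2.2.1 matR_entries.2.2.2 fun z => by
        rw [matR_smul_coe, hT _ (fricke_im z.im_pos)]
  | one => simp
  | mul x y _ _ h1 h2 =>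
    rw [Subgroup.coe_mul, map_mul, SlashAction.slash_mul, h1, slash_smul, h2, map_mul, mul_smul]
  | inv x _ h =>
    have h1 : ((fun z : ℍ => F z) ∣[w] ((x : SL(2, ℝ)) : GL (Fin 2) ℝ)) ∣[w]
        (((x⁻¹ : GammaPlus) : SL(2, ℝ)) : GL (Fin 2) ℝ) = fun z : ℍ => F z := by
      rw [← SlashAction.slash_mul, ← map_mul, ← Subgroup.coe_mul]
      simp
    rw [h, slash_smul] at h1
    have h2 : (chi ^ k) x⁻¹ * (chi ^ k) x = 1 := by rw [← map_mul]; simp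
    have h3 := congrArg (fun G => (chi ^ k) x⁻¹ • G) h1
    simp only [smul_smul, h2, one_smul] at h3
    exact h3

/-- Up to equivalence ∞ is the only cusp: g = A * B with A in the group and B fixing ∞, and slashing
with B only rescales the limit. -/
lemma limit_at_cusp_of_laws {F : ℂ → ℂ} {w : ℤ} {k : ℕ}
    (hT : ∀ z, 0 < z.im → F (z + 1) = F z)
    (hS : ∀ z, 0 < z.im → F (fricke z) = (-I) ^ k * (s3 * z) ^ w * F z)
    (hlim : ∃ L, Tendsto F imTop (𝓝 L)) (g : SL(2, ℝ))
    (hg : IsCusp ((g : GL (Fin 2) ℝ) • OnePoint.infty)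
      (GammaPlus.map (Matrix.SpecialLinearGroup.toGL : SL(2, ℝ) →* GL (Fin 2) ℝ))) :
    ∃ L : ℂ, Tendsto ((fun z : ℍ => F z) ∣[w] (g : GL (Fin 2) ℝ)) atImInfty (𝓝 L) := by
  obtain ⟨A, hA⟩ := exists_smul_infty_eq hg
  obtain ⟨L, hL⟩ := hlim
  set B : SL(2, ℝ) := (A : SL(2, ℝ))⁻¹ * g with hB
  have h10 : (B : GL (Fin 2) ℝ) 1 0 = 0 := by
    rw [← OnePoint.smul_infty_eq_self_iff, hB, map_mul, mul_smul, hA, ← mul_smul, ← map_mul]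
    simp
  have hgB : g = A * B := by rw [hB]; group
  rw [hgB, map_mul, SlashAction.slash_mul, slash_eq_of_laws hT hS, slash_smul]
  have h1 : B 1 0 = 0 := h10
  have hF : Tendsto (fun z : ℍ => F z) atImInfty (𝓝 L) := hL.comp tendsto_coe_atImInfty
  have h2 := (hF.comp (tendsto_smul_atImInfty h10)).mul_const ((B 1 1 : ℂ) ^ (-w))
  refine ⟨(chi ^ k) A • (L * (B 1 1 : ℂ) ^ (-w)), Tendsto.const_smul ?_ _⟩
  refine h2.congr fun z => ?_
  rw [SL_slash, h1]
  simp

lemma tendsto_nearly {f0 f1 : ℂ → ℂ} {L0 L1 : ℂ} (h0 : Tendsto f0 imTop (𝓝 L0))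
    (h1 : Tendsto f1 imTop (𝓝 L1)) : Tendsto (nearly f0 f1) imTop (𝓝 L0) := by
  have h2 : Tendsto (fun z : ℂ => (z - (starRingEnd ℂ) z)⁻¹) imTop (𝓝 0) := by
    rw [tendsto_zero_iff_norm_tendsto_zero]
    have h3 : Tendsto (fun z : ℂ => (2 * |z.im|)⁻¹) imTop (𝓝 0) :=
      ((tendsto_abs_atTop_atTop.comp tendsto_comap).const_mul_atTop two_pos).inv_tendsto_atTop
    refine h3.congr fun z => ?_
    rw [sub_conj]
    simp
  have := h0.add (h1.mul h2)
  rw [mul_zero, add_zero] at this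
  exact this

/-- Pairs satisfying the transformation laws give quasimodular forms. -/
theorem QuasiPair.mem_quasimodular {w : ℤ} {k : ℕ} {f0 f1 : ℂ → ℂ}
    (h : QuasiPair w ((-I) ^ k) f0 f1) :
    (fun z : ℍ => f0 z) ∈ quasimodular GammaPlus (chi ^ k) w 1 := by
  have hn : nearlyHol ![(fun z : ℍ => f0 z), (fun z : ℍ => f1 z)] = fun z : ℍ => nearly f0 f1 z := by
    ext z
    simp [nearlyHol, nearly]
  refine ⟨![(fun z : ℍ => f0 z), (fun z : ℍ => f1 z)], fun j => ?_, ?_, rfl⟩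
  · fin_cases j
    · exact mdifferentiable_coe_comp h.diff0
    · exact mdifferentiable_coe_comp h.diff1
  · rw [hn]
    obtain ⟨L0, h0⟩ := h.lim0
    obtain ⟨L1, h1⟩ := h.lim1
    exact ⟨slash_eq_of_laws (fun z hz => h.nearly_add_one hz) fun z hz => h.nearly_fricke hz,
      limit_at_cusp_of_laws (fun z hz => h.nearly_add_one hz) (fun z hz => h.nearly_fricke hz)
        ⟨_, tendsto_nearly h0 h1⟩⟩

/-! ### The components of a quasimodular form -/

/-- A complex derivative c would give conj u = c u for all u, which is contradictory for u = 1 and u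
= I. -/
lemma not_differentiableAt_conj (z : ℂ) : ¬ DifferentiableAt ℂ (starRingEnd ℂ) z := by
  intro h
  have h1 : ∀ u : ℂ, (starRingEnd ℂ) u = deriv (starRingEnd ℂ) z * u := fun u => by
    have hr : HasDerivAt (fun t : ℝ => z + t * u) u 0 := by
      simpa using! (((hasDerivAt_id (0 : ℝ)).ofReal_comp.mul_const u).const_add z)
    have h2 : HasDerivAt (starRingEnd ℂ) (deriv (starRingEnd ℂ) z) (z + ((0 : ℝ) : ℂ) * u) := by
      simpa using h.hasDerivAt
    have h3 := h2.comp (0 : ℝ) hr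
    have h4 : HasDerivAt (fun t : ℝ => (starRingEnd ℂ) z + t * (starRingEnd ℂ) u)
        ((starRingEnd ℂ) u) 0 := by
      simpa using! (((hasDerivAt_id (0 : ℝ)).ofReal_comp.mul_const
        ((starRingEnd ℂ) u)).const_add ((starRingEnd ℂ) z))
    refine h4.unique ?_
    convert! h3 using 1
    ext t
    simp
  have h5 := h1 1
  have h6 := h1 I
  rw [map_one, mul_one] at h5
  rw [conj_I, ← h5, one_mul] at h6
  have := congrArg Complex.im h6
  norm_num at this

/-- The components of a nearly holomorphic function are determined by it. -/
lemma eq_zero_of_nearly_eq_zero {g0 g1 : ℂ → ℂ} (hg0 : DifferentiableOn ℂ g0 ℍₒ)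
    (hg1 : DifferentiableOn ℂ g1 ℍₒ) (h : ∀ z, 0 < z.im → nearly g0 g1 z = 0) {z : ℂ}
    (hz : 0 < z.im) : g0 z = 0 ∧ g1 z = 0 := by
  have h1 : ∀ z, 0 < z.im → g0 z * (starRingEnd ℂ) z = g0 z * z + g1 z := fun z hz => by
    have h2 := h z hz
    have h3 := sub_conj_ne_zero hz
    rw [nearly] at h2
    field_simp at h2
    linear_combination -h2
  -- Otherwise conjugation would be the holomorphic function (z g0 + g1)/g0 near this point.
  have h0 : g0 z = 0 := by
    by_contra hne
    have hd := differentiableAt_of_H hg0 hz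
    refine not_differentiableAt_conj z (DifferentiableAt.congr_of_eventuallyEq
      (((hd.fun_mul differentiableAt_id).fun_add (differentiableAt_of_H hg1 hz)).fun_div hd hne) ?_)
    filter_upwards [eventually_mem_H hz, hd.continuousAt.eventually_ne hne] with w hw hw0
    rw [eq_div_iff hw0, mul_comm, h1 w hw]
    rfl
  exact ⟨h0, by simpa [h0] using (h1 z hz).symm⟩

lemma eq_of_nearly_eq {f0 f1 g0 g1 : ℂ → ℂ} (hf0 : DifferentiableOn ℂ f0 ℍₒ)
    (hf1 : DifferentiableOn ℂ f1 ℍₒ) (hg0 : DifferentiableOn ℂ g0 ℍₒ)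
    (hg1 : DifferentiableOn ℂ g1 ℍₒ) (h : ∀ z, 0 < z.im → nearly f0 f1 z = nearly g0 g1 z) {z : ℂ}
    (hz : 0 < z.im) : f0 z = g0 z ∧ f1 z = g1 z := by
  have := eq_zero_of_nearly_eq_zero (hf0.fun_sub hg0) (hf1.fun_sub hg1) (fun z hz => by
    have := h z hz
    rw [nearly, nearly] at this
    rw [nearly]
    linear_combination this) hz
  exact ⟨sub_eq_zero.1 this.1, sub_eq_zero.1 this.2⟩

lemma differentiableOn_add_one {f : ℂ → ℂ} (hf : DifferentiableOn ℂ f ℍₒ) :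
    DifferentiableOn ℂ (fun z => f (z + 1)) ℍₒ :=
  hf.comp (differentiableOn_id.add_const 1) fun z (hz : 0 < z.im) => by
    simpa [upperHalfPlaneSet] using hz

lemma differentiableOn_comp_fricke {f : ℂ → ℂ} (hf : DifferentiableOn ℂ f ℍₒ) :
    DifferentiableOn ℂ (fun z => f (fricke z)) ℍₒ :=
  hf.comp (fun z (hz : 0 < z.im) =>
    (hasDerivAt_fricke (ne_zero_of_im hz)).differentiableAt.differentiableWithinAt)
    fun _ hz => fricke_im hz

lemma differentiableOn_s3_mul_zpow (w : ℤ) : DifferentiableOn ℂ (fun z => (s3 * z) ^ w) ℍₒ :=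
  fun z (hz : 0 < z.im) => ((differentiableAt_id.const_mul s3).zpow
    (Or.inl (s3_mul_ne_zero hz))).differentiableWithinAt

/-- Uniqueness of the components splits each law into two. For the involution, z z̄/(z - z̄) = z²/(z
- z̄) - z brings the left side into the form with holomorphic components. -/
theorem quasiLaws_of_nearly {w : ℤ} {ε : ℂ} {f0 f1 : ℂ → ℂ} (hf0 : DifferentiableOn ℂ f0 ℍₒ)
    (hf1 : DifferentiableOn ℂ f1 ℍₒ)
    (hT : ∀ z, 0 < z.im → nearly f0 f1 (z + 1) = nearly f0 f1 z)
    (hS : ∀ z, 0 < z.im → nearly f0 f1 (fricke z) = ε * (s3 * z) ^ w * nearly f0 f1 z) :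
    QuasiLaws w ε f0 f1 := by
  have h1 : ∀ z : ℂ, 0 < z.im → f0 (z + 1) = f0 z ∧ f1 (z + 1) = f1 z := fun z hz =>
    eq_of_nearly_eq (differentiableOn_add_one hf0) (differentiableOn_add_one hf1) hf0 hf1
      (fun z hz => by
        have := hT z hz
        rwa [nearly, map_add, map_one, add_sub_add_right_eq_sub] at this) hz
  have hz0 := differentiableOn_comp_fricke hf0
  have hz1 := differentiableOn_comp_fricke hf1
  have hzw := (differentiableOn_s3_mul_zpow w).const_mul ε
  have h2 : ∀ z : ℂ, 0 < z.im → f0 (fricke z) - 3 * z * f1 (fricke z) = ε * (s3 * z) ^ w * f0 z ∧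
      3 * z ^ 2 * f1 (fricke z) = ε * (s3 * z) ^ w * f1 z := fun z hz =>
    eq_of_nearly_eq (hz0.fun_sub ((differentiableOn_id.const_mul 3).fun_mul hz1))
      (((differentiableOn_pow 2).const_mul 3).fun_mul hz1) (hzw.fun_mul hf0) (hzw.fun_mul hf1)
      (fun z hz => by
        have h := hS z hz
        have h0 := ne_zero_of_im hz
        have h3 : (starRingEnd ℂ) z ≠ 0 := by simpa using h0
        have h4 := sub_conj_ne_zero hz
        rw [nearly, nearly, fricke_sub_conj hz] at h
        rw [nearly, nearly, id]
        field_simp at h ⊢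
        linear_combination h) hz
  refine ⟨hf0, hf1, fun z hz => (h1 z hz).1, fun z hz => (h1 z hz).2, fun z hz => ?_, fun z hz => ?_⟩
  · have h0 := ne_zero_of_im hz
    obtain ⟨ha, hb⟩ := h2 z hz
    field_simp
    linear_combination z * ha + hb
  · have h0 := ne_zero_of_im hz
    obtain ⟨ha, hb⟩ := h2 z hz
    rw [zpow_sub₀ (s3_mul_ne_zero hz), zpow_ofNat, mul_pow, sq s3, s3C_sq]
    field_simp
    linear_combination hb

/-- If `f0 + f1 / (z - z̄)` is bounded near `i∞`, then `f0` grows at most linearly. -/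
lemma norm_le_of_nearly_bounded {f0 f1 : ℂ → ℂ} (hf0 : DifferentiableOn ℂ f0 ℍₒ)
    (hf1 : DifferentiableOn ℂ f1 ℍₒ) {A C : ℝ} (hA : 0 ≤ A)
    (h : ∀ z : ℂ, A < z.im → ‖nearly f0 f1 z‖ ≤ C) {z : ℂ} (hz : A + 1 < z.im) :
    ‖f0 z‖ ≤ 2 * C * (z.im + 1) := by
  -- H is holomorphic in u and H(z) = -f0(z). On the circle |u - z| = 1 the conjugate of u is z̄ +
  -- 1/(u - z), so there H(u) is (u - z)(u - ū) times the bounded function. The maximum principle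
  -- carries the bound to the centre.
  set H : ℂ → ℂ := fun u => f0 u * ((u - (starRingEnd ℂ) z) * (u - z) - 1) + f1 u * (u - z) with hH
  have him : ∀ u ∈ Metric.closedBall z 1, |u.im - z.im| ≤ 1 := fun u hu => by
    rw [mem_closedBall_iff_norm] at hu
    rw [← sub_im]
    exact (abs_im_le_norm _).trans hu
  have hsub : Metric.closedBall z 1 ⊆ ℍₒ := fun u hu => by
    have := abs_le.1 (him u hu)
    change 0 < u.im
    linarith
  have hd : DifferentiableOn ℂ H ℍₒ :=
    (hf0.fun_mul (((differentiableOn_id.sub_const _).fun_mul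
      (differentiableOn_id.sub_const _)).sub_const 1)).fun_add
      (hf1.fun_mul (differentiableOn_id.sub_const _))
  have hc : DiffContOnCl ℂ H (Metric.ball z 1) :=
    DifferentiableOn.diffContOnCl (by
      rw [closure_ball z one_ne_zero]
      exact hd.mono hsub)
  have hz1 : f0 z = -H z := by simp [hH]
  rw [hz1, norm_neg]
  refine Complex.norm_le_of_forall_mem_frontier_norm_le Metric.isBounded_ball hc (fun u hu => ?_)
    (subset_closure (Metric.mem_ball_self one_pos))
  rw [frontier_ball z one_ne_zero] at hu
  have hu' := Metric.sphere_subset_closedBall hu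
  have hu0 : 0 < u.im := hsub hu'
  have hui := abs_le.1 (him u hu')
  rw [mem_sphere_iff_norm] at hu
  have hne : u - z ≠ 0 := by
    rw [← norm_ne_zero_iff, hu]; exact one_ne_zero
  have hconj : (starRingEnd ℂ) u - (starRingEnd ℂ) z = 1 / (u - z) := by
    rw [eq_div_iff hne, ← map_sub, mul_comm, Complex.mul_conj, Complex.normSq_eq_norm_sq, hu]
    norm_num
  have hHu : H u = nearly f0 f1 u * (u - (starRingEnd ℂ) u) * (u - z) := by
    have h4 := sub_conj_ne_zero hu0
    have h5 : (starRingEnd ℂ) z = (starRingEnd ℂ) u - 1 / (u - z) := by linear_combination -hconj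
    have h6 : (u - (starRingEnd ℂ) z) * (u - z) - 1 = (u - (starRingEnd ℂ) u) * (u - z) := by
      rw [h5]; field_simp; ring
    simp only [hH]
    rw [h6, nearly]
    field_simp
  have hC := h u (by linarith)
  rw [hHu, norm_mul, norm_mul, hu, mul_one, sub_conj]
  have h7 : ‖((2 * u.im : ℝ) : ℂ) * I‖ = 2 * u.im := by
    rw [norm_mul, norm_I, mul_one, norm_real, Real.norm_of_nonneg (by linarith)]
  have hC0 : 0 ≤ C := (norm_nonneg _).trans hC
  rw [h7]
  calc ‖nearly f0 f1 u‖ * (2 * u.im) ≤ C * (2 * (z.im + 1)) :=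
        mul_le_mul hC (by linarith) (by linarith) hC0
    _ = 2 * C * (z.im + 1) := by ring

lemma tendsto_mul_cuspParam_of_norm_le {f : ℂ → ℂ} {A C : ℝ}
    (h : ∀ z : ℂ, A < z.im → ‖f z‖ ≤ C * z.im ^ 2) :
    Tendsto (fun z => f z * cuspParam z) imTop (𝓝 0) := by
  rw [tendsto_zero_iff_norm_tendsto_zero]
  have h1 : Tendsto (fun z : ℂ => C * (z.im ^ 2 * Real.exp (-z.im))) imTop (𝓝 0) := by
    have := ((Real.tendsto_pow_mul_exp_neg_atTop_nhds_zero 2).comp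
      (tendsto_comap (f := Complex.im))).const_mul C
    rw [mul_zero] at this
    exact this
  refine squeeze_zero' (Eventually.of_forall fun _ => norm_nonneg _) ?_ h1
  filter_upwards [eventually_im_gt A, eventually_im_gt 0] with z hz hz0
  have h2 := h z hz
  have h3 : ‖cuspParam z‖ ≤ Real.exp (-z.im) := by
    rw [cuspParam_eq, Function.Periodic.norm_qParam, Real.exp_le_exp]
    have := Real.pi_gt_three
    rw [div_one]
    nlinarith
  rw [norm_mul, ← mul_assoc]
  exact mul_le_mul h2 h3 (norm_nonneg _) ((norm_nonneg _).trans h2)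

lemma nearlyHol_eq_nearly (c : Fin (1 + 1) → ℍ → ℂ) (z : ℍ) :
    nearlyHol c z = nearly (c 0 ∘ ofComplex) (c 1 ∘ ofComplex) z := by
  simp [nearlyHol, nearly]

lemma nearlyHol_eq_nearly' (c : Fin (1 + 1) → ℍ → ℂ) {z : ℂ} (hz : 0 < z.im) :
    nearly (c 0 ∘ ofComplex) (c 1 ∘ ofComplex) z = nearlyHol c (ofComplex z) := by
  rw [nearlyHol_eq_nearly, ofComplex_coe_eq hz]

lemma isCusp_infty : IsCusp ((((1 : SL(2, ℝ)) : GL (Fin 2) ℝ)) • OnePoint.infty)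
    (GammaPlus.map (Matrix.SpecialLinearGroup.toGL : SL(2, ℝ) →* GL (Fin 2) ℝ)) := by
  rw [map_one, one_smul]
  refine Subgroup.isCusp_of_mem_strictPeriods (h := 1) one_pos ?_
  rw [Subgroup.mem_strictPeriods_iff]
  refine ⟨_, (matR * matS⁻¹ : GammaPlus).2, ?_⟩
  obtain ⟨h1, h2, h3, h4⟩ := T_zpow_entries 1
  rw [zpow_one] at h1 h2 h3 h4
  rw [Int.cast_one] at h2
  ext i j
  fin_cases i <;> fin_cases j
  · exact h1
  · exact h2
  · exact h3
  · exact h4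

/-- A quasimodular form of depth at most one comes from a pair of functions with expansions at
`∞` and the expected transformation laws. -/
theorem exists_quasiLaws {w : ℤ} {k : ℕ} {f : ℍ → ℂ}
    (hf : f ∈ quasimodular GammaPlus (chi ^ k) w 1) :
    ∃ f1 φ1 : ℂ → ℂ, QuasiLaws w ((-I) ^ k) (f ∘ ofComplex) f1 ∧
      HasQ (f ∘ ofComplex) (cuspFunction 1 f) ∧ HasQ f1 φ1 := by
  obtain ⟨c, hc, hm, rfl⟩ := hf
  set f0 : ℂ → ℂ := c 0 ∘ ofComplex
  set f1 : ℂ → ℂ := c 1 ∘ ofComplex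
  have hd0 : DifferentiableOn ℂ f0 ℍₒ := differentiableOn_comp_ofComplex (hc 0)
  have hd1 : DifferentiableOn ℂ f1 ℍₒ := differentiableOn_comp_ofComplex (hc 1)
  have hS : ∀ z : ℂ, 0 < z.im →
      nearly f0 f1 (fricke z) = (-I) ^ k * (s3 * z) ^ w * nearly f0 f1 z := fun z hz => by
    have h := congrFun (hm.slash_eq matS) ⟨z, hz⟩
    have h0 := zpow_ne_zero w (s3_mul_ne_zero hz)
    rw [SL_slash, matS_entries.2.2.1, matS_entries.2.2.2, nearlyHol_eq_nearly, matS_smul_coe,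
      Pi.smul_apply, nearlyHol_eq_nearly, MonoidHom.pow_apply, chi_matS, smul_eq_mul] at h
    push_cast at h
    rw [mul_one, mul_zero, add_zero, zpow_neg] at h
    change nearly f0 f1 (fricke z) * ((s3 * z) ^ w)⁻¹ = (-I) ^ k * nearly f0 f1 z at h
    rw [← div_eq_mul_inv, div_eq_iff h0] at h
    rw [h]
    ring
  have hT : ∀ z : ℂ, 0 < z.im → nearly f0 f1 (z + 1) = nearly f0 f1 z := fun z hz => by
    have h := congrFun (hm.slash_eq (matR * matS⁻¹)) ⟨z, hz⟩
    obtain ⟨h1, h2, h3, h4⟩ := T_zpow_entries 1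
    rw [zpow_one] at h1 h2 h3 h4
    have hchi : chi (matR * matS⁻¹) = 1 := by
      have h5 : chi (matR * matS⁻¹) * chi matS = chi matR := by rw [← map_mul]; simp
      rw [chi_matS, chi_matR] at h5
      exact mul_right_cancel₀ (neg_ne_zero.2 I_ne_zero) (h5.trans (one_mul _).symm)
    rw [SL_slash, nearlyHol_eq_nearly, SL_smul_coe, h1, h2, h3, h4, Pi.smul_apply,
      nearlyHol_eq_nearly, MonoidHom.pow_apply, hchi] at h
    simpa using! h
  have hQ := quasiLaws_of_nearly hd0 hd1 hT hS
  obtain ⟨L, hL⟩ := hm.limit_at_cusp 1 isCusp_infty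
  rw [map_one, SlashAction.slash_one] at hL
  have hL' : Tendsto (nearly f0 f1) imTop (𝓝 L) := by
    refine (hL.comp tendsto_comap_im_ofComplex).congr' ?_
    filter_upwards [eventually_im_gt 0] with z hz
    exact (nearlyHol_eq_nearly' c hz).symm
  obtain ⟨A, hA⟩ := eventually_imTop_iff.1
    (hL'.norm.eventually (eventually_le_nhds (lt_add_one ‖L‖)))
  set C := ‖L‖ + 1
  have hC : 0 ≤ C := by positivity
  -- Only the sum f0 + f1/(z - z̄) is known to be bounded. This yields linear growth of f0, hence
  -- quadratic growth of f1, and both are beaten by the exponential decay of q.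
  have hb0 : ∀ z : ℂ, max A 0 + 1 < z.im → ‖f0 z‖ ≤ 2 * C * (z.im + 1) := fun z hz =>
    norm_le_of_nearly_bounded hd0 hd1 (le_max_right A 0)
      (fun u hu => hA u ((le_max_left A 0).trans_lt hu)) hz
  have hg0 : Tendsto (fun z => f0 z * cuspParam z) imTop (𝓝 0) :=
    tendsto_mul_cuspParam_of_norm_le (A := max A 0 + 1) (C := 4 * C) fun z hz => by
      have h1 : 1 < z.im := by have := le_max_right A 0; linarith
      have h2 := hb0 z hz
      have h3 : z.im + 1 ≤ 2 * z.im ^ 2 := by nlinarith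
      nlinarith
  have hg1 : Tendsto (fun z => f1 z * cuspParam z) imTop (𝓝 0) :=
    tendsto_mul_cuspParam_of_norm_le (A := max A 0 + 1) (C := 10 * C) fun z hz => by
      have h1 : 1 < z.im := by have := le_max_right A 0; linarith
      have h2 := hb0 z hz
      have h3 := hA z (by have := le_max_left A 0; linarith)
      have h4 : f1 z = (nearly f0 f1 z - f0 z) * (z - (starRingEnd ℂ) z) := by
        have := sub_conj_ne_zero (z := z) (by linarith)
        rw [nearly]
        field_simp
        ring
      have h5 : ‖z - (starRingEnd ℂ) z‖ = 2 * z.im := by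
        rw [sub_conj, norm_mul, norm_I, mul_one, norm_real, Real.norm_of_nonneg (by linarith)]
      have h6 : ‖nearly f0 f1 z - f0 z‖ ≤ C + 2 * C * (z.im + 1) :=
        (norm_sub_le _ _).trans (add_le_add h3 h2)
      have h7 : C + 2 * C * (z.im + 1) ≤ 5 * C * z.im := by nlinarith
      rw [h4, norm_mul, h5]
      calc ‖nearly f0 f1 z - f0 z‖ * (2 * z.im) ≤ 5 * C * z.im * (2 * z.im) :=
            mul_le_mul_of_nonneg_right (h6.trans h7) (by linarith)
        _ = 10 * C * z.im ^ 2 := by ring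
  have hper : Function.Periodic (c 0 ∘ ofComplex) 1 := fun z => by
    have := periodic_coe_comp hQ.per0 z
    simpa [f0] using this
  obtain ⟨φ1, hφ1⟩ := exists_hasQ' hd1 hQ.per1 hg1
  exact ⟨f1, φ1, hQ, exists_hasQ (hc 0) hper hg0, hφ1⟩

/-- The order of the `q`-expansion is the vanishing order at `∞`. -/
lemma exists_hasQ_div_of_order {f : ℍ → ℂ} {n : ℕ}
    (hf : HasQ (f ∘ ofComplex) (cuspFunction 1 f)) (hn : (qExpansion 1 f).order = n) :
    ∃ ψ, HasQ (fun z => (f ∘ ofComplex) z / cuspParam z ^ n) ψ ∧ ψ 0 ≠ 0 := by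
  obtain ⟨h1, h2⟩ := PowerSeries.order_eq_nat.1 hn
  have hcoeff : ∀ m, (qExpansion 1 f).coeff m = 0 ↔ iteratedDeriv m (cuspFunction 1 f) 0 = 0 :=
    fun m => by
      rw [qExpansion_coeff, mul_eq_zero, or_iff_right]
      exact inv_ne_zero (by exact_mod_cast m.factorial_ne_zero)
  have h3 : analyticOrderAt (cuspFunction 1 f) 0 = n :=
    (analyticOrderAt_eq_nat_iff_iteratedDeriv_eq_zero hf.analytic).2
      ⟨fun m hm => (hcoeff m).1 (h2 m hm), fun h => h1 ((hcoeff n).2 h)⟩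
  obtain ⟨ψ, hψ, hψ0, h4⟩ := (hf.analytic.analyticOrderAt_eq_natCast).1 h3
  refine ⟨ψ, ⟨hψ, ?_⟩, hψ0⟩
  filter_upwards [hf.eventually_eq, tendsto_cuspParam'.eventually h4] with z hz hz4
  rw [hz, hz4, sub_zero, smul_eq_mul, mul_div_cancel_left₀]
  exact pow_ne_zero _ (cuspParam_ne_zero z)

/-! ### A lower bound for the dimension -/

/-- The homogeneous polynomial `∑ᵢ cᵢ X^(n-1-i) Y^i` evaluated at `X = M₂³` and `Y = M₆`. -/
def homForm (n : ℕ) (c : Fin n → ℂ) (z : ℂ) : ℂ :=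
  ∑ i : Fin n, c i * (m1 z ^ (6 * (n - 1 - i)) * g6 z ^ (i : ℕ))

lemma neg_I_pow_six_mul (n : ℕ) : (-I) ^ (6 * n) = (-1) ^ n := by
  rw [pow_mul]
  congr 1
  linear_combination (I ^ 4 - I ^ 2 + 1) * I_sq

/-- The monomials have degree n - 1, hence weight 6(n - 1) and Fricke factor (-1)^(n-1). Writing the
hypotheses with n instead of n - 1 covers n = 0, where the sum is empty. -/
lemma isForm_mul_homForm {w v : ℤ} {ε δ : ℂ} {G : ℂ → ℂ} (hG : IsForm v δ G) {n : ℕ}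
    (hw : v + 6 * n = w + 6) (hε : δ * (-1) ^ n = -ε) (c : Fin n → ℂ) :
    IsForm w ε (fun z => G z * homForm n c z) := by
  have h : ∀ i ∈ (Finset.univ : Finset (Fin n)), IsForm w ε
      (fun z => c i * (G z * (m1 z ^ (6 * (n - 1 - i)) * g6 z ^ (i : ℕ)))) := fun i _ => by
    refine (((hG.mul ((isForm_m1.pow _).mul (isForm_g6.pow _))).congr ?_ ?_
      fun _ _ => rfl).const_mul (c i))
    · have hi : ((n - 1 - i : ℕ) : ℤ) = n - 1 - i := by have := i.2; omega
      push_cast [hi]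
      linear_combination hw
    · have hi : n - 1 - i + i + 1 = n := by have := i.2; omega
      rw [neg_I_pow_six_mul, ← pow_add]
      rw [← hi, pow_succ] at hε
      linear_combination -hε
  refine (IsForm.sum Finset.univ h).congr rfl rfl fun z _ => ?_
  rw [homForm, Finset.mul_sum]
  exact Finset.sum_congr rfl fun i _ => by ring

/-- Division by m1^(6(n-1)) leaves a polynomial in M₆/M₂³. This quotient tends to 0 at i∞ without
taking the value 0, and a nonzero polynomial has no roots in a small punctured disc. -/
lemma eq_zero_of_homForm_eq_zero {n : ℕ} {c : Fin n → ℂ}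
    (h : ∀ᶠ z in imTop, homForm n c z = 0) : c = 0 := by
  set X : ℂ → ℂ := fun z => g6 z / m1 z ^ 6
  set P : Polynomial ℂ := ∑ i : Fin n, Polynomial.C (c i) * Polynomial.X ^ (i : ℕ) with hP
  have hX : Tendsto X imTop (𝓝[≠] 0) := by
    refine tendsto_nhdsWithin_iff.2 ⟨by simpa [Pi.div_def] using tendsto_g6.div (tendsto_m1.pow 6) (by simp), ?_⟩
    filter_upwards [eventually_im_gt 0, tendsto_m1.eventually_ne one_ne_zero] with z hz h1
    exact div_ne_zero (g6_ne_zero hz) (pow_ne_zero 6 h1)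
  have hroot : ∀ᶠ z in imTop, P.eval (X z) = 0 := by
    filter_upwards [h, tendsto_m1.eventually_ne one_ne_zero] with z hz h1
    have h2 : homForm n c z = m1 z ^ (6 * (n - 1)) * P.eval (X z) := by
      rw [hP, Polynomial.eval_finsetSum, Finset.mul_sum, homForm]
      refine Finset.sum_congr rfl fun i _ => ?_
      have hi : n - 1 = (n - 1 - i) + i := by have := i.2; omega
      have h3 : m1 z ^ (6 * (n - 1)) = m1 z ^ (6 * (n - 1 - i)) * (m1 z ^ 6) ^ (i : ℕ) := by
        rw [← pow_mul, ← pow_add]; congr 1; omega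
      simp only [Polynomial.eval_mul, Polynomial.eval_C, Polynomial.eval_pow, Polynomial.eval_X, X]
      rw [h3, div_pow]
      field_simp
    rw [h2] at hz
    exact (mul_eq_zero.1 hz).resolve_left (pow_ne_zero _ h1)
  have hP0 : P = 0 := by
    by_contra hne
    have h1 : ∀ᶠ x in 𝓝[≠] (0 : ℂ), P.eval x ≠ 0 := by
      refine nhdsNE_le_cofinite 0 ?_
      rw [mem_cofinite]
      refine (Polynomial.finite_setOfPred_isRoot hne).subset fun x hx => ?_
      simpa using hx
    obtain ⟨z, hz1, hz2⟩ := ((hX.eventually h1).and hroot).exists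
    exact hz1 hz2
  ext i
  have h2 := congrArg (Polynomial.coeff · (i : ℕ)) hP0
  simp only [hP, Polynomial.finsetSum_coeff, Polynomial.coeff_C_mul, Polynomial.coeff_X_pow,
    Polynomial.coeff_zero] at h2
  rw [Finset.sum_eq_single i (fun j _ hj => by
    rw [if_neg (fun h => hj (Fin.ext h.symm)), mul_zero]) (by simp)] at h2
  simpa using h2

/-- A form of weight `w` and one of weight `w - 2` combine to a quasimodular pair. -/
lemma quasiPair_of_forms {w : ℤ} {ε : ℂ} {F G : ℂ → ℂ} (hF : IsForm w ε F)
    (hG : IsForm (w - 2) ε G) :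
    QuasiPair w ε (fun z => F z + etaLog z * G z) (fun z => 3 * G z) := by
  have hG3 := hG.const_mul 3
  obtain ⟨L, hL⟩ := hF.lim
  obtain ⟨L', hL'⟩ := hG.lim
  refine ⟨⟨hF.diff.fun_add (differentiableOn_etaLog.fun_mul hG.diff), hG3.diff,
    fun z hz => by rw [hF.per z hz, hG.per z hz, etaLog_add_one hz], hG3.per, fun z hz => ?_,
    hG3.fricke⟩, ⟨_, hL.add (tendsto_etaLog.mul hL')⟩, hG3.lim⟩
  have h0 := ne_zero_of_im hz
  rw [hF.fricke z hz, hG.fricke z hz, etaLog_fricke hz, zpow_sub₀ (s3_mul_ne_zero hz), zpow_ofNat,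
    mul_pow s3 z, sq s3, s3C_sq]
  field_simp
  ring

/-- Applied to a vanishing first component, the involution leaves only the non-modular term 3G/z. -/
lemma eq_zero_of_forms {w : ℤ} {ε : ℂ} (hε : ε ≠ 0) {F G : ℂ → ℂ} (hF : IsForm w ε F)
    (hG : IsForm (w - 2) ε G) (h : ∀ z, 0 < z.im → F z + etaLog z * G z = 0) {z : ℂ}
    (hz : 0 < z.im) : F z = 0 ∧ G z = 0 := by
  have h1 := (quasiPair_of_forms hF hG).fricke0 z hz
  simp only [h _ (fricke_im hz), h z hz] at h1
  have hG0 : G z = 0 := by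
    have h2 := mul_ne_zero hε (zpow_ne_zero w (s3_mul_ne_zero hz))
    have h3 := (mul_eq_zero.1 h1.symm).resolve_left h2
    have h4 := ne_zero_of_im hz
    rw [zero_add, div_eq_zero_iff] at h3
    simpa [h4] using h3
  exact ⟨by simpa [hG0] using h z hz, hG0⟩

/-- The space of quasimodular forms contains the forms built from `homForm`. -/
theorem le_finrank_of_forms {w v v' : ℤ} {k n n' : ℕ} {δ δ' : ℂ} {G G' : ℂ → ℂ}
    [Module.Finite ℂ (quasimodular GammaPlus (chi ^ k) w 1)]
    (hG : IsForm v δ G) (hG' : IsForm v' δ' G')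
    (hw : v + 6 * n = w + 6) (hw' : v' + 6 * n' = w + 4)
    (hε : δ * (-1) ^ n = -(-I) ^ k) (hε' : δ' * (-1) ^ n' = -(-I) ^ k)
    (h0 : ∀ᶠ z in imTop, G z ≠ 0) (h0' : ∀ᶠ z in imTop, G' z ≠ 0) :
    n + n' ≤ Module.finrank ℂ (quasimodular GammaPlus (chi ^ k) w 1) := by
  have hF := fun c : Fin n → ℂ => isForm_mul_homForm hG hw hε c
  have hF' := fun c : Fin n' → ℂ => isForm_mul_homForm (w := w - 2) hG' (by linarith) hε' c
  have hadd : ∀ (m : ℕ) (c d : Fin m → ℂ) (z : ℂ),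
      homForm m (c + d) z = homForm m c z + homForm m d z := fun m c d z => by
    simp [homForm, add_mul, Finset.sum_add_distrib]
  have hsmul : ∀ (m : ℕ) (a : ℂ) (c : Fin m → ℂ) (z : ℂ),
      homForm m (a • c) z = a * homForm m c z := fun m a c z => by
    simp [homForm, Finset.mul_sum, mul_assoc]
  let Φ : ((Fin n → ℂ) × (Fin n' → ℂ)) →ₗ[ℂ] quasimodular GammaPlus (chi ^ k) w 1 :=
    { toFun := fun c => ⟨fun z : ℍ => G z * homForm n c.1 z + etaLog z * (G' z * homForm n' c.2 z),
        (quasiPair_of_forms (hF c.1) (hF' c.2)).mem_quasimodular⟩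
      map_add' := fun c d => by
        ext z
        simp only [Prod.fst_add, Prod.snd_add, hadd, Submodule.coe_add, Pi.add_apply]
        ring
      map_smul' := fun a c => by
        ext z
        simp only [Prod.smul_fst, Prod.smul_snd, hsmul, Submodule.coe_smul, Pi.smul_apply,
          smul_eq_mul, RingHom.id_apply]
        ring }
  have hinj : Function.Injective Φ := by
    rw [← LinearMap.ker_eq_bot, LinearMap.ker_eq_bot']
    intro c hc
    have h1 : ∀ z : ℂ, 0 < z.im →
        G z * homForm n c.1 z + etaLog z * (G' z * homForm n' c.2 z) = 0 := fun z hz =>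
      congrFun (congrArg Subtype.val hc) ⟨z, hz⟩
    have h2 := fun z hz => eq_zero_of_forms (z := z) (pow_ne_zero k (neg_ne_zero.2 I_ne_zero))
      (hF c.1) (hF' c.2) h1 hz
    refine Prod.ext (eq_zero_of_homForm_eq_zero ?_) (eq_zero_of_homForm_eq_zero ?_)
    · filter_upwards [h0, eventually_im_gt 0] with z hz hz0
      exact (mul_eq_zero.1 (h2 z hz0).1).resolve_left hz
    · filter_upwards [h0', eventually_im_gt 0] with z hz hz0
      exact (mul_eq_zero.1 (h2 z hz0).2).resolve_left hz
  have := LinearMap.finrank_le_finrank_of_injective hinj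
  simpa using this

lemma eventually_m1_ne_zero : ∀ᶠ z in imTop, m1 z ≠ 0 := tendsto_m1.eventually_ne one_ne_zero

lemma eventually_m3_ne_zero : ∀ᶠ z in imTop, m3 z ≠ 0 := by
  refine tendsto_m3.eventually_ne ?_
  simp [Real.pi_ne_zero]

lemma neg_I_pow_two_mul (m : ℕ) : (-I) ^ (2 * m) = (-1) ^ m := by
  rw [pow_mul]
  congr 1
  linear_combination I_sq

/-- For k = 2m there are m + 1 forms of weight 6m and m of weight 6m - 2 with prefactor m3 m1. For k
= 2m + 1 there are m + 1 of weight 6m + 3 with prefactor m3, and m + 1 of weight 6m + 1 with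
prefactor m1. The prefactors are chosen to match both the weight modulo 6 and the Fricke factor. -/
lemma add_one_le_finrank (k : ℕ) [Module.Finite ℂ (quasimodular GammaPlus (chi ^ k) (3 * k) 1)] :
    k + 1 ≤ Module.finrank ℂ (quasimodular GammaPlus (chi ^ k) (3 * k) 1) := by
  obtain ⟨m, rfl | rfl⟩ := k.even_or_odd'
  · refine le_trans (by omega) (le_finrank_of_forms (n := m + 1) (n' := m) (IsForm.const 1)
      (isForm_m3.mul isForm_m1) (by push_cast; ring) (by push_cast; ring) ?_ ?_
      (by simp) (by filter_upwards [eventually_m1_ne_zero, eventually_m3_ne_zero] with z h1 h3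
                    exact mul_ne_zero h3 h1))
    · rw [neg_I_pow_two_mul]; ring
    · rw [neg_I_pow_two_mul]; linear_combination (-1) ^ m * I_sq
  · refine le_trans (by omega) (le_finrank_of_forms (n := m + 1) (n' := m + 1) isForm_m3
      isForm_m1 (by push_cast; ring) (by push_cast; ring) ?_ ?_
      eventually_m3_ne_zero eventually_m1_ne_zero)
    · rw [pow_succ (-I), neg_I_pow_two_mul]; ring
    · rw [pow_succ (-I), neg_I_pow_two_mul]; ring

/-- For k = 2m the prefactor in weight 6m + 2 cannot be M₂, whose Fricke factor has the wrong sign;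
it is m3 m1⁵, of weight 8, and this leaves m forms there, besides m + 1 of weight 6m. For k = 2m + 1
there are m + 1 forms in each of the weights 6m + 5 and 6m + 3. -/
lemma add_one_le_finrank' (k : ℕ)
    [Module.Finite ℂ (quasimodular GammaPlus (chi ^ k) (3 * k + 2) 1)] :
    k + 1 ≤ Module.finrank ℂ (quasimodular GammaPlus (chi ^ k) (3 * k + 2) 1) := by
  have h5 : ∀ᶠ z in imTop, m1 z ^ 5 ≠ 0 := eventually_m1_ne_zero.mono fun z h => pow_ne_zero 5 h
  obtain ⟨m, rfl | rfl⟩ := k.even_or_odd'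
  · refine le_trans (by omega) (le_finrank_of_forms (n := m) (n' := m + 1)
      (isForm_m3.mul (isForm_m1.pow 5)) (IsForm.const 1) (by push_cast; ring) (by push_cast; ring)
      ?_ ?_ (by filter_upwards [h5, eventually_m3_ne_zero] with z h1 h3
                exact mul_ne_zero h3 h1) (by simp))
    · rw [neg_I_pow_two_mul]; linear_combination (-1) ^ m * (I ^ 4 - I ^ 2 + 1) * I_sq
    · rw [neg_I_pow_two_mul]; ring
  · refine le_trans (by omega) (le_finrank_of_forms (n := m + 1) (n' := m + 1) (isForm_m1.pow 5)
      isForm_m3 (by push_cast; ring) (by push_cast; ring) ?_ ?_ h5 eventually_m3_ne_zero)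
    · rw [pow_succ (-I) (2 * m), neg_I_pow_two_mul]
      linear_combination (-1) ^ m * (I ^ 3 - I) * I_sq
    · rw [pow_succ (-I), neg_I_pow_two_mul]; ring

/-- The data carried by an extremal form of depth one: the second component and the expansions at
`∞`. -/
theorem IsExtremal.exists_quasiLaws {w : ℤ} {k : ℕ} {f : ℍ → ℂ}
    (hf : IsExtremal (chi ^ k) w 1 f)
    (hdim : ∀ [Module.Finite ℂ (quasimodular GammaPlus (chi ^ k) w 1)],
      k + 1 ≤ Module.finrank ℂ (quasimodular GammaPlus (chi ^ k) w 1)) :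
    ∃ (f1 φ1 ψ : ℂ → ℂ) (n : ℕ), k ≤ n ∧ QuasiLaws w ((-I) ^ k) (f ∘ ofComplex) f1 ∧
      HasQ f1 φ1 ∧ HasQ (fun z => (f ∘ ofComplex) z / cuspParam z ^ n) ψ ∧ ψ 0 ≠ 0 := by
  obtain ⟨hmem, hord⟩ := hf
  obtain ⟨f1, φ1, hQ, h0, h1⟩ := QuasiThree.exists_quasiLaws hmem
  -- Infinite order is excluded because the dimension is a natural number.
  obtain ⟨n, hn⟩ : ∃ n : ℕ, (qExpansion 1 f).order = n := by
    refine ENat.ne_top_iff_exists.1 (fun h => ?_) |>.imp fun n h => h.symm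
    rw [h, top_add] at hord
    exact ENat.natCast_ne_top _ hord.symm
  rw [hn] at hord
  have hord' : n + 1 = Module.finrank ℂ (quasimodular GammaPlus (chi ^ k) w 1) := by
    exact_mod_cast hord
  -- `finrank` is 0 on an infinite-dimensional space, so its positivity gives finiteness.
  have := Module.finite_of_finrank_pos (hord' ▸ Nat.succ_pos n :
    0 < Module.finrank ℂ (quasimodular GammaPlus (chi ^ k) w 1))
  obtain ⟨ψ, hψ, hψ0⟩ := exists_hasQ_div_of_order h0 hn
  have := hdim
  exact ⟨f1, φ1, ψ, n, by omega, hQ, h1, hψ, hψ0⟩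

/-! ### Wronskians -/

/-- The Wronskian of `v` and `u`. -/
def wronsk (v u : ℂ → ℂ) (z : ℂ) : ℂ := u z * deriv v z - deriv u z * v z

/-- The Wronskian of the derivatives of `v` and `u`. -/
def wronsk' (v u : ℂ → ℂ) (z : ℂ) : ℂ :=
  deriv (deriv u) z * deriv v z - deriv u z * deriv (deriv v) z

/-- Holomorphic functions `v`, `u` whose span is stable under `z ↦ z + 1`. -/
structure ShiftPair (κ : ℂ) (v u : ℂ → ℂ) : Prop where
  diff : DifferentiableOn ℂ v ℍₒ
  diff' : DifferentiableOn ℂ u ℍₒ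
  shift : ∀ z, 0 < z.im → v (z + 1) = κ * v z
  shift' : ∀ z, 0 < z.im → u (z + 1) = κ * (u z + v z)
  sq : κ ^ 2 = 1

namespace ShiftPair

variable {κ : ℂ} {v u : ℂ → ℂ}

lemma hasDerivAt_wronsk (h : ShiftPair κ v u) {z : ℂ} (hz : 0 < z.im) : HasDerivAt (wronsk v u)
    (u z * deriv (deriv v) z - deriv (deriv u) z * v z) z := by
  refine (((hasDerivAt_of_H h.diff' hz).fun_mul
    (hasDerivAt_of_H (differentiableOn_deriv h.diff) hz)).fun_sub
    ((hasDerivAt_of_H (differentiableOn_deriv h.diff') hz).fun_mul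
      (hasDerivAt_of_H h.diff hz))).congr_deriv ?_
  ring

lemma differentiableOn_wronsk (h : ShiftPair κ v u) : DifferentiableOn ℂ (wronsk v u) ℍₒ :=
  fun _ hz => (h.hasDerivAt_wronsk hz).differentiableAt.differentiableWithinAt

lemma differentiableOn_wronsk' (h : ShiftPair κ v u) : DifferentiableOn ℂ (wronsk' v u) ℍₒ := by
  have h1 := differentiableOn_deriv h.diff
  have h2 := differentiableOn_deriv h.diff'
  exact ((differentiableOn_deriv h2).fun_mul h1).fun_sub (h2.fun_mul (differentiableOn_deriv h1))

/-- The differential equation satisfied by `v`. -/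
lemma wronsk_mul_deriv_deriv (h : ShiftPair κ v u) {z : ℂ} (hz : 0 < z.im) :
    wronsk v u z * deriv (deriv v) z =
      deriv (wronsk v u) z * deriv v z + wronsk' v u z * v z := by
  rw [(h.hasDerivAt_wronsk hz).deriv, wronsk, wronsk']
  ring

/-- The differential equation satisfied by `u`. -/
lemma wronsk_mul_deriv_deriv' (h : ShiftPair κ v u) {z : ℂ} (hz : 0 < z.im) :
    wronsk v u z * deriv (deriv u) z =
      deriv (wronsk v u) z * deriv u z + wronsk' v u z * u z := by
  rw [(h.hasDerivAt_wronsk hz).deriv, wronsk, wronsk']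
  ring

lemma deriv_add_one_of_eq {f g : ℂ → ℂ} (h : ∀ z, 0 < z.im → f (z + 1) = g z) {z : ℂ} (hz : 0 < z.im) :
    deriv f (z + 1) = deriv g z := by
  rw [← deriv_comp_add_const]
  refine Filter.EventuallyEq.deriv_eq ?_
  filter_upwards [eventually_mem_H hz] with w hw using h w hw

lemma deriv_shift (h : ShiftPair κ v u) {z : ℂ} (hz : 0 < z.im) :
    deriv v (z + 1) = κ * deriv v z := by
  rw [deriv_add_one_of_eq h.shift hz,
    ((hasDerivAt_of_H h.diff hz).const_mul κ).deriv]

lemma deriv_shift' (h : ShiftPair κ v u) {z : ℂ} (hz : 0 < z.im) :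
    deriv u (z + 1) = κ * (deriv u z + deriv v z) := by
  rw [deriv_add_one_of_eq h.shift' hz,
    (((hasDerivAt_of_H h.diff' hz).fun_add (hasDerivAt_of_H h.diff hz)).const_mul κ).deriv]

/-- The derivatives again form a shift pair. -/
lemma derivPair (h : ShiftPair κ v u) : ShiftPair κ (deriv v) (deriv u) :=
  ⟨differentiableOn_deriv h.diff, differentiableOn_deriv h.diff', fun _ hz => h.deriv_shift hz,
    fun _ hz => h.deriv_shift' hz, h.sq⟩

lemma wronsk_add_one (h : ShiftPair κ v u) {z : ℂ} (hz : 0 < z.im) :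
    wronsk v u (z + 1) = wronsk v u z := by
  rw [wronsk, wronsk, h.shift z hz, h.shift' z hz, h.deriv_shift hz, h.deriv_shift' hz]
  linear_combination (u z * deriv v z - deriv u z * v z) * h.sq

lemma wronsk'_add_one (h : ShiftPair κ v u) {z : ℂ} (hz : 0 < z.im) :
    wronsk' v u (z + 1) = wronsk' v u z := by
  rw [wronsk', wronsk', h.deriv_shift hz, h.deriv_shift' hz, h.derivPair.deriv_shift hz,
    h.derivPair.deriv_shift' hz]
  linear_combination
    (deriv (deriv u) z * deriv v z - deriv u z * deriv (deriv v) z) * h.sq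

/-- The Wronskian does not vanish identically. -/
lemma wronsk_ne_zero (h : ShiftPair κ v u) (hv : ∀ᶠ z in imTop, v z ≠ 0)
    (hw : ∀ z, 0 < z.im → wronsk v u z = 0) : False := by
  obtain ⟨A, hA⟩ := eventually_imTop_iff.1 hv
  set S : Set ℂ := {z | max A 0 < z.im} with hS
  have hpos : ∀ z ∈ S, 0 < z.im := fun z hz => (le_max_right A 0).trans_lt hz
  have hvS : ∀ z ∈ S, v z ≠ 0 := fun z hz => hA z ((le_max_left A 0).trans_lt hz)
  -- A vanishing Wronskian makes u/v constant on a half plane, while z ↦ z + 1 adds 1 to it.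
  have hd : ∀ z ∈ S, HasDerivAt (fun z => u z / v z) 0 z := fun z hz => by
    refine ((hasDerivAt_of_H h.diff' (hpos z hz)).fun_div (hasDerivAt_of_H h.diff (hpos z hz))
      (hvS z hz)).congr_deriv ?_
    have := hw z (hpos z hz)
    rw [wronsk] at this
    rw [div_eq_zero_iff]
    left
    linear_combination -this
  have hconv : Convex ℝ S := convex_halfSpace_im_gt _
  have hc : ∀ x ∈ S, ∀ y ∈ S, u x / v x = u y / v y := fun x hx y hy => by
    have := hconv.norm_image_sub_le_of_norm_hasDerivWithin_le (C := 0)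
      (fun z hz => (hd z hz).hasDerivWithinAt) (by simp) hy hx
    rw [zero_mul, norm_le_zero_iff] at this
    exact sub_eq_zero.1 this
  have hx : (((max A 0 + 1 : ℝ) : ℂ) * I) ∈ S := by
    have h1 := le_max_left A 0
    have h2 := le_max_right A 0
    simp only [hS, Set.mem_ofPred_eq, mul_I_im, ofReal_re]
    linarith
  set x : ℂ := ((max A 0 + 1 : ℝ) : ℂ) * I
  have hx1 : x + 1 ∈ S := by
    have hx' : max A 0 < x.im := hx
    simpa [hS] using hx'
  have h1 := hc _ hx1 _ hx
  have hκ : κ ≠ 0 := by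
    rintro rfl
    simpa using h.sq
  have hv0 := hvS x hx
  rw [h.shift x (hpos x hx), h.shift' x (hpos x hx)] at h1
  field_simp at h1
  simp [hv0] at h1

end ShiftPair

/-! ### The pair attached to an extremal form -/

variable {k n : ℕ} {w : ℤ} {f0 f1 : ℂ → ℂ}

lemma neg_one_pow_mul_I_pow (k : ℕ) : (-1 : ℂ) ^ k * I ^ k = (-I) ^ k := by
  rw [← mul_pow, neg_one_mul]

/-- Translation adds f0 to z f0 + f1, and the antiperiodic `etaRoot` contributes the sign (-1)^k. -/
lemma QuasiLaws.shiftPair (h : QuasiLaws w ((-I) ^ k) f0 f1) :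
    ShiftPair ((-1) ^ k) (fun z => f0 z / etaRoot z ^ k)
      (fun z => (z * f0 z + f1 z) / etaRoot z ^ k) := by
  have hd := differentiableOn_etaRoot.fun_pow k
  have hne : ∀ z ∈ ℍₒ, etaRoot z ^ k ≠ 0 := fun z hz => pow_ne_zero k (etaRoot_ne_zero hz)
  have hsq : ((-1 : ℂ) ^ k) ^ 2 = 1 := by rw [← pow_mul, mul_comm, pow_mul]; norm_num
  have hinv : ∀ x y : ℂ, x / ((-1) ^ k * y) = (-1) ^ k * (x / y) := fun x y => by
    have h1 : ((-1 : ℂ) ^ k)⁻¹ = (-1) ^ k := inv_eq_of_mul_eq_one_left (by rw [← sq, hsq])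
    rw [div_mul_eq_div_div_swap, div_eq_mul_inv (x / y), h1, mul_comm]
  refine ⟨h.diff0.fun_div hd hne, ((differentiableOn_id.fun_mul h.diff0).fun_add h.diff1).fun_div hd
    hne, fun z hz => ?_, fun z hz => ?_, hsq⟩
  · rw [h.per0 z hz, etaRoot_add_one, neg_pow, hinv]
  · rw [h.per0 z hz, h.per1 z hz, etaRoot_add_one, neg_pow, hinv]
    ring

lemma etaRoot_pow_fricke {z : ℂ} (hz : 0 < z.im) :
    etaRoot (fricke z) ^ k = I ^ k * (s3 * z) ^ (3 * (k : ℤ)) * etaRoot z ^ k := by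
  rw [etaRoot_fricke hz, mul_pow, mul_pow, ← pow_mul]
  norm_cast

/-- Division by `etaRoot ^ k` lowers the weight by 3k and turns the multiplier (-I)^k into a sign.
-/
lemma div_etaRoot_pow_fricke {a b : ℂ} {z : ℂ} (hz : 0 < z.im) {j : ℤ}
    (h : a = (-I) ^ k * (s3 * z) ^ (3 * k + j) * b) :
    a / etaRoot (fricke z) ^ k = (-1) ^ k * (s3 * z) ^ j * (b / etaRoot z ^ k) := by
  have h1 := zpow_ne_zero (3 * (k : ℤ)) (s3_mul_ne_zero hz)
  have h2 := pow_ne_zero k (etaRoot_ne_zero hz)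
  have h3 : I ^ k ≠ 0 := pow_ne_zero k I_ne_zero
  rw [etaRoot_pow_fricke hz, h, ← neg_one_pow_mul_I_pow, zpow_add₀ (s3_mul_ne_zero hz)]
  field_simp

/-! ### Behaviour of the pair and of its Wronskian at i∞ -/

section Asymptotics

variable {φ1 ψ : ℂ → ℂ}

lemma eventually_ne_zero_of_hasQ_div (hψ : HasQ (fun z => f0 z / cuspParam z ^ n) ψ)
    (hψ0 : ψ 0 ≠ 0) : ∀ᶠ z in imTop, f0 z ≠ 0 :=
  (hψ.tendsto.eventually_ne hψ0).mono fun z hz h => hz (by simp [h])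

lemma logDeriv_cuspParam (z : ℂ) : logDeriv cuspParam z = 2 * Real.pi * I := by
  rw [logDeriv_apply, (hasDerivAt_cuspParam z).deriv, mul_div_cancel_right₀ _ (cuspParam_ne_zero z)]

/-- The leading exponent of f0 / etaRoot^k in q is n - k/2, and the limit is 2πi times it. -/
lemma hasQ_logDeriv_div (hd : DifferentiableOn ℂ f0 ℍₒ)
    (hψ : HasQ (fun z => f0 z / cuspParam z ^ n) ψ) (hψ0 : ψ 0 ≠ 0) :
    ∃ χ, HasQ (logDeriv (fun z => f0 z / etaRoot z ^ k)) χ ∧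
      χ 0 = Real.pi * I * (2 * n - k) := by
  obtain ⟨θ, hθ, hθ0⟩ := hasQ_etaLog
  refine ⟨_, (((hψ.deriv.div hψ hψ0).add (HasQ.const (2 * Real.pi * I * n))).sub
    (hθ.const_mul k)).congr ?_, by simp [hθ0]; ring⟩
  filter_upwards [eventually_im_gt 0, eventually_ne_zero_of_hasQ_div hψ hψ0] with z hz h0
  have hq := cuspParam_ne_zero z
  have he := etaRoot_ne_zero hz
  have hdf := differentiableAt_of_H hd hz
  have hdq := (hasDerivAt_cuspParam z).differentiableAt
  have hde := differentiableAt_of_H differentiableOn_etaRoot hz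
  rw [logDeriv_div (g := fun z => etaRoot z ^ k) z h0 (pow_ne_zero k he) hdf (hde.fun_pow k), logDeriv_fun_pow hde]
  have h1 : deriv (fun z => f0 z / cuspParam z ^ n) z / (f0 z / cuspParam z ^ n) =
      logDeriv f0 z - n * (2 * Real.pi * I) := by
    rw [← logDeriv_apply, logDeriv_div (g := fun z => cuspParam z ^ n) z h0 (pow_ne_zero n hq) hdf (hdq.fun_pow n),
      logDeriv_fun_pow hdq, logDeriv_cuspParam]
  rw [h1, etaLog, logDeriv_apply etaRoot]
  ring

/-- Limits of the logarithmic derivatives of a function with an expansion of its logarithmic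
derivative. -/
lemma tendsto_deriv_deriv_div {v : ℂ → ℂ} {χ : ℂ → ℂ} (hd : DifferentiableOn ℂ v ℍₒ)
    (h0 : ∀ᶠ z in imTop, v z ≠ 0) (h : HasQ (logDeriv v) χ) :
    Tendsto (fun z => deriv (deriv v) z / v z) imTop (𝓝 (χ 0 ^ 2)) := by
  have h1 : Tendsto (fun z => deriv (logDeriv v) z + logDeriv v z ^ 2) imTop (𝓝 (0 + χ 0 ^ 2)) :=
    h.tendsto_deriv.add (h.tendsto.pow 2)
  rw [zero_add] at h1
  refine h1.congr' ?_
  filter_upwards [eventually_im_gt 0, h0] with z hz hv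
  have h2 := (hasDerivAt_of_H (differentiableOn_deriv hd) hz).fun_div (hasDerivAt_of_H hd hz) hv
  rw [show logDeriv v = fun z => deriv v z / v z from rfl, h2.deriv]
  field_simp
  ring

lemma wronsk_div_etaRoot (h0 : DifferentiableOn ℂ f0 ℍₒ) (h1 : DifferentiableOn ℂ f1 ℍₒ) {z : ℂ}
    (hz : 0 < z.im) : wronsk (fun z => f0 z / etaRoot z ^ k)
      (fun z => (z * f0 z + f1 z) / etaRoot z ^ k) z =
      (f1 z * deriv f0 z - f0 z ^ 2 - deriv f1 z * f0 z) / g6 z ^ k := by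
  have he := pow_ne_zero k (etaRoot_ne_zero hz)
  have hde := (differentiableAt_of_H (differentiableOn_etaRoot.fun_pow k) hz).hasDerivAt
  have hd0 := hasDerivAt_of_H h0 hz
  have hd1 := hasDerivAt_of_H h1 hz
  rw [wronsk, (hd0.fun_div hde he).deriv,
    ((((hasDerivAt_id' z).fun_mul hd0).fun_add hd1).fun_div hde he).deriv,
    show g6 z ^ k = (etaRoot z ^ k) ^ 2 by rw [g6, ← pow_mul, ← pow_mul, mul_comm]]
  field_simp
  ring

/-- Each term of f1 f0' - f0² - f1' f0 contains f0 or f0', hence a factor qⁿ, and M₆^k has exact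
order k. -/
lemma tendsto_wronsk_div_etaRoot (h0 : DifferentiableOn ℂ f0 ℍₒ) (h1 : DifferentiableOn ℂ f1 ℍₒ)
    (hφ : HasQ f1 φ1) (hψ : HasQ (fun z => f0 z / cuspParam z ^ n) ψ) (hkn : k ≤ n) :
    ∃ L, Tendsto (wronsk (fun z => f0 z / etaRoot z ^ k)
      (fun z => (z * f0 z + f1 z) / etaRoot z ^ k)) imTop (𝓝 L) ∧ (k < n → L = 0) := by
  obtain ⟨m, rfl⟩ := Nat.exists_eq_add_of_le hkn
  set r : ℂ → ℂ := fun z => f0 z / cuspParam z ^ (k + m)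
  have hq := tendsto_cuspParam'
  have hlim := (((((hφ.tendsto.mul (hψ.tendsto_deriv.add (hψ.tendsto.const_mul
    (2 * Real.pi * I * (k + m : ℕ))))).sub ((hψ.tendsto.pow 2).mul (hq.pow (k + m)))).sub
    (hφ.tendsto_deriv.mul hψ.tendsto)).mul (hq.pow m)).div (tendsto_g6_div.pow k) (by simp))
  refine ⟨_, hlim.congr' ?_, fun hm => ?_⟩
  · filter_upwards [eventually_im_gt 0] with z hz
    have hqz := cuspParam_ne_zero z
    have hqn := pow_ne_zero (k + m) hqz
    have hg := g6_ne_zero hz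
    have hd := (hasDerivAt_of_H h0 hz).fun_div ((hasDerivAt_cuspParam z).fun_pow (k + m)) hqn
    have hd' : deriv r z + 2 * Real.pi * I * (k + m : ℕ) * r z =
        deriv f0 z / cuspParam z ^ (k + m) := by
      rw [hd.deriv]
      simp only [r]
      rcases Nat.eq_zero_or_pos (k + m) with h | h
      · rw [h]; simp
      · obtain ⟨j, hj⟩ := Nat.exists_eq_add_of_lt h
        rw [hj]
        simp only [zero_add, Nat.add_sub_cancel]
        field_simp
        ring
    rw [wronsk_div_etaRoot h0 h1 hz]
    change (f1 z * (deriv r z + _ * r z) - _ - _) * _ / (g6 z / cuspParam z) ^ k = _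
    rw [hd']
    simp only [r]
    rw [div_pow, div_pow, pow_add]
    field_simp
  · have : m ≠ 0 := by omega
    simp [this]

end Asymptotics

namespace ShiftPair

variable {κ L : ℂ} {v u χ : ℂ → ℂ}

/-! ### The case of weight `3k` -/

section FirstCase

lemma deriv_fricke_one (h : ShiftPair κ v u) (hv : ∀ z, 0 < z.im → v (fricke z) = κ * (u z / z))
    {z : ℂ} (hz : 0 < z.im) : deriv v (fricke z) = 3 * κ * (z * deriv u z - u z) := by
  have h0 := ne_zero_of_im hz
  rw [deriv_fricke h.diff hv hz (((hasDerivAt_of_H h.diff' hz).fun_div (hasDerivAt_id' z)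
    h0).const_mul κ)]
  field_simp

lemma deriv_fricke_one' (h : ShiftPair κ v u)
    (hu : ∀ z, 0 < z.im → u (fricke z) = -κ * (v z / (3 * z))) {z : ℂ} (hz : 0 < z.im) :
    deriv u (fricke z) = -κ * (z * deriv v z - v z) := by
  have h0 := ne_zero_of_im hz
  rw [deriv_fricke h.diff' hu hz (((hasDerivAt_of_H h.diff hz).fun_div
    ((hasDerivAt_id' z).const_mul 3) (by simpa using h0)).const_mul (-κ))]
  field_simp

/-- Bol's identity: the second derivative takes weight -1 to weight 3 without lower-order terms. -/
lemma deriv_deriv_fricke_one (h : ShiftPair κ v u)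
    (hv : ∀ z, 0 < z.im → v (fricke z) = κ * (u z / z)) {z : ℂ} (hz : 0 < z.im) :
    deriv (deriv v) (fricke z) = 9 * κ * z ^ 3 * deriv (deriv u) z := by
  rw [deriv_fricke h.derivPair.diff (fun z hz => h.deriv_fricke_one hv hz) hz
    ((((hasDerivAt_id' z).fun_mul (hasDerivAt_of_H h.derivPair.diff' hz)).fun_sub
      (hasDerivAt_of_H h.diff' hz)).const_mul (3 * κ))]
  ring

lemma deriv_deriv_fricke_one' (h : ShiftPair κ v u)
    (hu : ∀ z, 0 < z.im → u (fricke z) = -κ * (v z / (3 * z))) {z : ℂ} (hz : 0 < z.im) :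
    deriv (deriv u) (fricke z) = -3 * κ * z ^ 3 * deriv (deriv v) z := by
  rw [deriv_fricke h.derivPair.diff' (fun z hz => h.deriv_fricke_one' hu hz) hz
    ((((hasDerivAt_id' z).fun_mul (hasDerivAt_of_H h.derivPair.diff hz)).fun_sub
      (hasDerivAt_of_H h.diff hz)).const_mul (-κ))]
  ring

/-- The differential equation in weight `3k`. -/
theorem ode_one (h : ShiftPair κ v u) (hv : ∀ z, 0 < z.im → v (fricke z) = κ * (u z / z))
    (hu : ∀ z, 0 < z.im → u (fricke z) = -κ * (v z / (3 * z))) (hne : ∀ᶠ z in imTop, v z ≠ 0)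
    (hχ : HasQ (logDeriv v) χ) (hL : Tendsto (wronsk v u) imTop (𝓝 L)) :
    L ≠ 0 ∧ ∀ z, 0 < z.im → deriv (deriv v) z = χ 0 ^ 2 * m4 z * v z := by
  -- The weights -1 and -1 and the 2 from the derivative add up to 0.
  have hW : ∀ z, 0 < z.im → wronsk v u z = L :=
    eq_const_of_invariant h.differentiableOn_wronsk (fun z hz => h.wronsk_add_one hz)
      (fun z hz => by
        have h0 := ne_zero_of_im hz
        rw [wronsk, wronsk, hv z hz, hu z hz, h.deriv_fricke_one hv hz, h.deriv_fricke_one' hu hz]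
        field_simp
        linear_combination z * (u z * deriv v z - deriv u z * v z) * h.sq) hL
  have hL0 : L ≠ 0 := by
    rintro rfl
    exact h.wronsk_ne_zero hne hW
  have hW' : ∀ z, 0 < z.im → deriv (wronsk v u) z = 0 := fun z hz => by
    rw [Filter.EventuallyEq.deriv_eq (f := fun _ => L), deriv_const]
    filter_upwards [eventually_mem_H hz] with x hx using hW x hx
  have hode : ∀ z, 0 < z.im → L * deriv (deriv v) z = wronsk' v u z * v z := fun z hz => by
    have := h.wronsk_mul_deriv_deriv hz
    rw [hW z hz, hW' z hz] at this
    linear_combination this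
  have hlim : Tendsto (wronsk' v u) imTop (𝓝 (L * χ 0 ^ 2)) := by
    refine ((tendsto_deriv_deriv_div h.diff hne hχ).const_mul L).congr' ?_
    filter_upwards [eventually_im_gt 0, hne] with z hz hz0
    rw [← mul_div_assoc, hode z hz, mul_div_cancel_right₀ _ hz0]
  have hform : IsForm 4 1 (wronsk' v u) := by
    refine ⟨h.differentiableOn_wronsk', fun z hz => h.wronsk'_add_one hz, fun z hz => ?_, _, hlim⟩
    -- W' = 0 cancels the extra terms that v' and u' acquire under the involution.
    have h1 := hW' z hz
    rw [(h.hasDerivAt_wronsk hz).deriv] at h1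
    have hs : (s3 * z) ^ (4 : ℤ) = 9 * z ^ 4 := by
      rw [zpow_ofNat]
      linear_combination (z ^ 4 * (s3 * s3 + 3)) * s3C_sq
    rw [wronsk', wronsk', h.deriv_fricke_one hv hz, h.deriv_fricke_one' hu hz,
      h.deriv_deriv_fricke_one hv hz, h.deriv_deriv_fricke_one' hu hz, hs]
    linear_combination 9 * κ ^ 2 * z ^ 3 * h1 + 9 * z ^ 4 * (deriv (deriv u) z * deriv v z -
      deriv u z * deriv (deriv v) z) * h.sq
  refine ⟨hL0, fun z hz => ?_⟩
  have h1 := hode z hz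
  rw [hform.eq_mul_m2_sq hlim hz] at h1
  rw [m4_eq hz]
  refine mul_left_cancel₀ hL0 ?_
  linear_combination h1

end FirstCase

/-! ### The case of weight `3k + 2` -/

section SecondCase

lemma deriv_fricke_two (h : ShiftPair κ v u) (hv : ∀ z, 0 < z.im → v (fricke z) = 3 * κ * (z * u z))
    {z : ℂ} (hz : 0 < z.im) :
    deriv v (fricke z) = 9 * κ * (z ^ 2 * u z + z ^ 3 * deriv u z) := by
  rw [deriv_fricke h.diff hv hz (((hasDerivAt_id' z).fun_mul
    (hasDerivAt_of_H h.diff' hz)).const_mul (3 * κ))]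
  ring

lemma deriv_fricke_two' (h : ShiftPair κ v u) (hu : ∀ z, 0 < z.im → u (fricke z) = -κ * (z * v z))
    {z : ℂ} (hz : 0 < z.im) :
    deriv u (fricke z) = -3 * κ * (z ^ 2 * v z + z ^ 3 * deriv v z) := by
  rw [deriv_fricke h.diff' hu hz (((hasDerivAt_id' z).fun_mul
    (hasDerivAt_of_H h.diff hz)).const_mul (-κ))]
  ring

lemma hasDerivAt_sq_add_cube {g : ℂ → ℂ} (hg : DifferentiableOn ℂ g ℍₒ) {z : ℂ} (hz : 0 < z.im) :
    HasDerivAt (fun z => z ^ 2 * g z + z ^ 3 * deriv g z)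
      (2 * z * g z + 4 * z ^ 2 * deriv g z + z ^ 3 * deriv (deriv g) z) z := by
  refine (((hasDerivAt_pow 2 z).fun_mul (hasDerivAt_of_H hg hz)).fun_add
    ((hasDerivAt_pow 3 z).fun_mul (hasDerivAt_of_H (differentiableOn_deriv hg) hz))).congr_deriv ?_
  norm_num
  ring

lemma deriv_deriv_fricke_two (h : ShiftPair κ v u)
    (hv : ∀ z, 0 < z.im → v (fricke z) = 3 * κ * (z * u z)) {z : ℂ} (hz : 0 < z.im) :
    deriv (deriv v) (fricke z) =
      27 * κ * (2 * z ^ 3 * u z + 4 * z ^ 4 * deriv u z + z ^ 5 * deriv (deriv u) z) := by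
  rw [deriv_fricke h.derivPair.diff (fun z hz => h.deriv_fricke_two hv hz) hz
    ((hasDerivAt_sq_add_cube h.diff' hz).const_mul (9 * κ))]
  ring

lemma deriv_deriv_fricke_two' (h : ShiftPair κ v u)
    (hu : ∀ z, 0 < z.im → u (fricke z) = -κ * (z * v z)) {z : ℂ} (hz : 0 < z.im) :
    deriv (deriv u) (fricke z) =
      -9 * κ * (2 * z ^ 3 * v z + 4 * z ^ 4 * deriv v z + z ^ 5 * deriv (deriv v) z) := by
  rw [deriv_fricke h.derivPair.diff' (fun z hz => h.deriv_fricke_two' hu hz) hz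
    ((hasDerivAt_sq_add_cube h.diff hz).const_mul (-3 * κ))]
  ring

lemma s3_mul_zpow_four (z : ℂ) : (s3 * z) ^ (4 : ℤ) = 9 * z ^ 4 := by
  rw [zpow_ofNat]
  linear_combination (z ^ 4 * (s3 * s3 + 3)) * s3C_sq

lemma s3_mul_zpow_eight (z : ℂ) : (s3 * z) ^ (8 : ℤ) = 81 * z ^ 8 := by
  have := s3_mul_zpow_four z
  rw [zpow_ofNat] at this ⊢
  linear_combination ((s3 * z) ^ 4 + 9 * z ^ 4) * this

/-- In weight `3k + 2` the Wronskian is a multiple of `M₂²`. -/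
lemma wronsk_eq_two (h : ShiftPair κ v u) (hv : ∀ z, 0 < z.im → v (fricke z) = 3 * κ * (z * u z))
    (hu : ∀ z, 0 < z.im → u (fricke z) = -κ * (z * v z))
    (hL : Tendsto (wronsk v u) imTop (𝓝 L)) {z : ℂ} (hz : 0 < z.im) :
    wronsk v u z = L * m1 z ^ 4 := by
  have hform : IsForm 4 1 (wronsk v u) := by
    refine ⟨h.differentiableOn_wronsk, fun z hz => h.wronsk_add_one hz, fun z hz => ?_, L, hL⟩
    rw [s3_mul_zpow_four, wronsk, wronsk, hv z hz, hu z hz, h.deriv_fricke_two hv hz,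
      h.deriv_fricke_two' hu hz]
    linear_combination 9 * z ^ 4 * (u z * deriv v z - deriv u z * v z) * h.sq
  rw [hform.eq_mul_m2_sq hL hz, ← m1_sq hz]
  ring

lemma deriv_wronsk_two (hW : ∀ z : ℂ, 0 < z.im → wronsk v u z = L * m1 z ^ 4) {z : ℂ}
    (hz : 0 < z.im) : deriv (wronsk v u) z = L * (4 * m1 z ^ 3 * deriv m1 z) := by
  rw [Filter.EventuallyEq.deriv_eq (f := fun z => L * m1 z ^ 4),
    (((hasDerivAt_of_H differentiableOn_m1 hz).fun_pow 4).const_mul L).deriv]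
  · norm_num
  · filter_upwards [eventually_mem_H hz] with x hx using hW x hx

/-- A form of weight `8` is a combination of `M₂⁴` and `M₂ M₆`. -/
lemma _root_.QuasiThree.IsForm.eq_of_weight_eight {X : ℂ → ℂ} {α : ℂ} (hX : IsForm 8 1 X)
    (hα : Tendsto X imTop (𝓝 α)) :
    ∃ β, ∀ z, 0 < z.im → X z = α * m1 z ^ 8 + β * (m1 z ^ 2 * g6 z) := by
  have h8 : IsForm 8 1 (fun z => m1 z ^ 8) := (isForm_m1.pow 8).congr (by norm_num)
    (by rw [neg_pow]; linear_combination (I ^ 6 - I ^ 4 + I ^ 2 - 1) * I_sq) fun _ _ => rfl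
  have h2 : IsForm 8 1 (fun z => m1 z ^ 2 * g6 z) :=
    ((isForm_m1.pow 2).mul isForm_g6).congr (by norm_num) (by linear_combination -I_sq)
      fun _ _ => rfl
  have hY := hX.sub (h8.const_mul α)
  have hY0 : Tendsto (fun z => X z - α * m1 z ^ 8) imTop (𝓝 0) := by
    simpa using hα.sub ((tendsto_m1.pow 8).const_mul α)
  obtain ⟨β, hβ⟩ := hY.tendsto_div_param hY0
  have hZ := hY.sub (h2.const_mul β)
  have hZq : Tendsto (fun z => (X z - α * m1 z ^ 8 - β * (m1 z ^ 2 * g6 z)) / cuspParam z) imTop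
      (𝓝 0) := by
    have := hβ.sub (((tendsto_m1.pow 2).mul tendsto_g6_div).const_mul β)
    simp only [one_pow, mul_one, sub_self] at this
    exact this.congr fun z => by ring
  have hZ0 : Tendsto (fun z => X z - α * m1 z ^ 8 - β * (m1 z ^ 2 * g6 z)) imTop (𝓝 0) := by
    have := hZq.mul tendsto_cuspParam'
    rw [mul_zero] at this
    exact this.congr fun z => div_mul_cancel₀ _ (cuspParam_ne_zero z)
  obtain ⟨φ, hφ, hφ0⟩ := hZ.hasQ hZ0
  obtain ⟨ψ, hψ, -⟩ := hφ.exists_eq_param_mul hφ0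
  obtain ⟨θ, hθ, -⟩ := hψ.exists_eq_param_mul (tendsto_nhds_unique hψ.tendsto hZq)
  -- The remainder vanishes to order 2, so its cube, of weight 24 = 6 · 4, vanishes to order 6 > 4.
  have hlim : Tendsto (fun z => (X z - α * m1 z ^ 8 - β * (m1 z ^ 2 * g6 z)) ^ 3 / cuspParam z ^ 4)
      imTop (𝓝 0) := by
    have := (hθ.tendsto.pow 3).mul (tendsto_cuspParam'.pow 2)
    simp only [ne_eq, OfNat.ofNat_ne_zero, not_false_eq_true, zero_pow, mul_zero] at this
    refine this.congr fun z => ?_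
    have := cuspParam_ne_zero z
    field_simp
  have hfin := (hZ.pow 3).eq_mul_g6_pow (m := 4) (by norm_num) (by norm_num) hlim
  refine ⟨β, fun z hz => ?_⟩
  have h3 := hfin z hz
  rw [zero_mul] at h3
  linear_combination eq_zero_of_pow_eq_zero h3

/-- The second coefficient of the differential equation in weight `3k + 2`. -/
lemma wronsk'_eq_two (h : ShiftPair κ v u) (hv : ∀ z, 0 < z.im → v (fricke z) = 3 * κ * (z * u z))
    (hu : ∀ z, 0 < z.im → u (fricke z) = -κ * (z * v z)) (hne : ∀ᶠ z in imTop, v z ≠ 0)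
    (hχ : HasQ (logDeriv v) χ) (hL : Tendsto (wronsk v u) imTop (𝓝 L)) (hL0 : L ≠ 0) :
    ∃ β, ∀ z, 0 < z.im → wronsk' v u z = L * (χ 0 ^ 2 * m1 z ^ 8 + β * (m1 z ^ 2 * g6 z) -
      m1 z ^ 3 * deriv (deriv m1) z) := by
  have hW := fun (z : ℂ) (hz : 0 < z.im) => h.wronsk_eq_two hv hu hL hz
  have hW' := fun (z : ℂ) (hz : 0 < z.im) => deriv_wronsk_two hW hz
  have hdm := differentiableOn_deriv differentiableOn_m1
  obtain ⟨μ, hμ, -⟩ := hasQ_m1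
  have hlim : Tendsto (fun z => wronsk' v u z / L + m1 z ^ 3 * deriv (deriv m1) z) imTop
      (𝓝 (χ 0 ^ 2)) := by
    have h1 := ((((tendsto_m1.pow 4).mul (tendsto_deriv_deriv_div h.diff hne hχ)).sub
      ((((tendsto_m1.pow 3).mul hμ.tendsto_deriv).mul hχ.tendsto).const_mul 4)).add
      ((tendsto_m1.pow 3).mul hμ.deriv.tendsto_deriv))
    simp only [one_pow, one_mul, mul_zero, zero_mul, sub_zero, add_zero] at h1
    refine h1.congr' ?_
    filter_upwards [eventually_im_gt 0, hne] with z hz hz0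
    have h2 := h.wronsk_mul_deriv_deriv hz
    rw [hW z hz, hW' z hz] at h2
    rw [logDeriv_apply]
    field_simp
    linear_combination h2
  -- Under the involution `wronsk'` acquires multiples of W and W'. By W = L m1⁴ these are expressed
  -- through m1 and m1', and the term m1³ m1'' cancels them.
  have hform : IsForm 8 1 (fun z => wronsk' v u z / L + m1 z ^ 3 * deriv (deriv m1) z) := by
    refine ⟨(h.differentiableOn_wronsk'.div_const L).fun_add ((differentiableOn_m1.fun_pow 3).fun_mul
      (differentiableOn_deriv hdm)), fun z hz => ?_, fun z hz => ?_, _, hlim⟩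
    · rw [h.wronsk'_add_one hz, isForm_m1.per z hz,
        deriv_add_one' (fun z hz => deriv_add_one' isForm_m1.per hz) hz]
    · have h1 := hW z hz
      have h2 := hW' z hz
      rw [(h.hasDerivAt_wronsk hz).deriv] at h2
      rw [wronsk] at h1
      have h4 : (-I * s3) ^ 4 = 9 := by
        linear_combination (s3 ^ 4 * (I ^ 2 - 1)) * I_sq + (s3 * s3 + 3) * s3C_sq
      rw [s3_mul_zpow_eight, wronsk', wronsk', h.deriv_fricke_two hv hz, h.deriv_fricke_two' hu hz,
        h.deriv_deriv_fricke_two hv hz, h.deriv_deriv_fricke_two' hu hz, m1_fricke hz,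
        deriv_deriv_m1_fricke hz, ← sub_eq_zero]
      field_simp
      linear_combination 81 * (z ^ 8 * (deriv (deriv u) z * deriv v z - deriv u z *
          deriv (deriv v) z) - 2 * z ^ 6 * (u z * deriv v z - deriv u z * v z) -
          z ^ 7 * (u z * deriv (deriv v) z - deriv (deriv u) z * v z)) * h.sq -
        162 * z ^ 6 * h1 - 81 * z ^ 7 * h2 + L * z ^ 3 * m1 z ^ 3 * (18 * z ^ 3 * m1 z +
          36 * z ^ 4 * deriv m1 z + 9 * z ^ 5 * deriv (deriv m1) z) * h4
  obtain ⟨β, hβ⟩ := hform.eq_of_weight_eight hlim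
  refine ⟨β, fun z hz => ?_⟩
  have h1 := hβ z hz
  field_simp at h1 ⊢
  linear_combination h1

end SecondCase

end ShiftPair

/-! ### The local argument at the elliptic point -/

/-- ζ = 3 ellPt² satisfies ζ² = ζ - 1, so it is a primitive sixth root of unity. Its inverse is the
derivative of the rotation `matR` at its fixed point. -/
lemma le_of_three_mul_ellPt_sq_pow {m : ℕ} (hm : m ≠ 0) (h : (3 * ellPt ^ 2) ^ m = 1) : 6 ≤ m := by
  set ζ := 3 * ellPt ^ 2 with hζ
  have h0 := three_mul_ellPt_sq
  have h2 : ζ ^ 2 = ζ - 1 := by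
    rw [hζ]
    linear_combination (3 * ellPt ^ 2 + 3 * ellPt - 1) * h0 + 2 * h0
  have h3 : ζ ^ 3 = -1 := by linear_combination (ζ + 1) * h2
  by_contra hlt
  interval_cases m
  · exact hm rfl
  · rw [pow_one] at h
    rw [h] at h3
    norm_num at h3
  · have : ζ = 2 := by linear_combination h - h2
    rw [this] at h3
    norm_num at h3
  · rw [h] at h3
    norm_num at h3
  · have : ζ = -1 := by linear_combination -h + ζ * h3
    rw [this] at h2
    norm_num at h2
  · have : ζ = 0 := by linear_combination -h + ζ ^ 2 * h3 - h2
    rw [this] at h2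
    norm_num at h2

/-- At `ellPt` the bracket identity reduces to 2 m1'² = 24π² M₆, which is not 0. -/
lemma deriv_m1_ellPt : deriv m1 ellPt ≠ 0 := by
  intro h
  have h1 := m1_bracket ellPt_im
  rw [h, m1_ellPt] at h1
  have h2 := g6_ne_zero ellPt_im
  simp [h2, Real.pi_ne_zero] at h1

lemma eventually_m1_ne_zero_nhds {z : ℂ} (hz : 0 < z.im) : ∀ᶠ w in 𝓝[≠] z, m1 w ≠ 0 := by
  obtain ⟨z₁, hz₁, h1⟩ := exists_im_pos_of_imTop eventually_m1_ne_zero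
  exact eventually_ne_zero_of_H differentiableOn_m1 hz₁ h1 hz

lemma fricke_add_one_sub_ellPt {z : ℂ} (hz : 0 < z.im) :
    fricke z + 1 - ellPt = (z - ellPt) / (3 * z * ellPt) := by
  have h0 := ne_zero_of_im hz
  have h1 := ne_zero_of_im ellPt_im
  have h2 : fricke z + 1 - ellPt = fricke z - fricke ellPt := by
    linear_combination fricke_ellPt
  rw [h2, fricke, fricke]
  field_simp
  ring

/-- A function with the transformation law of an eigenvector of the rotation about the elliptic
point vanishes there to order at least `6`, if it vanishes at all. -/
lemma six_le_order {r g : ℂ → ℂ} {m : ℕ}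
    (hr : ∀ z, 0 < z.im → r (fricke z + 1) = z / ellPt * r z) (h0 : r ellPt = 0)
    (hg : ContinuousAt g ellPt) (hg0 : g ellPt ≠ 0)
    (hrg : ∀ᶠ z in 𝓝 ellPt, r z = (z - ellPt) ^ m * g z) : 6 ≤ m := by
  have hz0 := ne_zero_of_im ellPt_im
  have hm : m ≠ 0 := by
    rintro rfl
    have := hrg.self_of_nhds
    rw [h0] at this
    simp only [pow_zero, one_mul] at this
    exact hg0 this.symm
  refine le_of_three_mul_ellPt_sq_pow hm ?_
  have hR : Tendsto (fun z => fricke z + 1) (𝓝 ellPt) (𝓝 ellPt) := by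
    have := (hasDerivAt_fricke hz0).continuousAt.tendsto.add_const 1
    rwa [fricke_ellPt] at this
  -- Writing p for `ellPt`, the rotation sends z - p to (z - p)/(3zp). Cancelling (z - p)^m in the
  -- law of r and letting z → p gives (3p²)^m = 1.
  have h1 : ∀ᶠ z in 𝓝[≠] ellPt, ellPt * g (fricke z + 1) = z * g z * (3 * z * ellPt) ^ m := by
    filter_upwards [self_mem_nhdsWithin, (hrg.and (eventually_mem_H ellPt_im)).filter_mono
      nhdsWithin_le_nhds, (hR.eventually hrg).filter_mono nhdsWithin_le_nhds] with z hz ⟨h2, him⟩ h3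
    have hz' := ne_zero_of_im him
    rw [hr z him, fricke_add_one_sub_ellPt him, h2, div_pow] at h3
    have hne : (z - ellPt) ^ m ≠ 0 := pow_ne_zero m (sub_ne_zero.2 hz)
    have h3zm : (3 * z * ellPt) ^ m ≠ 0 := pow_ne_zero m (by simp [hz', hz0])
    refine mul_left_cancel₀ hne ?_
    rw [div_mul_eq_mul_div, div_mul_eq_mul_div, div_eq_div_iff hz0 h3zm] at h3
    linear_combination -h3
  have hlim1 : Tendsto (fun z => ellPt * g (fricke z + 1)) (𝓝[≠] ellPt) (𝓝 (ellPt * g ellPt)) :=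
    ((hg.tendsto.comp hR).const_mul ellPt).mono_left nhdsWithin_le_nhds
  have hlim2 : Tendsto (fun z => z * g z * (3 * z * ellPt) ^ m) (𝓝[≠] ellPt)
      (𝓝 (ellPt * g ellPt * (3 * ellPt * ellPt) ^ m)) :=
    (((tendsto_id.mul hg.tendsto).mul (((tendsto_id.const_mul 3).mul_const ellPt).pow m))).mono_left
      nhdsWithin_le_nhds
  have h2 := tendsto_nhds_unique (hlim1.congr' h1) hlim2
  have h3 : ellPt * g ellPt ≠ 0 := mul_ne_zero hz0 hg0
  refine mul_left_cancel₀ h3 ?_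
  rw [mul_one, sq, ← mul_assoc, ← h2]

namespace ShiftPair

variable {κ L α β : ℂ} {v u χ : ℂ → ℂ}

/-- Some element of the span of `v` and `u` does not vanish at the elliptic point. -/
lemma apply_ellPt_ne_zero (h : ShiftPair κ v u)
    (hv : ∀ z, 0 < z.im → v (fricke z) = 3 * κ * (z * u z))
    (hu : ∀ z, 0 < z.im → u (fricke z) = -κ * (z * v z)) (hL0 : L ≠ 0)
    (hW : ∀ z, 0 < z.im → wronsk v u z = L * m1 z ^ 4) : u ellPt - ellPt * v ellPt ≠ 0 := by
  intro h0
  have hz0 := ne_zero_of_im ellPt_im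
  -- r is an eigenvector of the rotation about `ellPt`. If it vanished there, it would do so to
  -- order at least 6, and W, which is also the Wronskian of v and r, to order at least 5. But m1⁴
  -- vanishes to order exactly 4.
  set r : ℂ → ℂ := fun z => u z - ellPt * v z with hr
  have hrd : DifferentiableOn ℂ r ℍₒ := h.diff'.fun_sub (h.diff.const_mul ellPt)
  have hra : AnalyticAt ℂ r ellPt := hrd.analyticAt (isOpen_H.mem_nhds ellPt_im)
  have hva : AnalyticAt ℂ v ellPt := h.diff.analyticAt (isOpen_H.mem_nhds ellPt_im)
  have hrR : ∀ z, 0 < z.im → r (fricke z + 1) = z / ellPt * r z := fun z hz => by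
    simp only [hr]
    rw [h.shift _ (fricke_im hz), h.shift' _ (fricke_im hz), hv z hz, hu z hz]
    field_simp
    linear_combination z * (-ellPt * v z + 3 * ellPt * u z - 3 * ellPt ^ 2 * u z) * h.sq -
      z * u z * three_mul_ellPt_sq
  have hrW : ∀ z, 0 < z.im → r z * deriv v z - deriv r z * v z = L * m1 z ^ 4 := fun z hz => by
    rw [← hW z hz, wronsk, ((hasDerivAt_of_H h.diff' hz).fun_sub
      ((hasDerivAt_of_H h.diff hz).const_mul ellPt)).deriv]
    simp only [hr]
    ring
  have hne : analyticOrderAt r ellPt ≠ ⊤ := by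
    intro htop
    have h1 := eventually_eventually_nhds.2 (analyticOrderAt_eq_top.1 htop)
    have h2 : ∀ᶠ z in 𝓝[≠] ellPt, False := by
      filter_upwards [eventually_m1_ne_zero_nhds ellPt_im,
        (h1.and (eventually_mem_H ellPt_im)).filter_mono nhdsWithin_le_nhds] with z hz ⟨h2, him⟩
      have h3 := hrW z him
      have h4 : deriv r z = 0 := by
        rw [Filter.EventuallyEq.deriv_eq (f := fun _ => 0) h2, deriv_const]
      rw [h2.self_of_nhds, h4] at h3
      simp [hL0, hz] at h3
    exact h2.exists.elim fun _ h => h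
  obtain ⟨g, hg, hg0, hrg⟩ := hra.analyticOrderAt_ne_top.1 hne
  set m := analyticOrderNatAt r ellPt
  simp only [smul_eq_mul] at hrg
  obtain ⟨j, hj⟩ := Nat.exists_eq_add_of_le (six_le_order hrR h0 hg.continuousAt hg0 hrg)
  set b : ℂ → ℂ := fun z => (z - ellPt) ^ j * g z with hb
  have hba : AnalyticAt ℂ b ellPt := ((analyticAt_id.sub analyticAt_const).fun_pow j).fun_mul hg
  have hrb : ∀ᶠ z in 𝓝 ellPt, r z = (z - ellPt) ^ 6 * b z := by
    filter_upwards [hrg] with z hz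
    rw [hz, hj, hb]
    ring
  have hkey : ∀ᶠ z in 𝓝[≠] ellPt, L * dslope m1 ellPt z ^ 4 = (z - ellPt) *
      ((z - ellPt) * b z * deriv v z - (6 * b z + (z - ellPt) * deriv b z) * v z) := by
    filter_upwards [self_mem_nhdsWithin, ((eventually_eventually_nhds.2 hrb).and
      ((eventually_mem_H ellPt_im).and hba.eventually_analyticAt)).filter_mono
      nhdsWithin_le_nhds] with z hz ⟨h1, him, hbz⟩
    have h2 := hrW z him
    have h3 : deriv r z = 6 * (z - ellPt) ^ 5 * b z + (z - ellPt) ^ 6 * deriv b z := by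
      rw [Filter.EventuallyEq.deriv_eq h1]
      simpa using ((((hasDerivAt_id' z).sub_const ellPt).fun_pow 6).fun_mul
        hbz.differentiableAt.hasDerivAt).deriv
    have h4 : m1 z = (z - ellPt) * dslope m1 ellPt z := by
      have := sub_smul_dslope m1 ellPt z
      rw [m1_ellPt, sub_zero, smul_eq_mul] at this
      exact this.symm
    rw [h1.self_of_nhds, h3, h4] at h2
    refine mul_left_cancel₀ (pow_ne_zero 4 (sub_ne_zero.2 hz)) ?_
    linear_combination -h2
  have hds : Tendsto (dslope m1 ellPt) (𝓝 ellPt) (𝓝 (deriv m1 ellPt)) := by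
    have := (continuousAt_dslope_same.2 (differentiableAt_of_H differentiableOn_m1 ellPt_im)).tendsto
    rwa [dslope_same] at this
  have hlim1 := ((hds.pow 4).const_mul L).mono_left (nhdsWithin_le_nhds (s := {ellPt}ᶜ))
  have hsub : Tendsto (fun z : ℂ => z - ellPt) (𝓝 ellPt) (𝓝 0) := by
    have := (tendsto_id (x := 𝓝 ellPt)).sub_const ellPt
    rwa [sub_self] at this
  have hbt := hba.continuousAt.tendsto
  have hlim2 := (hsub.mul ((((hsub.mul hbt).mul hva.deriv.continuousAt.tendsto)).sub
    (((hbt.const_mul 6).add (hsub.mul hba.deriv.continuousAt.tendsto)).mul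
      hva.continuousAt.tendsto))).mono_left (nhdsWithin_le_nhds (s := {ellPt}ᶜ))
  have hfin := tendsto_nhds_unique (hlim1.congr' hkey) hlim2
  rw [zero_mul] at hfin
  exact (mul_ne_zero hL0 (pow_ne_zero 4 deriv_m1_ellPt)) hfin

/-- The differential equation divided by the square of `M₂`. -/
lemma ode_reduced (hL0 : L ≠ 0) {g : ℂ → ℂ} (hg : DifferentiableOn ℂ g ℍₒ)
    (h : ∀ z, 0 < z.im → L * m1 z ^ 4 * deriv (deriv g) z = L * (4 * m1 z ^ 3 * deriv m1 z) *
      deriv g z + L * (α * m1 z ^ 8 + β * (m1 z ^ 2 * g6 z) - m1 z ^ 3 * deriv (deriv m1) z) * g z)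
    {z : ℂ} (hz : 0 < z.im) : m1 z ^ 2 * deriv (deriv g) z = 4 * m1 z * deriv m1 z * deriv g z +
      (α * m1 z ^ 6 + β * g6 z - m1 z * deriv (deriv m1) z) * g z := by
  set D : ℂ → ℂ := fun z => m1 z ^ 2 * deriv (deriv g) z - (4 * m1 z * deriv m1 z * deriv g z +
      (α * m1 z ^ 6 + β * g6 z - m1 z * deriv (deriv m1) z) * g z) with hD
  have hm := differentiableOn_m1
  have hm1 := differentiableOn_deriv hm
  have hm2 := differentiableOn_deriv hm1
  have hg1 := differentiableOn_deriv hg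
  have hg2 := differentiableOn_deriv hg1
  have hdD : DifferentiableOn ℂ D ℍₒ := ((hm.fun_pow 2).fun_mul hg2).fun_sub
    ((((hm.const_mul 4).fun_mul hm1).fun_mul hg1).fun_add
      (((((hm.fun_pow 6).const_mul α).fun_add (isForm_g6.diff.const_mul β)).fun_sub
        (hm.fun_mul hm2)).fun_mul hg))
  have hmul : ∀ z, 0 < z.im → m1 z ^ 2 * D z = 0 := fun z hz => by
    refine mul_left_cancel₀ hL0 ?_
    simp only [hD]
    linear_combination h z hz
  -- The zeros of m1 are isolated, so the cancelled equation extends across them by continuity.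
  have h0 : D z = 0 := by
    by_contra hne
    have h1 := (((differentiableAt_of_H hdD hz).continuousAt.eventually_ne hne).and
      (eventually_mem_H hz)).filter_mono (nhdsWithin_le_nhds (s := {z}ᶜ))
    obtain ⟨x, ⟨hx1, hx2⟩, hx3⟩ := (h1.and (eventually_m1_ne_zero_nhds hz)).exists
    exact (mul_ne_zero (pow_ne_zero 2 hx3) hx1) (hmul x hx2)
  exact sub_eq_zero.1 h0

/-- The differential equation in weight `3k + 2`. -/
theorem ode_two (h : ShiftPair κ v u) (hv : ∀ z, 0 < z.im → v (fricke z) = 3 * κ * (z * u z))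
    (hu : ∀ z, 0 < z.im → u (fricke z) = -κ * (z * v z)) (hne : ∀ᶠ z in imTop, v z ≠ 0)
    (hχ : HasQ (logDeriv v) χ) (hL : Tendsto (wronsk v u) imTop (𝓝 L)) :
    L ≠ 0 ∧ ∀ z, 0 < z.im → m1 z ^ 2 * deriv (deriv v) z = 4 * m1 z * deriv m1 z * deriv v z +
      (χ 0 ^ 2 * m1 z ^ 6 - m1 z * deriv (deriv m1) z) * v z := by
  have hW : ∀ z, 0 < z.im → wronsk v u z = L * m1 z ^ 4 := fun z hz => h.wronsk_eq_two hv hu hL hz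
  have hL0 : L ≠ 0 := by
    rintro rfl
    exact h.wronsk_ne_zero hne fun z hz => by rw [hW z hz, zero_mul]
  obtain ⟨β, hN⟩ := h.wronsk'_eq_two hv hu hne hχ hL hL0
  have h1 := fun (z : ℂ) (hz : 0 < z.im) => ode_reduced hL0 h.diff (α := χ 0 ^ 2) (β := β)
    (fun z hz => by
      rw [← hW z hz, ← deriv_wronsk_two hW hz, ← hN z hz]
      exact h.wronsk_mul_deriv_deriv hz) hz
  have h2 := fun (z : ℂ) (hz : 0 < z.im) => ode_reduced hL0 h.diff' (α := χ 0 ^ 2) (β := β)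
    (fun z hz => by
      rw [← hW z hz, ← deriv_wronsk_two hW hz, ← hN z hz]
      exact h.wronsk_mul_deriv_deriv' hz) hz
  -- At `ellPt`, where m1 = 0, only β M₆ g = 0 remains of the equation, for g = v and g = u; and u -
  -- ellPt v is not 0 there.
  have hβ : β = 0 := by
    have h3 := h1 _ ellPt_im
    have h4 := h2 _ ellPt_im
    rw [m1_ellPt] at h3 h4
    have h5 : β * (g6 ellPt * (u ellPt - ellPt * v ellPt)) = 0 := by
      linear_combination ellPt * h3 - h4
    exact (mul_eq_zero.1 h5).resolve_right
      (mul_ne_zero (g6_ne_zero ellPt_im) (h.apply_ellPt_ne_zero hv hu hL0 hW))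
  refine ⟨hL0, fun z hz => ?_⟩
  have := h1 z hz
  rw [hβ] at this
  linear_combination this

end ShiftPair

/-! ### The differential equations for extremal forms -/

/-- The differential equation for extremal forms of weight `3k`. -/
theorem IsExtremal.ode_one {k : ℕ} {f : ℍ → ℂ} (hf : IsExtremal (chi ^ k) (3 * k) 1 f) :
    DifferentiableOn ℂ (fun z => (f ∘ ofComplex) z / etaRoot z ^ k) ℍₒ ∧ ∀ z, 0 < z.im →
      deriv (deriv (fun z => (f ∘ ofComplex) z / etaRoot z ^ k)) z =
        (Real.pi * I * k) ^ 2 * m4 z * ((f ∘ ofComplex) z / etaRoot z ^ k) := by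
  obtain ⟨f1, φ1, ψ, n, hkn, hQ, h1, hψ, hψ0⟩ := hf.exists_quasiLaws (add_one_le_finrank k)
  set f0 := f ∘ ofComplex
  have hp := hQ.shiftPair
  obtain ⟨χ, hχ, hχ0⟩ := hasQ_logDeriv_div (k := k) hQ.diff0 hψ hψ0
  obtain ⟨L, hL, hLn⟩ := tendsto_wronsk_div_etaRoot hQ.diff0 hQ.diff1 h1 hψ hkn
  have hne : ∀ᶠ z in imTop, f0 z / etaRoot z ^ k ≠ 0 := by
    filter_upwards [eventually_ne_zero_of_hasQ_div hψ hψ0, eventually_im_gt 0] with z h0 hz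
    exact div_ne_zero h0 (pow_ne_zero k (etaRoot_ne_zero hz))
  obtain ⟨hL0, hode⟩ := hp.ode_one (fun z hz => by
      have h0 := ne_zero_of_im hz
      rw [div_etaRoot_pow_fricke hz (j := 0) (by rw [add_zero]; exact hQ.fricke0 z hz), zpow_zero]
      field_simp)
    (fun z hz => by
      have h0 := ne_zero_of_im hz
      -- The witness is -1/(3z) · (f0 + f1/z) + f1/(3z²) = -f0/(3z).
      rw [div_etaRoot_pow_fricke hz (j := 0) (b := -(f0 z / (3 * z))) ?_, zpow_zero]
      · field_simp
      · rw [hQ.fricke0 z hz, hQ.fricke1 z hz, add_zero, zpow_sub₀ (s3_mul_ne_zero hz), zpow_ofNat,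
          mul_pow s3 z, sq s3, s3C_sq, fricke]
        field_simp
        ring) hne hχ hL
  -- An order n > k would make L = 0. With n = k the limit πi(2n - k) becomes πik.
  have hnk : n = k := le_antisymm (not_lt.1 fun h => hL0 (hLn h)) hkn
  refine ⟨hp.diff, fun z hz => ?_⟩
  rw [hode z hz, hχ0, hnk]
  ring

/-- The differential equation for extremal forms of weight `3k + 2`. -/
theorem IsExtremal.ode_two {k : ℕ} {f : ℍ → ℂ} (hf : IsExtremal (chi ^ k) (3 * k + 2) 1 f) :
    ∃ v : ℂ → ℂ, (∀ z, v z = (f ∘ ofComplex) z / etaRoot z ^ k) ∧ DifferentiableOn ℂ v ℍₒ ∧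
      ∀ z, 0 < z.im → m1 z ^ 2 * deriv (deriv v) z = 4 * m1 z * deriv m1 z * deriv v z +
        ((Real.pi * I * k) ^ 2 * m1 z ^ 6 - m1 z * deriv (deriv m1) z) * v z := by
  obtain ⟨f1, φ1, ψ, n, hkn, hQ, h1, hψ, hψ0⟩ := hf.exists_quasiLaws (add_one_le_finrank' k)
  set f0 := f ∘ ofComplex
  have hp := hQ.shiftPair
  obtain ⟨χ, hχ, hχ0⟩ := hasQ_logDeriv_div (k := k) hQ.diff0 hψ hψ0
  obtain ⟨L, hL, hLn⟩ := tendsto_wronsk_div_etaRoot hQ.diff0 hQ.diff1 h1 hψ hkn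
  have hne : ∀ᶠ z in imTop, f0 z / etaRoot z ^ k ≠ 0 := by
    filter_upwards [eventually_ne_zero_of_hasQ_div hψ hψ0, eventually_im_gt 0] with z h0 hz
    exact div_ne_zero h0 (pow_ne_zero k (etaRoot_ne_zero hz))
  obtain ⟨hL0, hode⟩ := hp.ode_two (fun z hz => by
      have h0 := ne_zero_of_im hz
      rw [div_etaRoot_pow_fricke hz (j := 2) (hQ.fricke0 z hz), zpow_ofNat, mul_pow s3 z, sq s3,
        s3C_sq]
      field_simp)
    (fun z hz => by
      have h0 := ne_zero_of_im hz
      rw [div_etaRoot_pow_fricke hz (j := 2) (b := -(f0 z / (3 * z))) ?_, zpow_ofNat,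
        mul_pow s3 z, sq s3, s3C_sq]
      · field_simp
      · rw [hQ.fricke0 z hz, hQ.fricke1 z hz, add_sub_cancel_right,
          zpow_add₀ (s3_mul_ne_zero hz), zpow_ofNat, mul_pow s3 z, sq s3, s3C_sq, fricke]
        field_simp
        ring) hne hχ hL
  have hnk : n = k := le_antisymm (not_lt.1 fun h => hL0 (hLn h)) hkn
  refine ⟨_, fun z => rfl, hp.diff, fun z hz => ?_⟩
  rw [hode z hz, hχ0, hnk]
  ring

/-- Division by `M₂` turns the equation in weight `3k + 2` into its normal form. -/
lemma deriv_deriv_div_m2 {v : ℂ → ℂ} {α : ℂ} (hv : DifferentiableOn ℂ v ℍₒ)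
    (hode : ∀ z, 0 < z.im → m1 z ^ 2 * deriv (deriv v) z = 4 * m1 z * deriv m1 z * deriv v z +
        (α * m1 z ^ 6 - m1 z * deriv (deriv m1) z) * v z)
    {z : ℂ} (hz : 0 < z.im) (h0 : m2 z ≠ 0) : deriv (deriv (fun z => v z / m2 z)) z =
      (α * m4 z + 72 * (Real.pi : ℂ) ^ 2 * (g6 z / m2 z)) * (v z / m2 z) := by
  have hm := differentiableOn_m1
  have h1 : ∀ᶠ w in 𝓝 z, deriv (fun z => v z / m2 z) w =
      deriv v w / m1 w ^ 2 - 2 * (deriv m1 w * v w) / m1 w ^ 3 := by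
    filter_upwards [eventually_mem_H hz,
      (differentiableAt_of_H isForm_m2.diff hz).continuousAt.eventually_ne h0] with w hw hw0
    have ha : m1 w ≠ 0 := fun h => hw0 ((m1_eq_zero_iff hw).1 h)
    rw [Filter.EventuallyEq.deriv_eq (f := fun z => v z / m1 z ^ 2) (by
      filter_upwards [eventually_mem_H hw] with x hx
      rw [m1_sq hx]), ((hasDerivAt_of_H hv hw).fun_div ((hasDerivAt_of_H hm hw).fun_pow 2)
      (pow_ne_zero 2 ha)).deriv]
    field_simp
    norm_num
    ring
  have ha : m1 z ≠ 0 := fun h => h0 ((m1_eq_zero_iff hz).1 h)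
  have h2 := ((hasDerivAt_of_H (differentiableOn_deriv hv) hz).fun_div
    ((hasDerivAt_of_H hm hz).fun_pow 2) (pow_ne_zero 2 ha)).fun_sub
    ((((hasDerivAt_of_H (differentiableOn_deriv hm) hz).fun_mul (hasDerivAt_of_H hv hz)).const_mul
      2).fun_div ((hasDerivAt_of_H hm hz).fun_pow 3) (pow_ne_zero 3 ha))
  rw [Filter.EventuallyEq.deriv_eq h1, h2.deriv, m4_eq hz, ← m1_sq hz]
  -- In the second derivative of v/m1² the equation for v cancels the terms with v', and beside α
  -- m1⁶ there remains -3 (m1 m1'' - 2 m1'²) = 72π² M₆.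
  have h3 := hode z hz
  have h4 := m1_bracket hz
  field_simp
  norm_num
  linear_combination m1 z ^ 2 * h3 - 3 * m1 z ^ 2 * v z * h4

/-- A branch of `M₆^{k/2}` agrees up to sign with the `k`-th power of `η(z)³η(3z)³`. -/
lemma IsBranchM6.exists_sign {k : ℕ} {h : ℍ → ℂ} (hh : IsBranchM6 k h) :
    ∃ s : ℂ, s ^ 2 = 1 ∧ ∀ z : ℂ, 0 < z.im → (h ∘ ofComplex) z = s * etaRoot z ^ k := by
  have hd : DifferentiableOn ℂ (h ∘ ofComplex) ℍₒ := differentiableOn_comp_ofComplex hh.1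
  have hcases := isPreconnected_H.eq_or_eq_neg_of_sq_eq hd.continuousOn
    (differentiableOn_etaRoot.fun_pow k).continuousOn
    (fun z hz => by
      have h1 := hh.2 (ofComplex z)
      rw [M6_eq, ofComplex_coe_eq hz, g6] at h1
      simp only [Pi.pow_apply, Function.comp_apply]
      rw [h1, ← pow_mul, ← pow_mul, mul_comm])
    (fun hz => pow_ne_zero k (etaRoot_ne_zero hz))
  rcases hcases with hc | hc
  · exact ⟨1, by norm_num, fun z hz => by rw [hc hz, one_mul]⟩
  · exact ⟨-1, by norm_num, fun z hz => by rw [hc hz, neg_one_mul]; rfl⟩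

/-- The equation is linear, so the sign that separates two branches is harmless. -/
lemma isSolution_of_eq {Q y : ℍ → ℂ} {P : Set ℍ} {Y : ℂ → ℂ} {s : ℂ}
    (heq : ∀ z : ℂ, 0 < z.im → (y ∘ ofComplex) z = s * Y z) (hm : MeromorphicOn Y ℍₒ)
    (ha : ∀ z : ℍ, z ∉ P → AnalyticAt ℂ Y z)
    (hode : ∀ z : ℍ, z ∉ P → deriv (deriv Y) z = -4 * (Real.pi : ℂ) ^ 2 * Q z * Y z) :
    IsSolution Q y P := by
  have hev : ∀ z : ℂ, 0 < z.im → (fun z => s * Y z) =ᶠ[𝓝 z] y ∘ ofComplex := fun z hz => by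
    filter_upwards [eventually_mem_H hz] with w hw using (heq w hw).symm
  refine ⟨fun z hz => ?_, fun z hz => ?_, fun z hz => ?_⟩
  · exact ((MeromorphicAt.const s z).fun_mul (hm z hz)).congr
      ((hev z hz).filter_mono nhdsWithin_le_nhds)
  · exact (analyticAt_const.fun_mul (ha z hz)).congr (hev z z.im_pos)
  · have h1 : deriv (y ∘ ofComplex) =ᶠ[𝓝 (z : ℂ)] fun w => s * deriv Y w := by
      refine (hev z z.im_pos).symm.deriv.trans (Filter.Eventually.of_forall fun w => ?_)
      exact deriv_const_mul_field s
    have h2 : y z = s * Y z := by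
      have := heq z z.im_pos
      rwa [Function.comp_apply, ofComplex_apply] at this
    rw [h1.deriv_eq, deriv_const_mul_field, hode z hz, h2]
    ring

lemma inv_eq_self_of_sq_eq_one {s : ℂ} (hs : s ^ 2 = 1) : s⁻¹ = s :=
  inv_eq_of_mul_eq_one_left (by rw [← sq, hs])

end

end QuasiThree

/-! ### The two equations for an arbitrary branch -/

open QuasiThree in
theorem mainTheorem7 (k : ℕ) :
    (∀ z, M4 z = M2 z ^ 2) ∧
    (∀ f : ℍ → ℂ, IsExtremal (chi ^ k) (3 * k) 1 f →
      ∀ h : ℍ → ℂ, IsBranchM6 k h →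
        IsSolution (fun z => ((k : ℂ) / 2) ^ 2 * M4 z) (fun z => f z / h z) ∅) ∧
    (∀ f : ℍ → ℂ, IsExtremal (chi ^ k) (3 * k + 2) 1 f →
      ∀ h : ℍ → ℂ, IsBranchM6 k h →
        IsSolution (fun z => ((k : ℂ) / 2) ^ 2 * M4 z - 18 * (M6 z / M2 z))
          (fun z => f z / (h z * M2 z)) {z | M2 z = 0}) := by
  refine ⟨fun z => by rw [M4_eq, M2_eq, m4_eq z.im_pos], fun f hf h hh => ?_, fun f hf h hh => ?_⟩
  · obtain ⟨s, hs, hsh⟩ := hh.exists_sign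
    obtain ⟨hd, hode⟩ := hf.ode_one
    have han : ∀ z : ℂ, 0 < z.im → AnalyticAt ℂ _ z := fun z hz =>
      hd.analyticAt (isOpen_H.mem_nhds hz)
    refine isSolution_of_eq (s := s) (fun z hz => ?_) (fun z hz => (han z hz).meromorphicAt)
      (fun z _ => han z z.im_pos) fun z _ => ?_
    · have h1 := hsh z hz
      simp only [Function.comp_apply] at h1 ⊢
      rw [h1, div_mul_eq_div_div_swap, div_eq_mul_inv _ s, inv_eq_self_of_sq_eq_one hs, mul_comm]
    · rw [hode z z.im_pos, M4_eq]
      -- (πik)² = -4π²(k/2)².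
      linear_combination ((Real.pi : ℂ) * k) ^ 2 * m4 z *
        ((f ∘ ofComplex) z / etaRoot z ^ k) * I_sq
  · obtain ⟨s, hs, hsh⟩ := hh.exists_sign
    obtain ⟨v, hv, hd, hode⟩ := hf.ode_two
    have han : ∀ z : ℂ, 0 < z.im → AnalyticAt ℂ v z := fun z hz =>
      hd.analyticAt (isOpen_H.mem_nhds hz)
    have han2 : ∀ z : ℂ, 0 < z.im → AnalyticAt ℂ m2 z := fun z hz =>
      isForm_m2.diff.analyticAt (isOpen_H.mem_nhds hz)
    refine isSolution_of_eq (s := s) (Y := fun z => v z / m2 z) (fun z hz => ?_)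
      (fun z hz => (han z hz).meromorphicAt.fun_div (han2 z hz).meromorphicAt)
      (fun z hz => (han z z.im_pos).fun_div (han2 z z.im_pos) ?_) fun z hz => ?_
    · have h1 := hsh z hz
      simp only [Function.comp_apply] at h1 ⊢
      rw [h1, M2_eq, ofComplex_coe_eq hz, hv, Function.comp_apply, mul_assoc,
        div_mul_eq_div_div_swap, div_eq_mul_inv _ s, inv_eq_self_of_sq_eq_one hs, mul_comm,
        div_div]
    · rwa [← M2_eq]
    · have h0 : m2 z ≠ 0 := by rwa [← M2_eq]
      rw [deriv_deriv_div_m2 hd hode z.im_pos h0, M4_eq, M6_eq, M2_eq]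
      linear_combination ((Real.pi : ℂ) * k) ^ 2 * m4 z * (v z / m2 z) * I_sq
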